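/- **Setting.** Fix $M>1$, $m>0$ and a cutoff index $\rho\in\mathbb N$. On $\mathbb R^4$ the propagator with cutoff is $C_\rho=\sum_{i=0}^{\rho}C^i$, where $$C^i(x,y)=\int_{I_i}\frac{dt}{(4\pi t)^{2}}\,e^{-|x-y|^2/4t-tm^2},\qquad I_0=[1,\infty),\quad I_i=[M^{-2i},M^{-2(i-1)}]\ (i\ge 1).$$ A graph $G$ of $\phi^4_4$ with $n=n(G)$ vertices and $N=N(G)$ external legs is an amputated Wick contraction of $n$ labelled four-valent vertices with $N$ labelled external legs; it enters every sum over graphs with its weight $\frac1{n!\,(4!)^n}$. All sums are restricted to connected graphs without two-point subgraphs. A subgraph $h$ is a set of internal lines together with their end vertices, and $N(h)$ is the number of half-lines at its vertices that do not belong to its lines. A scale assignment is $\mu=(i_l)_l\in\{0,\dots,\rho\}^{I(G)}$ ($I(G)$ is the number of internal lines); external legs of $G$ have scale $-1$. For a subgraph $h$ let $i_h$ be the minimum of the scales of its lines and $e_h$ the maximum of the scales of its external legs (the lines of $G$ outside $h$ attached to $h$, and the external legs of $G$). Let $D_\mu(G)$ be the set of connected subgraphs $h$ with at least one line, $N(h)=4$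 and $i_h>e_h$; it is a forest. Let $e_\nu(\mu)$ be the maximum of the scales of the lines and legs attached to the vertex $\nu$. The amplitude $A_{G,\mu}$ is the distribution $a\mapsto\int\prod_\nu dx_\nu\prod_{l}C^{i_l}(x_l,y_l)\,a(x_{\nu(1)},\dots,x_{\nu(N)})$ on Schwartz functions $a$ on $(\mathbb R^4)^N$, where the $j$-th external leg is attached to the vertex $\nu(j)$. The operator $\tau_h$ (Taylor expansion of order $0$ at zero external momenta) moves all external legs of $h$ to one and the same external vertex of $h$; products of $\tau$'s over a subset of the forest $D_\mu(G)$ are applied from inside to outside. For a four-point graph $H$, $\tau_HA_{H,\mu}$ also denotes the number by which the local vertex $a\mapsto\int a(x,x,x,x)\,dx$ is multiplied, i.e. the value at zero external momenta. The bare series of the connected $N$-point function is the formal series in $\lambda_\rho$ $$C_N^\rho=\sum_{G:\,N(G)=N}\ \sum_{\mu\in\{0,\dots,\rho\}^{I(G)}}(-\lambda_\rho)^{n(G)}A_{G,\mu}.$$ **Theorem (effective series).** All the integrals that define the amplitudes, with or without operators $\tau$, converge absolutely. There exist $\rho+1$ formal power series in $\lambda_\rho=\lambda_\rho^\rho$,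 denoted $\lambda^\rho_{\rho-1},\dots,\lambda^\rho_{-1}$ and depending on neither $N$ nor the test function, such that for every $N$, as formal power series in $\lambda_\rho$ (with distributions as coefficients), $$C_N^\rho=\sum_{G:\,N(G)=N}\ \sum_{\mu\in\{0,\dots,\rho\}^{I(G)}}\ \prod_{\nu\in\mathcal V(G)}\bigl(-\lambda^\rho_{e_\nu(\mu)}\bigr)\,A^{UR}_{G,\mu},\qquad A^{UR}_{G,\mu}=\prod_{h\in D_\mu(G)}(1-\tau_h)\,A_{G,\mu},$$ and such that, for $-1\le i<\rho$, $$-\lambda_i^\rho=-\lambda_{i+1}^\rho+\sum_{H:\,N(H)=4}\ \sum_{\mu(H):\,i_H=i+1}\ \prod_{\nu\in\mathcal V(H)}\bigl(-\lambda^\rho_{e_\nu(\mu)}\bigr)\prod_{h\in D_\mu(H),\,h\neq H}(1-\tau_h)\ \tau_HA_{H,\mu},$$ the sum running over graphs $H$ with at least one internal line. The infinite sums over graphs converge as formal power series: every coefficient of the partial sums by number of vertices is eventually constant. -/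

import Mathlib

open scoped SchwartzMap PowerSeries

namespace Phi4

/-- Euclidean space-time of dimension four. -/
abbrev Space : Type := EuclideanSpace ℝ (Fin 4)

/-- Integrand of the parametric representation of the propagator of mass `m` in dimension
four, where `(4 π t) ^ (D / 2) = (4 π t) ^ 2`. -/
noncomputable def heatKernel (m t : ℝ) (x y : Space) : ℝ :=
  Real.exp (-(‖x - y‖ ^ 2) / (4 * t) - t * m ^ 2) / (4 * Real.pi * t) ^ 2

/-- The propagator `C^i(x, y)` of the slice `i`: the parameter `t` runs over `[1, ∞)` for `i = 0`
and over `[M^(-2i), M^(-2(i-1))]` for `i ≥ 1`. -/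
noncomputable def propagator (M m : ℝ) : ℕ → Space → Space → ℝ
  | 0, x, y => ∫ t in Set.Ioi (1 : ℝ), heatKernel m t x y
  | i + 1, x, y => ∫ t in Set.Ioc ((M ^ (2 * (i + 1)))⁻¹) ((M ^ (2 * i))⁻¹), heatKernel m t x y

theorem propagator_symm (M m : ℝ) (i : ℕ) (x y : Space) :
    propagator M m i x y = propagator M m i y x := by
  cases i <;> simp only [propagator, heatKernel, norm_sub_rev]

/-- Half-lines attached to `n` four-valent vertices: `(v, k)` is the `k`-th half-line of `v`. -/
abbrev HalfLine (n : ℕ) : Type := Fin n × Fin 4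

/-- An amputated graph of `φ⁴` with `n` labelled vertices and `N` labelled external legs, that is,
a Wick contraction of `φ(y₁) ⋯ φ(y_N) φ⁴(x₁) ⋯ φ⁴(x_n)` in which no two external fields are
contracted together: each half-line either carries exactly one external leg or belongs to exactly
one internal line. -/
@[ext] structure FeynmanGraph (n N : ℕ) where
  /-- the internal lines, as unordered pairs of half-lines -/
  lines : Finset (Sym2 (HalfLine n))
  /-- the half-line that carries a given external leg -/
  leg : Fin N → HalfLine n
  leg_injective : Function.Injective leg
  not_isDiag : ∀ l ∈ lines, ¬ l.IsDiag
  lines_disjoint : ∀ l ∈ lines, ∀ l' ∈ lines, ∀ e, e ∈ l → e ∈ l' → l = l'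
  leg_notMem : ∀ l ∈ lines, ∀ j, leg j ∉ l
  covered : ∀ e, (∃ l ∈ lines, e ∈ l) ∨ ∃ j, leg j = e

noncomputable instance (n N : ℕ) : Fintype (FeynmanGraph n N) :=
  Fintype.ofInjective (fun G : FeynmanGraph n N => (G.lines, G.leg)) (by
    intro G G' h
    simp only [Prod.mk.injEq] at h
    exact FeynmanGraph.ext h.1 h.2)

namespace FeynmanGraph

/-- The internal lines of `G`, as a type. -/
abbrev Line {n N : ℕ} (G : FeynmanGraph n N) : Type := {l // l ∈ G.lines}

/-- A scale assignment `μ ∈ ⟦0, ρ⟧^{I(G)}`. -/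
abbrev Scales {n N : ℕ} (G : FeynmanGraph n N) (ρ : ℕ) : Type := G.Line → Fin (ρ + 1)

/-- A subgraph is a set of internal lines, together with the vertices they touch. -/
abbrev Sub {n N : ℕ} (G : FeynmanGraph n N) : Type := Finset G.Line

open Classical in
/-- The vertices of a subgraph. -/
noncomputable def verts {n N : ℕ} (G : FeynmanGraph n N) (h : G.Sub) : Finset (Fin n) :=
  Finset.univ.filter fun v => ∃ l ∈ h, ∃ k : Fin 4, (v, k) ∈ l.1

open Classical in
/-- The coordination of the vertex `v` in the subgraph `h` (a line from `v` to itself is attached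
twice to `v`). -/
noncomputable def coord {n N : ℕ} (G : FeynmanGraph n N) (h : G.Sub) (v : Fin n) : ℕ :=
  (Finset.univ.filter fun k : Fin 4 => ∃ l ∈ h, (v, k) ∈ l.1).card

open Classical in
/-- The external vertices of a subgraph: those of coordination one, two or three in it. -/
noncomputable def extVerts {n N : ℕ} (G : FeynmanGraph n N) (h : G.Sub) : Finset (Fin n) :=
  (G.verts h).filter fun v => G.coord h v < 4

/-- The number of external legs of a subgraph. -/
noncomputable def numLegs {n N : ℕ} (G : FeynmanGraph n N) (h : G.Sub) : ℕ :=
  ∑ v ∈ G.extVerts h, (4 - G.coord h v)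

/-- Two vertices are joined by a line of the subgraph `h`. -/
def Joined {n N : ℕ} (G : FeynmanGraph n N) (h : G.Sub) (v w : Fin n) : Prop :=
  ∃ l ∈ h, ∃ k k' : Fin 4, l.1 = s((v, k), (w, k'))

/-- A (non-empty) subgraph is connected. -/
def SubConnected {n N : ℕ} (G : FeynmanGraph n N) (h : G.Sub) : Prop :=
  h.Nonempty ∧ ∀ v ∈ G.verts h, ∀ w ∈ G.verts h, Relation.ReflTransGen (G.Joined h) v w

/-- The whole graph is connected (the graph formed of a single vertex without lines is). -/
def Connected {n N : ℕ} (G : FeynmanGraph n N) : Prop :=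
  0 < n ∧ ∀ v w : Fin n, Relation.ReflTransGen (G.Joined Finset.univ) v w

/-- The graph has no subgraph with two external legs. -/
def NoTwoPoint {n N : ℕ} (G : FeynmanGraph n N) : Prop :=
  ∀ h : G.Sub, G.numLegs h ≠ 2

/-- The line `l` is attached to the vertex `v`. -/
def Attached {n N : ℕ} (G : FeynmanGraph n N) (l : G.Line) (v : Fin n) : Prop :=
  ∃ k : Fin 4, (v, k) ∈ l.1

/-- `h` is quasi-local for `μ`: it is connected and `i_h(μ) > e_h(μ)`, all its lines being strictly
above all the lines of `G` outside `h` that are attached to `h`. The external legs of `G` have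
scale `-1`, so they put no constraint. -/
def QuasiLocal {n N ρ : ℕ} (G : FeynmanGraph n N) (μ : G.Scales ρ) (h : G.Sub) : Prop :=
  G.SubConnected h ∧
    ∀ l ∈ h, ∀ l' ∉ h, (∃ v ∈ G.verts h, G.Attached l' v) → μ l' < μ l

open Classical in
/-- The forest `D_μ(G)` of the dangerous subgraphs: the quasi-local ones with four external legs.
It contains `G` itself if `G` has four external legs and at least one internal line. -/
noncomputable def dangerous {n N ρ : ℕ} (G : FeynmanGraph n N) (μ : G.Scales ρ) : Finset G.Sub :=
  Finset.univ.filter fun h => G.QuasiLocal μ h ∧ G.numLegs h = 4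

open Classical in
/-- The scale `e_ν(μ)` of the highest line attached to the vertex `v`, external legs having
scale `-1`. -/
noncomputable def vertexScale {n N ρ : ℕ} (G : FeynmanGraph n N) (μ : G.Scales ρ) (v : Fin n) : ℤ :=
  (insert (-1 : ℤ) ((Finset.univ.filter fun l => G.Attached l v).image
    fun l => ((μ l : ℕ) : ℤ))).max' (Finset.insert_nonempty _ _)

open Classical in
/-- The vertex to which the counterterm of a subgraph `h` moves the external legs of `h`: one of
the external vertices of `h`. By translation invariance, the value of a counterterm does not depend
on which one. The value `v` is used if there is none. -/
noncomputable def anchor {n N : ℕ} (G : FeynmanGraph n N) (h : G.Sub) (v : Fin n) : Fin n :=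
  if hne : (G.extVerts h).Nonempty then (G.extVerts h).min' hne else v

open Classical in
/-- The vertex at which the half-line `e` sits once the operators `τ_h`, `h ∈ F`, have been applied
for a forest `F`. The operator `τ_h` moves the half-lines at the vertices of `h` that are not part
of the lines of `h` to one same vertex of `h`. The elements of the forest `F` that have `e` as an
external leg are nested, and the largest one, which is their union, decides the position of `e`;
`e` stays at its vertex if there are none. -/
noncomputable def position {n N : ℕ} (G : FeynmanGraph n N) (F : Finset G.Sub) (e : HalfLine n) :
    Fin n :=
  G.anchor ((F.filter fun h => e.1 ∈ G.verts h ∧ ∀ l ∈ h, e ∉ l.1).biUnion id) e.1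

/-- The product of the propagators of the internal lines after `∏_{h ∈ F} τ_h`, as a function of
the positions of the vertices. -/
noncomputable def lineProduct {n N ρ : ℕ} (M m : ℝ) (G : FeynmanGraph n N) (μ : G.Scales ρ)
    (F : Finset G.Sub) (x : Fin n → Space) : ℝ :=
  ∏ l : G.Line, Sym2.lift ⟨fun e e' =>
    propagator M m (μ l) (x (G.position F e)) (x (G.position F e')),
    fun _ _ => propagator_symm M m _ _ _⟩ l.1

/-- The integrand of `∏_{h ∈ F} τ_h A_{G,μ}` smeared with the test function `a` of the positions
of the `N` external legs. -/
noncomputable def integrand {n N ρ : ℕ} (M m : ℝ) (G : FeynmanGraph n N) (μ : G.Scales ρ)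
    (F : Finset G.Sub) (a : (Fin N → Space) → ℝ) (x : Fin n → Space) : ℝ :=
  G.lineProduct M m μ F x * a (fun j => x (G.position F (G.leg j)))

/-- `∏_{h ∈ F} τ_h A_{G,μ}` smeared with `a`; for `F = ∅` this is the bare amplitude `A_{G,μ}`. -/
noncomputable def amplitude {n N ρ : ℕ} (M m : ℝ) (G : FeynmanGraph n N) (μ : G.Scales ρ)
    (F : Finset G.Sub) (a : (Fin N → Space) → ℝ) : ℝ :=
  ∫ x : Fin n → Space, G.integrand M m μ F a x

/-- The usefully renormalized amplitude `A^{UR}_{G,μ} = ∏_{h ∈ D_μ(G)} (1 - τ_h) A_{G,μ}`, smeared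
with `a`; the product is expanded over the subsets of the forest `D_μ(G)`. -/
noncomputable def renAmplitude {n N ρ : ℕ} (M m : ℝ) (G : FeynmanGraph n N) (μ : G.Scales ρ)
    (a : (Fin N → Space) → ℝ) : ℝ :=
  ∑ F ∈ (G.dangerous μ).powerset, (-1) ^ F.card * G.amplitude M m μ F a

/-- The positions of all the vertices, when `v₀` sits at the origin. -/
noncomputable def pinned {n : ℕ} (v₀ : Fin n) (y : {v : Fin n // v ≠ v₀} → Space) (v : Fin n) :
    Space :=
  if hv : v ≠ v₀ then y ⟨v, hv⟩ else 0

/-- The number `∏_{h ∈ F} τ_h τ_G A_{G,μ}`, that is, the value at zero external momenta of the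
amplitude `∏_{h ∈ F} τ_h A_{G,μ}` stripped of its momentum conservation: one external vertex is
fixed at the origin and all the others are integrated over. As a distribution in the external
points, `τ_G` of the amplitude is this number times the local vertex. -/
noncomputable def localPart {n N ρ : ℕ} (M m : ℝ) (G : FeynmanGraph n N) (μ : G.Scales ρ)
    (F : Finset G.Sub) : ℝ :=
  if hne : (G.extVerts Finset.univ).Nonempty then
    ∫ y : {v : Fin n // v ≠ (G.extVerts Finset.univ).min' hne} → Space,
      G.lineProduct M m μ F (pinned _ y)
  else 0

open Classical in
/-- The number `∏_{h ∈ D_μ(G), h ≠ G} (1 - τ_h) τ_G A_{G,μ}`. -/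
noncomputable def renLocalPart {n N ρ : ℕ} (M m : ℝ) (G : FeynmanGraph n N) (μ : G.Scales ρ) : ℝ :=
  ∑ F ∈ ((G.dangerous μ).erase Finset.univ).powerset, (-1) ^ F.card * G.localPart M m μ F

/-- The lowest scale `i_G(μ)` of the internal lines of `G` is `i` (so `G` has a line). -/
def LowestScale {n N ρ : ℕ} (G : FeynmanGraph n N) (μ : G.Scales ρ) (i : ℤ) : Prop :=
  (∃ l, ((μ l : ℕ) : ℤ) = i) ∧ ∀ l, i ≤ ((μ l : ℕ) : ℤ)

end FeynmanGraph

open Classical in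
/-- The connected graphs with `n` vertices and `N` external legs, without two-point subgraphs. -/
noncomputable def graphs (n N : ℕ) : Finset (FeynmanGraph n N) :=
  Finset.univ.filter fun G => G.Connected ∧ G.NoTwoPoint

/-- The weight `1 / (n! (4!)^n)` of each Wick contraction with `n` vertices. -/
noncomputable def weight (n : ℕ) : ℝ :=
  ((n.factorial : ℝ) * (Nat.factorial 4 : ℝ) ^ n)⁻¹

/-- The bare series: the formal power series in `λ_ρ`, written `X`, of the connected `N`-point
function smeared with `a`. -/
noncomputable def bareSeries (M m : ℝ) (ρ N : ℕ) (a : (Fin N → Space) → ℝ) : ℝ⟦X⟧ :=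
  PowerSeries.mk fun n => (-1) ^ n *
    (weight n * ∑ G ∈ graphs n N, ∑ μ : G.Scales ρ, G.amplitude M m μ ∅ a)

/-- The contribution of the graphs with `n` vertices to the effective series, for the effective
constants `lam i`. -/
noncomputable def effectiveTerm (M m : ℝ) (ρ N : ℕ) (lam : ℤ → ℝ⟦X⟧) (a : (Fin N → Space) → ℝ)
    (n : ℕ) : ℝ⟦X⟧ :=
  weight n • ∑ G ∈ graphs n N, ∑ μ : G.Scales ρ,
    G.renAmplitude M m μ a • ∏ v : Fin n, (-lam (G.vertexScale μ v))

open Classical in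
/-- The contribution of the four-point graphs `H` with `n` vertices and lowest scale `i + 1` to the
flow from `-lam (i + 1)` to `-lam i`. -/
noncomputable def flowTerm (M m : ℝ) (ρ : ℕ) (lam : ℤ → ℝ⟦X⟧) (i : ℤ) (n : ℕ) : ℝ⟦X⟧ :=
  weight n • ∑ H ∈ graphs n 4, ∑ μ : H.Scales ρ with H.LowestScale μ (i + 1),
    H.renLocalPart M m μ • ∏ v : Fin n, (-lam (H.vertexScale μ v))

/-- `S` is the sum of the formal power series `T n`: each coefficient of the partial sums is
eventually constant, equal to that of `S`. -/
def FormalHasSum (T : ℕ → ℝ⟦X⟧) (S : ℝ⟦X⟧) : Prop :=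
  ∀ k : ℕ, ∀ᶠ p in Filter.atTop,
    PowerSeries.coeff k (∑ n ∈ Finset.range p, T n) = PowerSeries.coeff k S

end Phi4

/-! The effective series is a resummation of the bare series, done one scale at a time from the
cutoff downwards. Every pair of a graph and a forest `F` of its dangerous subgraphs gets a weight: a
factor `s` of the lowest scale for each element of `F` and a factor `κ` of the vertex scale for each
vertex (`forestSum`). If `s` vanishes on all scales that occur and `κ` is the bare constant, only
the empty forest survives and the sum is the bare series. If `s = -1` and `κ` is minus the effective
constant, it is the effective series. At stage `j` the elements of lowest scale above `ρ - j` have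
weight `-1`, the others weight `0`, and the constants no longer vary below the scale `ρ - j`.

To cross the scale `c = ρ - j`, let a parameter `t` go from `0` to `1`: elements of lowest scale `c`
get the weight `-t`, and `t δ` is added to `κ e` for `e < c`, where `δ` is the sum of the flow terms
of scale `c`. The derivative in `t` is `δ` times the sum over graphs with one marked vertex of scale
below `c`, minus the sum over forests with one marked element `h` of lowest scale `c`. No element of
nonzero weight strictly contains `h`, because it would have a line attached to `h` and therefore of
scale below `c`; the other elements lie inside `h` or do not touch it. Contracting `h` to a vertex
thus factorizes both the forest and, by translation invariance, the amplitude (`amplitude_glue`).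
The weights `1 / (n! (4!)^n)` match the number of ways to insert a four-point graph in a vertex
(`insertion`). So the second sum is the convolution of the flow terms with the first one
(`markedTotal_eq`), and the derivative vanishes as a formal series. Only one element being marked,
the number of subgraphs of scale `c` that are contracted together never has to be counted.

Only finite sums are used: the derivative of the sum over graphs with fewer than `p` vertices is
divisible by `X ^ p`, hence so is the difference of its values at `1` and `0`
(`X_pow_dvd_forestSum_sub`). That `δ` does not depend on `t` is `flowSum_switched`.

Absolute convergence comes from the mass. Each slice decays exponentially, and the lines still
connect all the vertices after the operators `τ` have moved them (`reach_of_quasiLocal`), so all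
relative positions are controlled. The test function, or the pinned vertex, controls the remaining
global translation. -/

namespace Phi4

open MeasureTheory

/-! ### Exponential decay of the slices of the propagator -/

theorem heatKernel_nonneg (m t : ℝ) (x y : Space) : 0 ≤ heatKernel m t x y := by
  unfold heatKernel; positivity

theorem heatKernel_add_right (m t : ℝ) (x y c : Space) :
    heatKernel m t (x + c) (y + c) = heatKernel m t x y := by
  simp [heatKernel]

theorem propagator_add_right (M m : ℝ) (i : ℕ) (x y c : Space) :
    propagator M m i (x + c) (y + c) = propagator M m i x y := by
  cases i <;> simp only [propagator, heatKernel_add_right]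

/-- The range of the parameter in the slice `i`. -/
def slice (M : ℝ) : ℕ → Set ℝ
  | 0 => Set.Ioi 1
  | i + 1 => Set.Ioc ((M ^ (2 * (i + 1)))⁻¹) ((M ^ (2 * i))⁻¹)

theorem propagator_eq (M m : ℝ) (i : ℕ) (x y : Space) :
    propagator M m i x y = ∫ t in slice M i, heatKernel m t x y := by
  cases i <;> rfl

theorem slice_subset {M : ℝ} (hM : 1 < M) (i : ℕ) : ∃ t₀ > 0, slice M i ⊆ Set.Ioi t₀ := by
  cases i with
  | zero => exact ⟨1, one_pos, le_rfl⟩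
  | succ i => exact ⟨(M ^ (2 * (i + 1)))⁻¹, by positivity, fun t ht => ht.1⟩

theorem measurableSet_slice (M : ℝ) (i : ℕ) : MeasurableSet (slice M i) := by
  cases i
  · exact measurableSet_Ioi
  · exact measurableSet_Ioc

theorem measurable_heatKernel (m : ℝ) :
    Measurable fun p : (Space × Space) × ℝ => heatKernel m p.2 p.1.1 p.1.2 := by
  unfold heatKernel
  fun_prop

theorem propagator_nonneg (M m : ℝ) (i : ℕ) (x y : Space) : 0 ≤ propagator M m i x y := by
  rw [propagator_eq]
  exact integral_nonneg fun t => heatKernel_nonneg m t x y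

theorem measurable_propagator (M m : ℝ) (i : ℕ) :
    Measurable fun p : Space × Space => propagator M m i p.1 p.2 := by
  simp only [propagator_eq]
  exact ((measurable_heatKernel m).stronglyMeasurable.integral_prod_right
    (ν := volume.restrict (slice M i))).measurable

/-- Each slice of the propagator decays exponentially. -/
theorem propagator_le {M m : ℝ} (hM : 1 < M) (hm : 0 < m) (i : ℕ) :
    ∃ K > 0, ∀ x y, propagator M m i x y ≤ K * Real.exp (-(m / 2) * ‖x - y‖) := by
  obtain ⟨t₀, ht₀, hsub⟩ := slice_subset hM i
  have hint : IntegrableOn (fun t : ℝ => Real.exp (-(m ^ 2 / 2) * t)) (slice M i) :=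
    (integrableOn_exp_mul_Ioi (by nlinarith [sq_nonneg m, sq_pos_of_pos hm]) t₀).mono_set hsub
  set B : ℝ := ((4 * Real.pi * t₀) ^ 2)⁻¹ with hB
  have hBpos : 0 < B := by positivity
  set K := ∫ t in slice M i, B * Real.exp (-(m ^ 2 / 2) * t) with hK
  have hKnn : 0 ≤ K := integral_nonneg fun t => by positivity
  refine ⟨K + 1, by positivity, fun x y => ?_⟩
  set r := ‖x - y‖ with hr
  have hrnn : 0 ≤ r := norm_nonneg _
  have key : ∀ t ∈ slice M i, heatKernel m t x y ≤
      B * Real.exp (-(m ^ 2 / 2) * t) * Real.exp (-(m / 2) * r) := by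
    intro t ht
    have htt : t₀ < t := hsub ht
    have htpos : 0 < t := ht₀.trans htt
    unfold heatKernel
    rw [mul_assoc B, ← Real.exp_add, div_eq_inv_mul]
    have h1 : ((4 * Real.pi * t) ^ 2)⁻¹ ≤ B := by
      rw [hB]; gcongr
    have h2 : -(‖x - y‖ ^ 2) / (4 * t) - t * m ^ 2 ≤ -(m ^ 2 / 2) * t + -(m / 2) * r := by
      rw [← hr]
      -- This is `(r - m t) ^ 2 ≥ 0`. Half of the mass term is traded for decay in `r`; the other
      -- half keeps the integral over `t` finite on the unbounded slice.
      have : -(r ^ 2) / (4 * t) ≤ -(m / 2) * r + (m ^ 2 / 2) * t := by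
        rw [div_le_iff₀ (by positivity)]
        nlinarith [sq_nonneg (r - m * t), mul_pos htpos htpos, sq_nonneg (m * t)]
      nlinarith
    gcongr
  rw [propagator_eq]
  have hI : IntegrableOn (fun t => B * Real.exp (-(m ^ 2 / 2) * t) * Real.exp (-(m / 2) * r))
      (slice M i) := (hint.const_mul B).mul_const _
  calc ∫ t in slice M i, heatKernel m t x y
      ≤ ∫ t in slice M i, B * Real.exp (-(m ^ 2 / 2) * t) * Real.exp (-(m / 2) * r) :=
        integral_mono_of_nonneg (Filter.Eventually.of_forall fun t => heatKernel_nonneg m t x y) hI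
          ((ae_restrict_iff' (measurableSet_slice M i)).2 (Filter.Eventually.of_forall key))
    _ = K * Real.exp (-(m / 2) * r) := by rw [integral_mul_const]
    _ ≤ (K + 1) * Real.exp (-(m / 2) * r) := by gcongr; linarith

theorem exists_propagator_le {M m : ℝ} (hM : 1 < M) (hm : 0 < m) (ρ : ℕ) :
    ∃ K > 0, ∀ i : Fin (ρ + 1), ∀ x y,
      propagator M m i x y ≤ K * Real.exp (-(m / 2) * ‖x - y‖) := by
  choose K hK h using fun i : Fin (ρ + 1) => propagator_le hM hm (i : ℕ)
  refine ⟨∑ i, K i, Finset.sum_pos (fun i _ => hK i) Finset.univ_nonempty, fun i x y => ?_⟩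
  refine (h i x y).trans ?_
  gcongr
  exact Finset.single_le_sum (fun j _ => (hK j).le) (Finset.mem_univ i)

/-- An exponential is dominated by any power. -/
theorem exists_exp_le_pow {c : ℝ} (hc : 0 < c) (R : ℕ) :
    ∃ K > 0, ∀ r : ℝ, 0 ≤ r → Real.exp (-c * r) ≤ K * ((1 + r) ^ R)⁻¹ := by
  refine ⟨Real.exp c * (R.factorial / c ^ R), by positivity, fun r hr => ?_⟩
  have h := Real.pow_div_factorial_le_exp (x := c * (1 + r)) (by positivity) R
  rw [mul_pow, div_le_iff₀ (by positivity)] at h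
  have h2 : Real.exp (c * (1 + r)) = Real.exp c * Real.exp (c * r) := by
    rw [← Real.exp_add]; ring_nf
  rw [h2] at h
  rw [neg_mul, Real.exp_neg, ← div_eq_mul_inv, le_div_iff₀ (by positivity),
    inv_mul_le_iff₀ (Real.exp_pos _)]
  rw [mul_div_assoc', mul_div_assoc', le_div_iff₀ (by positivity)]
  linarith

/-! ### Integrability for a connected system of lines -/

section LineSystem

variable {V L : Type*} [Fintype L]

/-- The total length of the lines. -/
noncomputable def totalLength (p q : L → V) (x : V → Space) : ℝ := ∑ l, ‖x (p l) - x (q l)‖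

theorem totalLength_nonneg (p q : L → V) (x : V → Space) : 0 ≤ totalLength p q x :=
  Finset.sum_nonneg fun _ _ => norm_nonneg _

/-- In a connected system of lines, distances are controlled by the total length. -/
theorem exists_dist_le_totalLength (p q : L → V)
    (v w : V) (h : Relation.ReflTransGen
      (fun v w => ∃ l, (v = p l ∧ w = q l) ∨ (v = q l ∧ w = p l)) v w) :
    ∃ k : ℕ, ∀ x : V → Space, ‖x v - x w‖ ≤ k * totalLength p q x := by
  induction h with
  | refl => exact ⟨0, fun x => by simp⟩
  | tail _ hl ih =>
    obtain ⟨k, hk⟩ := ih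
    obtain ⟨l, hl⟩ := hl
    refine ⟨k + 1, fun x => ?_⟩
    have h1 : ‖x (p l) - x (q l)‖ ≤ totalLength p q x :=
      Finset.single_le_sum (f := fun l => ‖x (p l) - x (q l)‖)
        (fun _ _ => norm_nonneg _) (Finset.mem_univ l)
    have h2 := hk x
    push_cast
    rename_i b c _
    have h3 : ‖x b - x c‖ ≤ totalLength p q x := by
      rcases hl with ⟨rfl, rfl⟩ | ⟨rfl, rfl⟩
      · exact h1
      · rwa [norm_sub_rev]
    have h4 : ‖x v - x c‖ ≤ ‖x v - x b‖ + ‖x b - x c‖ := norm_sub_le_norm_sub_add_norm_sub ..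
    linarith

theorem exists_sum_le_totalLength [Fintype V] (p q : L → V)
    (h : ∀ v w, Relation.ReflTransGen
      (fun v w => ∃ l, (v = p l ∧ w = q l) ∨ (v = q l ∧ w = p l)) v w) (v₀ : V) :
    ∃ c > 0, ∀ x : V → Space, c * ∑ v, ‖x v - x v₀‖ ≤ totalLength p q x := by
  choose k hk using fun v => exists_dist_le_totalLength p q v v₀ (h v v₀)
  refine ⟨(1 + ∑ v, (k v : ℝ))⁻¹, by positivity, fun x => ?_⟩
  rw [inv_mul_le_iff₀ (by positivity)]
  calc ∑ v, ‖x v - x v₀‖ ≤ ∑ v, (k v : ℝ) * totalLength p q x :=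
        Finset.sum_le_sum fun v _ => hk v x
    _ = (∑ v, (k v : ℝ)) * totalLength p q x := by rw [Finset.sum_mul]
    _ ≤ _ := by nlinarith [totalLength_nonneg p q x]

/-- The exponent `5` is the first integer above the dimension four of `Space`. -/
theorem integrable_prod_inv_one_add_norm [Fintype V] :
    Integrable fun x : V → Space => ∏ v, ((1 + ‖x v‖) ^ 5)⁻¹ := by
  refine Integrable.fintype_prod (f := fun (_ : V) (y : Space) => ((1 + ‖y‖) ^ 5)⁻¹) fun v => ?_
  have := integrable_one_add_norm (E := Space) (μ := volume) (r := 5) (by simp; norm_num)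
  refine this.congr (Filter.Eventually.of_forall fun y => ?_)
  simp only
  rw [Real.rpow_neg (by positivity)]
  norm_cast

/-- A function with the decay of the lines of a connected system, and rapid decay in one point,
is integrable. -/
theorem integrable_of_le_exp_totalLength [Fintype V] (p q : L → V)
    (h : ∀ v w, Relation.ReflTransGen
      (fun v w => ∃ l, (v = p l ∧ w = q l) ∨ (v = q l ∧ w = p l)) v w) (v₀ : V)
    {f : (V → Space) → ℝ} (hf : AEStronglyMeasurable f) {c : ℝ} (hc : 0 < c)
    (hle : ∀ R : ℕ, ∃ K, ∀ x,
      ‖f x‖ ≤ K * Real.exp (-c * totalLength p q x) * ((1 + ‖x v₀‖) ^ R)⁻¹) :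
    Integrable f := by
  classical
  obtain ⟨d, hd, hdx⟩ := exists_sum_le_totalLength p q h v₀
  -- The decay in `x v₀` is shared out between all the vertices, a power `5` for each.
  obtain ⟨K, hK⟩ := hle (5 * Fintype.card V)
  obtain ⟨K', hK', hexp⟩ := exists_exp_le_pow (mul_pos hc hd) 5
  refine Integrable.mono' ((integrable_prod_inv_one_add_norm (V := V)).const_mul
    (|K| * K' ^ Fintype.card V)) hf (Filter.Eventually.of_forall fun x => (hK x).trans ?_)
  have h1 : Real.exp (-c * totalLength p q x) ≤ ∏ v, (K' * ((1 + ‖x v - x v₀‖) ^ 5)⁻¹) := by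
    calc Real.exp (-c * totalLength p q x) ≤ Real.exp (∑ v, -(c * d) * ‖x v - x v₀‖) := by
          rw [Real.exp_le_exp, ← Finset.mul_sum]
          nlinarith [hdx x]
      _ = ∏ v, Real.exp (-(c * d) * ‖x v - x v₀‖) := Real.exp_sum ..
      _ ≤ _ := Finset.prod_le_prod (fun _ _ => (Real.exp_pos _).le)
          fun v _ => hexp _ (norm_nonneg _)
  have h2 : ((1 + ‖x v₀‖) ^ (5 * Fintype.card V))⁻¹ = ∏ _v : V, ((1 + ‖x v₀‖) ^ 5)⁻¹ := by
    rw [Finset.prod_const, pow_mul, Finset.card_univ, inv_pow]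
  calc K * Real.exp (-c * totalLength p q x) * ((1 + ‖x v₀‖) ^ (5 * Fintype.card V))⁻¹
      ≤ |K| * (∏ v, (K' * ((1 + ‖x v - x v₀‖) ^ 5)⁻¹)) * ∏ _v : V, ((1 + ‖x v₀‖) ^ 5)⁻¹ := by
        rw [h2]
        gcongr
        exact le_abs_self K
    _ = |K| * K' ^ Fintype.card V *
        ∏ v, (((1 + ‖x v - x v₀‖) ^ 5)⁻¹ * ((1 + ‖x v₀‖) ^ 5)⁻¹) := by
        rw [Finset.prod_mul_distrib, Finset.prod_mul_distrib, Finset.prod_const, Finset.card_univ]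
        ring
    _ ≤ _ := by
        gcongr with v
        rw [← mul_inv, ← mul_pow]
        gcongr
        -- It gives `1 + ‖x v‖ ≤ (1 + ‖x v - x v₀‖) * (1 + ‖x v₀‖)`.
        have : ‖x v‖ ≤ ‖x v - x v₀‖ + ‖x v₀‖ := by
          simpa using norm_add_le (x v - x v₀) (x v₀)
        nlinarith [norm_nonneg (x v - x v₀), norm_nonneg (x v₀)]

/-- The same with the point `v₀` fixed at the origin. -/
theorem integrable_pinned_of_le_exp_totalLength {n : ℕ} (p q : L → Fin n)
    (h : ∀ v w, Relation.ReflTransGen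
      (fun v w => ∃ l, (v = p l ∧ w = q l) ∨ (v = q l ∧ w = p l)) v w) (v₀ : Fin n)
    {f : (Fin n → Space) → ℝ} (hf : Measurable f)
    {c K : ℝ} (hc : 0 < c) (hle : ∀ x, ‖f x‖ ≤ K * Real.exp (-c * totalLength p q x)) :
    Integrable fun y : {v : Fin n // v ≠ v₀} → Space => f (FeynmanGraph.pinned v₀ y) := by
  classical
  obtain ⟨d, hd, hdx⟩ := exists_sum_le_totalLength p q h v₀
  obtain ⟨K', hK', hexp⟩ := exists_exp_le_pow (mul_pos hc hd) 5
  have hmeas : Measurable fun y : {v : Fin n // v ≠ v₀} → Space =>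
      FeynmanGraph.pinned v₀ y := by
    refine measurable_pi_lambda _ fun v => ?_
    unfold FeynmanGraph.pinned
    split_ifs
    · exact measurable_pi_apply _
    · exact measurable_const
  refine Integrable.mono' ((integrable_prod_inv_one_add_norm
    (V := {v : Fin n // v ≠ v₀})).const_mul (|K| * K' ^ Fintype.card {v : Fin n // v ≠ v₀}))
    (hf.comp hmeas).aestronglyMeasurable
    (Filter.Eventually.of_forall fun y => (hle _).trans ?_)
  set x := FeynmanGraph.pinned v₀ y with hx
  have hx0 : x v₀ = 0 := by simp [hx, FeynmanGraph.pinned]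
  have hxv : ∀ v : {v : Fin n // v ≠ v₀}, x v = y v := fun v => by
    simp [hx, FeynmanGraph.pinned, v.2]
  have hs : ∑ v : {v : Fin n // v ≠ v₀}, ‖y v‖ ≤ ∑ v, ‖x v - x v₀‖ := by
    rw [hx0]
    simp only [sub_zero, ← hxv]
    calc ∑ v : {v : Fin n // v ≠ v₀}, ‖x v‖ = ∑ v ∈ Finset.univ.filter (· ≠ v₀), ‖x v‖ :=
          (Finset.sum_subtype _ (by simp) fun v => ‖x v‖).symm
      _ ≤ _ := Finset.sum_le_sum_of_subset_of_nonneg (Finset.filter_subset _ _)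
          fun _ _ _ => norm_nonneg _
  have h1 : Real.exp (-c * totalLength p q x) ≤
      ∏ v : {v : Fin n // v ≠ v₀}, (K' * ((1 + ‖y v‖) ^ 5)⁻¹) := by
    calc Real.exp (-c * totalLength p q x) ≤
        Real.exp (∑ v : {v : Fin n // v ≠ v₀}, -(c * d) * ‖y v‖) := by
          rw [Real.exp_le_exp, ← Finset.mul_sum]
          nlinarith [hdx x, mul_pos hc hd]
      _ = ∏ v : {v : Fin n // v ≠ v₀}, Real.exp (-(c * d) * ‖y v‖) := Real.exp_sum ..
      _ ≤ _ := Finset.prod_le_prod (fun _ _ => (Real.exp_pos _).le)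
          fun v _ => hexp _ (norm_nonneg _)
  calc K * Real.exp (-c * totalLength p q x)
      ≤ |K| * ∏ v : {v : Fin n // v ≠ v₀}, (K' * ((1 + ‖y v‖) ^ 5)⁻¹) := by
        gcongr
        exact le_abs_self K
    _ = _ := by
        rw [Finset.prod_mul_distrib, Finset.prod_const, Finset.card_univ]
        ring

end LineSystem

/-- Schwartz functions decay rapidly in each of their variables. -/
theorem schwartz_decay {N : ℕ} (a : 𝓢(Fin N → Space, ℝ)) (j : Fin N) (R : ℕ) :
    ∃ K > 0, ∀ z : Fin N → Space, ‖a z‖ ≤ K * ((1 + ‖z j‖) ^ R)⁻¹ := by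
  refine ⟨2 ^ R * (Finset.Iic (R, 0)).sup (fun m => SchwartzMap.seminorm ℝ m.1 m.2) a + 1,
    by positivity, fun z => ?_⟩
  have h := SchwartzMap.one_add_le_sup_seminorm_apply (𝕜 := ℝ) (m := (R, 0)) (k := R) (n := 0)
    le_rfl le_rfl a z
  rw [norm_iteratedFDeriv_zero] at h
  rw [← div_eq_mul_inv, le_div_iff₀ (by positivity)]
  have h1 : (1 + ‖z j‖) ^ R ≤ (1 + ‖z‖) ^ R := by
    gcongr
    exact norm_le_pi_norm z j
  simp only at h
  nlinarith [norm_nonneg (a z)]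

/-! ### Counting external half-lines -/

namespace FeynmanGraph

open MeasureTheory

section Legs

variable {n N : ℕ} (G : FeynmanGraph n N)

theorem mem_verts {h : G.Sub} {v : Fin n} : v ∈ G.verts h ↔ ∃ l ∈ h, ∃ k : Fin 4, (v, k) ∈ l.1 := by
  simp [verts]

theorem mem_verts_of_mem {h : G.Sub} {l : G.Line} (hl : l ∈ h) {e : HalfLine n} (he : e ∈ l.1) :
    e.1 ∈ G.verts h :=
  G.mem_verts.2 ⟨l, hl, e.2, he⟩

theorem line_eq_of_mem {l l' : G.Line} {e : HalfLine n} (h : e ∈ l.1) (h' : e ∈ l'.1) : l = l' :=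
  Subtype.ext (G.lines_disjoint l.1 l.2 l'.1 l'.2 e h h')

open Classical in
/-- The half-lines at the vertices of `h` that do not belong to the lines of `h`. -/
noncomputable def extHalfLines (h : G.Sub) : Finset (HalfLine n) :=
  Finset.univ.filter fun e => e.1 ∈ G.verts h ∧ ∀ l ∈ h, e ∉ l.1

theorem mem_extHalfLines {h : G.Sub} {e : HalfLine n} :
    e ∈ G.extHalfLines h ↔ e.1 ∈ G.verts h ∧ ∀ l ∈ h, e ∉ l.1 := by
  simp [extHalfLines]

open Classical in
/-- The half-lines of the lines of `h`. -/
noncomputable def intHalfLines (h : G.Sub) : Finset (HalfLine n) :=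
  h.biUnion fun l => l.1.toFinset

theorem mem_intHalfLines {h : G.Sub} {e : HalfLine n} :
    e ∈ G.intHalfLines h ↔ ∃ l ∈ h, e ∈ l.1 := by
  simp [intHalfLines]

theorem card_intHalfLines (h : G.Sub) : (G.intHalfLines h).card = 2 * h.card := by
  classical
  unfold intHalfLines
  rw [Finset.card_biUnion]
  · rw [Finset.sum_congr rfl (fun l _ => Sym2.card_toFinset_of_not_isDiag l.1
      (G.not_isDiag l.1 l.2)), Finset.sum_const, smul_eq_mul, mul_comm]
  · intro l _ l' _ hne
    rw [Function.onFun, Finset.disjoint_left]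
    intro e he he'
    simp only [Sym2.mem_toFinset] at he he'
    exact hne (G.line_eq_of_mem he he')

/-- The exception is real: away from the vertices of `h` the left side is `4`, while there are no
external half-lines. -/
theorem four_sub_coord (h : G.Sub) (v : Fin n) :
    4 - G.coord h v = ((G.extHalfLines h).filter fun e => e.1 = v).card ∨ v ∉ G.verts h := by
  classical
  by_cases hv : v ∈ G.verts h
  · left
    have h1 : ((G.extHalfLines h).filter fun e => e.1 = v).card =
        (Finset.univ.filter fun k : Fin 4 => ¬ ∃ l ∈ h, (v, k) ∈ l.1).card := by
      refine Finset.card_bij (fun e _ => e.2) ?_ ?_ ?_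
      · rintro ⟨w, k⟩ he
        simp only [Finset.mem_filter, mem_extHalfLines] at he
        obtain ⟨⟨-, he⟩, rfl⟩ := he
        simpa using he
      · rintro ⟨w, k⟩ he ⟨w', k'⟩ he' heq
        simp only [Finset.mem_filter] at he he'
        simp_all
      · intro k hk
        refine ⟨(v, k), ?_, rfl⟩
        simp only [Finset.mem_filter, mem_extHalfLines, and_true]
        exact ⟨hv, by simpa using hk⟩
    have h2 := Finset.card_filter_add_card_filter_not (s := (Finset.univ : Finset (Fin 4)))
      (fun k : Fin 4 => ∃ l ∈ h, (v, k) ∈ l.1)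
    rw [Finset.card_univ, Fintype.card_fin] at h2
    rw [h1]
    unfold coord
    omega
  · exact Or.inr hv

theorem mem_extVerts {h : G.Sub} {v : Fin n} :
    v ∈ G.extVerts h ↔ ∃ k, (v, k) ∈ G.extHalfLines h := by
  classical
  unfold extVerts
  rw [Finset.mem_filter]
  constructor
  · rintro ⟨hv, hc⟩
    have h1 := (G.four_sub_coord h v).resolve_right (not_not.2 hv)
    have h2 : 0 < ((G.extHalfLines h).filter fun e => e.1 = v).card := by omega
    obtain ⟨e, he⟩ := Finset.card_pos.1 h2
    rw [Finset.mem_filter] at he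
    obtain ⟨he, rfl⟩ := he
    exact ⟨e.2, he⟩
  · rintro ⟨k, hk⟩
    have hv := (G.mem_extHalfLines.1 hk).1
    refine ⟨hv, ?_⟩
    have h1 := (G.four_sub_coord h v).resolve_right (not_not.2 hv)
    have h2 : 0 < ((G.extHalfLines h).filter fun e => e.1 = v).card :=
      Finset.card_pos.2 ⟨(v, k), by simpa using hk⟩
    omega

theorem extVerts_subset (h : G.Sub) : G.extVerts h ⊆ G.verts h := Finset.filter_subset _ _

theorem numLegs_eq_card (h : G.Sub) : G.numLegs h = (G.extHalfLines h).card := by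
  classical
  rw [Finset.card_eq_sum_card_fiberwise (f := fun e => e.1) (t := G.extVerts h)
    (fun e he => G.mem_extVerts.2 ⟨e.2, he⟩)]
  exact Finset.sum_congr rfl fun v hv =>
    (G.four_sub_coord h v).resolve_right (not_not.2 (G.extVerts_subset h hv))

/-- Each of the four half-lines at a vertex of `h` is either external or one of the two ends of a
line of `h`. In particular the number of legs is even, and the later counts of legs become linear
arithmetic. -/
theorem numLegs_add (h : G.Sub) : G.numLegs h + 2 * h.card = 4 * (G.verts h).card := by
  classical
  rw [numLegs_eq_card, ← card_intHalfLines, ← Finset.card_union_of_disjoint]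
  · have : G.extHalfLines h ∪ G.intHalfLines h = G.verts h ×ˢ Finset.univ := by
      ext ⟨v, k⟩
      simp only [Finset.mem_union, mem_extHalfLines, mem_intHalfLines, Finset.mem_product,
        Finset.mem_univ, and_true]
      constructor
      · rintro (h | ⟨l, hl, he⟩)
        · exact h.1
        · exact G.mem_verts_of_mem hl he
      · intro hv
        by_cases hx : ∃ l ∈ h, (v, k) ∈ l.1
        · exact Or.inr hx
        · push Not at hx
          exact Or.inl ⟨hv, hx⟩
    rw [this, Finset.card_product, Finset.card_univ, Fintype.card_fin, mul_comm]
  · rw [Finset.disjoint_left]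
    intro e he he'
    obtain ⟨l, hl, hel⟩ := G.mem_intHalfLines.1 he'
    exact (G.mem_extHalfLines.1 he).2 l hl hel

/-- Removing one line frees its two ends. No vertex is lost: in a subgraph without legs all four
half-lines of each vertex are used, and one line takes at most two of them. -/
theorem numLegs_eq_two_of_erase {h : G.Sub} {l : G.Line} (hl : l ∈ h) (h0 : G.numLegs h = 0)
    (h' : G.Sub) (hh' : ∀ l', l' ∈ h' ↔ l' ∈ h ∧ l' ≠ l) : G.numLegs h' = 2 := by
  classical
  have hv : G.verts h' = G.verts h := by
    ext v
    constructor
    · intro hv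
      obtain ⟨l', hl', k, hk⟩ := G.mem_verts.1 hv
      exact G.mem_verts_of_mem ((hh' l').1 hl').1 hk
    · intro hv
      rw [numLegs_eq_card, Finset.card_eq_zero] at h0
      obtain ⟨⟨e, e'⟩, hee⟩ := Quot.exists_rep l.1
      -- A half-line number that differs from those of both ends of `l`, so that `(v, k)` lies on
      -- another line of `h`.
      have hk : ∃ k : Fin 4, k ≠ e.2 ∧ k ≠ e'.2 := by
        generalize e.2 = a
        generalize e'.2 = b
        revert a b
        decide
      obtain ⟨k, hk1, hk2⟩ := hk
      have hkl : (v, k) ∉ l.1 := by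
        rw [← hee]
        intro hmem
        rcases Sym2.mem_iff.1 hmem with h | h
        · exact hk1 (by rw [← h])
        · exact hk2 (by rw [← h])
      have : (v, k) ∉ G.extHalfLines h := by simp [h0]
      rw [mem_extHalfLines] at this
      push Not at this
      obtain ⟨l', hl', hmem⟩ := this hv
      refine G.mem_verts_of_mem (e := (v, k)) ((hh' l').2 ⟨hl', ?_⟩) hmem
      rintro rfl
      exact hkl hmem
  have h1 := G.numLegs_add h
  have h2 := G.numLegs_add h'
  have h3 : h' = h.erase l := by
    ext l'
    rw [hh', Finset.mem_erase, and_comm]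
  have h4 := Finset.card_erase_add_one hl
  rw [hv] at h2
  rw [← h3] at h4
  omega

/-- The number of legs is even, and a subgraph without legs would yield a two-point one by removal
of a line. The lower bound is the form suited to counting; the empty subgraph has no legs. -/
theorem noTwoPoint_iff : G.NoTwoPoint ↔ ∀ h : G.Sub, h.Nonempty → 4 ≤ G.numLegs h := by
  classical
  constructor
  · rintro hG h ⟨l, hl⟩
    have h1 := G.numLegs_add h
    have h2 := hG h
    have h3 : G.numLegs h ≠ 0 := fun h0 =>
      hG (h.erase l) (G.numLegs_eq_two_of_erase hl h0 _ fun l' => by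
        rw [Finset.mem_erase, and_comm])
    omega
  · intro hG h h2
    rcases h.eq_empty_or_nonempty with rfl | hne
    · have h1 := G.numLegs_add ∅
      have : G.verts ∅ = ∅ := by simp [verts]
      rw [this] at h1
      simp at h1
      omega
    · have := hG h hne
      omega

theorem verts_univ_of_line (hG : G.Connected) (l : G.Line) : G.verts Finset.univ = Finset.univ := by
  classical
  ext v
  simp only [Finset.mem_univ, iff_true]
  obtain ⟨⟨e, e'⟩, hee⟩ := Quot.exists_rep l.1
  have he : e ∈ l.1 := by rw [← hee]; exact Sym2.mem_mk_left _ _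
  rcases Relation.ReflTransGen.cases_tail (hG.2 e.1 v) with h | ⟨w, -, l', hl', k, k', hk⟩
  · rw [h]; exact G.mem_verts_of_mem (Finset.mem_univ l) he
  · exact G.mem_verts.2 ⟨l', hl', k', by rw [hk]; exact Sym2.mem_mk_right _ _⟩

theorem subConnected_univ (hG : G.Connected) (l : G.Line) : G.SubConnected Finset.univ :=
  ⟨⟨l, Finset.mem_univ l⟩, fun v _ w _ => hG.2 v w⟩

end Legs

theorem _root_.Phi4.mem_graphs {n N : ℕ} {G : FeynmanGraph n N} :
    G ∈ graphs n N ↔ G.Connected ∧ G.NoTwoPoint := by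
  simp [graphs]

theorem _root_.Phi4.pos_of_mem_graphs {n N : ℕ} {G : FeynmanGraph n N} (hG : G ∈ graphs n N) :
    0 < N := by
  classical
  rw [mem_graphs, noTwoPoint_iff] at hG
  obtain ⟨⟨hn, -⟩, hG⟩ := hG
  by_contra hN
  obtain rfl : N = 0 := by omega
  have key : ∀ e, ∃ l ∈ G.lines, e ∈ l := fun e => (G.covered e).resolve_right fun ⟨j, _⟩ => j.elim0
  obtain ⟨l, hl, -⟩ := key (⟨0, hn⟩, 0)
  have h := hG Finset.univ ⟨⟨l, hl⟩, Finset.mem_univ _⟩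
  rw [numLegs_eq_card] at h
  obtain ⟨e, he⟩ := Finset.card_pos.1 (lt_of_lt_of_le (by norm_num) h)
  obtain ⟨l, hl, hel⟩ := key e
  exact (G.mem_extHalfLines.1 he).2 ⟨l, hl⟩ (Finset.mem_univ _) hel

/-! ### Nesting of quasi-local subgraphs, connectivity of moved lines, absolute convergence -/

section Forest

variable {n N ρ : ℕ} (G : FeynmanGraph n N) (μ : G.Scales ρ)

theorem Joined.symm {h : G.Sub} {v w : Fin n} (hj : G.Joined h v w) : G.Joined h w v := by
  obtain ⟨l, hl, k, k', hk⟩ := hj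
  exact ⟨l, hl, k', k, by rw [hk, Sym2.eq_swap]⟩

theorem Joined.mono {h h' : G.Sub} (hh : h ⊆ h') {v w : Fin n} (hj : G.Joined h v w) :
    G.Joined h' v w := by
  obtain ⟨l, hl, k, k', hk⟩ := hj
  exact ⟨l, hh hl, k, k', hk⟩

/-- If every line of `f` that touches `g` belonged to `g`, a path in `f` that starts at the common
vertex could never leave `g`, and `f` would be contained in `g`. -/
theorem exists_line_of_not_subset {f g : G.Sub} (hf : G.SubConnected f) {v : Fin n}
    (hvf : v ∈ G.verts f) (hvg : v ∈ G.verts g) (hfg : ¬ f ⊆ g) :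
    ∃ l ∈ f, l ∉ g ∧ ∃ w ∈ G.verts g, G.Attached l w := by
  by_contra! hcon
  have key : ∀ l ∈ f, ∀ w ∈ G.verts g, G.Attached l w → l ∈ g := fun l hl w hw ha => by
    by_contra hlg
    exact hcon l hl hlg w hw ha
  obtain ⟨l, hl, hlg⟩ := Finset.not_subset.1 hfg
  obtain ⟨⟨e, e'⟩, hee⟩ := Quot.exists_rep l.1
  have he : e ∈ l.1 := by rw [← hee]; exact Sym2.mem_mk_left _ _
  have hpath := hf.2 v hvf e.1 (G.mem_verts_of_mem hl he)
  have : e.1 ∈ G.verts g := by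
    clear he
    generalize e.1 = u at hpath
    induction hpath with
    | refl => exact hvg
    | tail _ hj ih =>
      obtain ⟨l, hl, k, k', hk⟩ := hj
      have := key l hl _ ih ⟨k, by rw [hk]; exact Sym2.mem_mk_left _ _⟩
      exact G.mem_verts.2 ⟨l, this, k', by rw [hk]; exact Sym2.mem_mk_right _ _⟩
  exact hlg (key l hl _ this ⟨e.2, he⟩)

/-- Quasi-local subgraphs that share a vertex are nested. -/
theorem QuasiLocal.nested {μ : G.Scales ρ} {f g : G.Sub} (hf : G.QuasiLocal μ f)
    (hg : G.QuasiLocal μ g) {v : Fin n} (hvf : v ∈ G.verts f) (hvg : v ∈ G.verts g) :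
    f ⊆ g ∨ g ⊆ f := by
  by_contra! hcon
  obtain ⟨l, hl, hlg, w, hw, ha⟩ := G.exists_line_of_not_subset hf.1 hvf hvg hcon.1
  obtain ⟨l', hl', hlf, w', hw', ha'⟩ := G.exists_line_of_not_subset hg.1 hvg hvf hcon.2
  -- Each of `l` and `l'` lies in one subgraph and is attached to the other from outside, so each
  -- would have to be strictly above the other.
  exact lt_asymm (hf.2 l hl l' hlf ⟨w', hw', ha'⟩) (hg.2 l' hl' l hlg ⟨w, hw, ha⟩)

theorem mem_dangerous {μ : G.Scales ρ} {f : G.Sub} :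
    f ∈ G.dangerous μ ↔ G.QuasiLocal μ f ∧ G.numLegs f = 4 := by
  simp [dangerous]

theorem _root_.Finset.biUnion_id_mem_of_chain {α : Type*} [DecidableEq α] {S : Finset (Finset α)}
    (hne : S.Nonempty) (hS : ∀ f ∈ S, ∀ g ∈ S, f ⊆ g ∨ g ⊆ f) : S.biUnion id ∈ S := by
  obtain ⟨m, hm, hmax⟩ := Finset.exists_max_image S Finset.card hne
  suffices S.biUnion id = m by rwa [this]
  refine subset_antisymm (Finset.biUnion_subset.2 fun f hf => ?_)
    (Finset.subset_biUnion_of_mem id hm)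
  rcases hS f hf m hm with h | h
  · exact h
  · exact (Finset.eq_of_subset_of_card_le h (hmax f hf)).ge

theorem anchor_mem_or (h : G.Sub) (v : Fin n) :
    (G.extVerts h = ∅ ∧ G.anchor h v = v) ∨ G.anchor h v ∈ G.extVerts h := by
  unfold anchor
  split_ifs with hne
  · exact Or.inr (Finset.min'_mem _ _)
  · exact Or.inl ⟨Finset.not_nonempty_iff_eq_empty.1 hne, rfl⟩

/-- The elements of `F` that have `e` as an external leg share the vertex of `e`. They are therefore
nested, and their union is one of them. -/
theorem position_cases {μ : G.Scales ρ} {F : Finset G.Sub} (hF : F ⊆ G.dangerous μ)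
    (e : HalfLine n) :
    G.position F e = e.1 ∨ ∃ g ∈ F, e.1 ∈ G.verts g ∧ (∀ l ∈ g, e ∉ l.1) ∧
      G.position F e ∈ G.verts g := by
  classical
  unfold position
  set S := F.filter fun h => e.1 ∈ G.verts h ∧ ∀ l ∈ h, e ∉ l.1 with hS
  rcases G.anchor_mem_or (S.biUnion id) e.1 with ⟨_, h⟩ | h
  · left
    convert h
  · right
    rcases S.eq_empty_or_nonempty with hemp | hne
    · exfalso
      rw [hemp] at h
      have := G.extVerts_subset _ h
      simp [verts] at this
    · have hmem : S.biUnion id ∈ S := by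
        refine Finset.biUnion_id_mem_of_chain hne fun f hf g hg => ?_
        rw [hS, Finset.mem_filter] at hf hg
        exact QuasiLocal.nested G (G.mem_dangerous.1 (hF hf.1)).1
          (G.mem_dangerous.1 (hF hg.1)).1 hf.2.1 hg.2.1
      have hmem' := hmem
      rw [hS, Finset.mem_filter] at hmem'
      refine ⟨_, hmem'.1, hmem'.2.1, hmem'.2.2, ?_⟩
      convert G.extVerts_subset _ h

/-- Two vertices are joined by a line of `f`, once the half-lines have been moved by the operators
`τ_h`, `h ∈ F`. -/
def MovedJoined (F : Finset G.Sub) (f : G.Sub) (v w : Fin n) : Prop :=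
  ∃ l ∈ f, ∃ e e', l.1 = s(e, e') ∧ v = G.position F e ∧ w = G.position F e'

theorem MovedJoined.symm {F : Finset G.Sub} {f : G.Sub} {v w : Fin n}
    (h : G.MovedJoined F f v w) : G.MovedJoined F f w v := by
  obtain ⟨l, hl, e, e', hee, hv, hw⟩ := h
  exact ⟨l, hl, e', e, by rw [hee, Sym2.eq_swap], hw, hv⟩

theorem MovedJoined.mono {F : Finset G.Sub} {f g : G.Sub} (hfg : f ⊆ g) {v w : Fin n}
    (h : G.MovedJoined F f v w) : G.MovedJoined F g v w := by
  obtain ⟨l, hl, h⟩ := h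
  exact ⟨l, hfg hl, h⟩

theorem MovedJoined.reach_symm {F : Finset G.Sub} {f : G.Sub} {v w : Fin n}
    (h : Relation.ReflTransGen (G.MovedJoined F f) v w) :
    Relation.ReflTransGen (G.MovedJoined F f) w v :=
  haveI : Std.Symm (G.MovedJoined F f) := ⟨fun _ _ h => MovedJoined.symm G h⟩
  Std.Symm.symm _ _ h

/-- The moved lines of a quasi-local subgraph connect its vertices. -/
theorem reach_of_quasiLocal {μ : G.Scales ρ} {F : Finset G.Sub} (hF : F ⊆ G.dangerous μ) (c : ℕ) :
    ∀ f : G.Sub, f.card ≤ c → G.QuasiLocal μ f → ∀ v ∈ G.verts f, ∀ w ∈ G.verts f,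
      Relation.ReflTransGen (G.MovedJoined F f) v w := by
  induction c with
  | zero =>
    intro f hc hf
    have := Finset.card_pos.2 hf.1.1
    omega
  | succ c ih =>
    intro f hc hf
    -- The element `g` that moves an end of a line of `f` shares a vertex with `f` and cannot
    -- contain it, so it is strictly smaller. The moved lines of `g` then join the old position to
    -- the new one, by induction.
    have hpos : ∀ l ∈ f, ∀ e ∈ l.1,
        Relation.ReflTransGen (G.MovedJoined F f) e.1 (G.position F e) := by
      intro l hl e he
      rcases G.position_cases hF e with h | ⟨g, hg, heg, hext, hpg⟩
      · rw [h]
      · have hgq := (G.mem_dangerous.1 (hF hg)).1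
        have hnot : ¬ f ⊆ g := fun hfg => hext l (hfg hl) he
        have hgf : g ⊆ f :=
          (QuasiLocal.nested G hf hgq (G.mem_verts_of_mem hl he) heg).resolve_left hnot
        have hcard : g.card < f.card := Finset.card_lt_card ⟨hgf, hnot⟩
        exact Relation.ReflTransGen.mono (fun _ _ h => MovedJoined.mono G hgf h) _ _
          (ih g (by omega) hgq _ heg _ hpg)
    intro v hv w hw
    have hpath := hf.1.2 v hv w hw
    induction hpath with
    | refl => exact Relation.ReflTransGen.refl
    | @tail b c' _ hj ih' =>
      obtain ⟨l, hl, k, k', hk⟩ := hj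
      have hb : (b, k) ∈ l.1 := by rw [hk]; exact Sym2.mem_mk_left _ _
      have hc' : (c', k') ∈ l.1 := by rw [hk]; exact Sym2.mem_mk_right _ _
      refine (ih' (G.mem_verts_of_mem hl hb)).trans ((hpos l hl _ hb).trans
        (.head ⟨l, hl, _, _, hk, rfl, rfl⟩ (MovedJoined.reach_symm G (hpos l hl _ hc'))))

theorem quasiLocal_univ (hG : G.Connected) (l : G.Line) : G.QuasiLocal μ Finset.univ :=
  ⟨G.subConnected_univ hG l, fun _ _ l' hl' => absurd (Finset.mem_univ l') hl'⟩

theorem reach_univ {μ : G.Scales ρ} {F : Finset G.Sub} (hF : F ⊆ G.dangerous μ) (hG : G.Connected)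
    (v w : Fin n) : Relation.ReflTransGen (G.MovedJoined F Finset.univ) v w := by
  rcases isEmpty_or_nonempty G.Line with hE | ⟨⟨l⟩⟩
  · have : v = w := by
      rcases Relation.ReflTransGen.cases_head (hG.2 v w) with h | ⟨_, ⟨l, _⟩, _⟩
      · exact h
      · exact hE.elim l
    rw [this]
  · have hv := G.verts_univ_of_line hG l
    exact G.reach_of_quasiLocal hF _ Finset.univ le_rfl (G.quasiLocal_univ μ hG l) v
      (hv ▸ Finset.mem_univ _) w (hv ▸ Finset.mem_univ _)

/-- The endpoints of a line, in some order. -/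
noncomputable def ends {G : FeynmanGraph n N} (l : G.Line) : HalfLine n × HalfLine n := Quot.out l.1

theorem mk_ends {G : FeynmanGraph n N} (l : G.Line) : s((ends l).1, (ends l).2) = l.1 :=
  Quot.out_eq l.1

theorem lineProduct_eq (M m : ℝ) (F : Finset G.Sub) (x : Fin n → Space) :
    G.lineProduct M m μ F x = ∏ l : G.Line, propagator M m (μ l)
      (x (G.position F (ends l).1)) (x (G.position F (ends l).2)) := by
  unfold lineProduct
  refine Finset.prod_congr rfl fun l _ => ?_
  conv_lhs => rw [← mk_ends l]
  rfl

theorem measurable_lineProduct (M m : ℝ) (F : Finset G.Sub) :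
    Measurable (G.lineProduct M m μ F) := by
  simp only [funext (G.lineProduct_eq μ M m F)]
  refine Finset.measurable_prod _ fun l _ => ?_
  have h : Measurable fun x : Fin n → Space =>
      (x (G.position F (ends l).1), x (G.position F (ends l).2)) :=
    (measurable_pi_apply _).prodMk (measurable_pi_apply _)
  exact (measurable_propagator M m (μ l)).comp h

theorem lineProduct_add_right (M m : ℝ) (F : Finset G.Sub) (x : Fin n → Space) (c : Space) :
    G.lineProduct M m μ F (fun v => x v + c) = G.lineProduct M m μ F x := by
  simp only [lineProduct_eq, propagator_add_right]

theorem lineProduct_nonneg (M m : ℝ) (F : Finset G.Sub) (x : Fin n → Space) :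
    0 ≤ G.lineProduct M m μ F x := by
  rw [lineProduct_eq]
  exact Finset.prod_nonneg fun l _ => propagator_nonneg ..

theorem exists_lineProduct_le {M m : ℝ} (hM : 1 < M) (hm : 0 < m) (F : Finset G.Sub) :
    ∃ K > 0, ∀ x, G.lineProduct M m μ F x ≤ K * Real.exp (-(m / 2) *
      totalLength (fun l : G.Line => G.position F (ends l).1)
        (fun l => G.position F (ends l).2) x) := by
  obtain ⟨K, hK, h⟩ := exists_propagator_le hM hm ρ
  refine ⟨K ^ Fintype.card G.Line, by positivity, fun x => ?_⟩
  rw [lineProduct_eq, totalLength, Finset.mul_sum, Real.exp_sum, ← Finset.card_univ,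
    ← Finset.prod_const, ← Finset.prod_mul_distrib]
  exact Finset.prod_le_prod (fun l _ => propagator_nonneg ..) fun l _ => h _ _ _

theorem reach_ends {μ : G.Scales ρ} {F : Finset G.Sub} (hF : F ⊆ G.dangerous μ)
    (hG : G.Connected) (v w : Fin n) :
    Relation.ReflTransGen (fun v w => ∃ l : G.Line,
      (v = G.position F (ends l).1 ∧ w = G.position F (ends l).2) ∨
      (v = G.position F (ends l).2 ∧ w = G.position F (ends l).1)) v w := by
  refine Relation.ReflTransGen.mono ?_ _ _ (G.reach_univ hF hG v w)
  rintro a b ⟨l, -, e, e', hee, ha, hb⟩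
  refine ⟨l, ?_⟩
  have := (mk_ends l).trans hee
  rcases Sym2.eq_iff.1 this with ⟨h1, h2⟩ | ⟨h1, h2⟩
  · rw [h1, h2]; exact Or.inl ⟨ha, hb⟩
  · rw [h1, h2]; exact Or.inr ⟨ha, hb⟩

/-- The amplitudes, with or without operators `τ`, converge absolutely. -/
theorem integrable_integrand {M m : ℝ} (hM : 1 < M) (hm : 0 < m) (hG : G ∈ graphs n N)
    {μ : G.Scales ρ} {F : Finset G.Sub} (hF : F ⊆ G.dangerous μ) (a : 𝓢(Fin N → Space, ℝ)) :
    Integrable (G.integrand M m μ F a) := by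
  have hN := pos_of_mem_graphs hG
  rw [mem_graphs] at hG
  obtain ⟨K, hK, hle⟩ := G.exists_lineProduct_le μ hM hm F
  -- The base point is where the first external leg sits after the moves, since the test function
  -- decays there.
  refine integrable_of_le_exp_totalLength _ _ (G.reach_ends hF hG.1)
    (G.position F (G.leg ⟨0, hN⟩)) ?_ (half_pos hm) fun R => ?_
  · refine ((G.measurable_lineProduct μ M m F).mul ?_).aestronglyMeasurable
    exact a.continuous.measurable.comp (measurable_pi_lambda _ fun j => measurable_pi_apply _)
  · obtain ⟨K', hK', ha⟩ := schwartz_decay a ⟨0, hN⟩ R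
    refine ⟨K * K', fun x => ?_⟩
    rw [integrand, norm_mul, Real.norm_of_nonneg (G.lineProduct_nonneg ..)]
    calc _ ≤ _ := mul_le_mul (hle x) (ha _) (norm_nonneg _) (by positivity)
      _ = _ := by ring

theorem integrable_pinned {M m : ℝ} (hM : 1 < M) (hm : 0 < m) (hG : G ∈ graphs n N)
    {μ : G.Scales ρ} {F : Finset G.Sub} (hF : F ⊆ G.dangerous μ) (v₀ : Fin n) :
    Integrable fun y : {v : Fin n // v ≠ v₀} → Space => G.lineProduct M m μ F (pinned v₀ y) := by
  rw [mem_graphs] at hG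
  obtain ⟨K, hK, hle⟩ := G.exists_lineProduct_le μ hM hm F
  refine integrable_pinned_of_le_exp_totalLength _ _ (G.reach_ends hF hG.1) v₀
    (G.measurable_lineProduct μ M m F) (half_pos hm) (K := K) fun x => ?_
  rw [Real.norm_of_nonneg (G.lineProduct_nonneg ..)]
  exact hle x

end Forest

end FeynmanGraph

/-! ### Transport of subgraphs along increasing maps of vertices -/

theorem _root_.Sym2.exists_of_map_eq_mk {α β : Type*} {f : α → β} {z : Sym2 α} {x y : β}
    (h : z.map f = s(x, y)) : ∃ a b, z = s(a, b) ∧ f a = x ∧ f b = y := by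
  induction z with
  | _ a b =>
    rw [Sym2.map_mk, Sym2.eq_iff] at h
    rcases h with ⟨h1, h2⟩ | ⟨h1, h2⟩
    · exact ⟨a, b, rfl, h1, h2⟩
    · exact ⟨b, a, Sym2.eq_swap, h2, h1⟩

theorem _root_.Sym2.not_isDiag_map {α β : Type*} {f : α → β} (hf : Function.Injective f)
    {z : Sym2 α} (h : ¬ z.IsDiag) : ¬ (z.map f).IsDiag := by
  induction z with
  | _ a b => simpa [hf.eq_iff] using h

namespace FeynmanGraph

section SubIso

variable {n₁ N₁ n₂ N₂ : ℕ} {G₁ : FeynmanGraph n₁ N₁} {G₂ : FeynmanGraph n₂ N₂}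

/-- The subgraph `f₂` is the image of `f₁` under a map of vertices that is increasing on the
vertices of `f₁`. -/
structure SubIso (f₁ : G₁.Sub) (f₂ : G₂.Sub) (φ : Fin n₁ → Fin n₂) : Prop where
  exists_map : ∀ l ∈ f₁, ∃ l' ∈ f₂, l'.1 = l.1.map (Prod.map φ id)
  exists_of_mem : ∀ l' ∈ f₂, ∃ l ∈ f₁, l'.1 = l.1.map (Prod.map φ id)
  strictMonoOn : StrictMonoOn φ (G₁.verts f₁)

variable {f₁ : G₁.Sub} {f₂ : G₂.Sub} {φ : Fin n₁ → Fin n₂}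

theorem SubIso.mem_verts (hφ : SubIso f₁ f₂ φ) {v : Fin n₂} :
    v ∈ G₂.verts f₂ ↔ ∃ a ∈ G₁.verts f₁, φ a = v := by
  constructor
  · intro hv
    obtain ⟨l', hl', k, hk⟩ := G₂.mem_verts.1 hv
    obtain ⟨l, hl, hll⟩ := hφ.exists_of_mem l' hl'
    rw [hll, Sym2.mem_map] at hk
    obtain ⟨e, he, hek⟩ := hk
    exact ⟨e.1, G₁.mem_verts_of_mem hl he, congrArg Prod.fst hek⟩
  · rintro ⟨a, ha, rfl⟩
    obtain ⟨l, hl, k, hk⟩ := G₁.mem_verts.1 ha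
    obtain ⟨l', hl', hll⟩ := hφ.exists_map l hl
    refine G₂.mem_verts.2 ⟨l', hl', k, ?_⟩
    rw [hll, Sym2.mem_map]
    exact ⟨_, hk, rfl⟩

theorem SubIso.mem_extHalfLines (hφ : SubIso f₁ f₂ φ) {e : HalfLine n₂} :
    e ∈ G₂.extHalfLines f₂ ↔ ∃ a ∈ G₁.extHalfLines f₁, Prod.map φ id a = e := by
  simp only [FeynmanGraph.mem_extHalfLines]
  constructor
  · rintro ⟨hv, hext⟩
    obtain ⟨a, ha, hae⟩ := hφ.mem_verts.1 hv
    refine ⟨(a, e.2), ⟨ha, fun l hl hmem => ?_⟩, Prod.ext hae rfl⟩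
    obtain ⟨l', hl', hll⟩ := hφ.exists_map l hl
    refine hext l' hl' ?_
    rw [hll, Sym2.mem_map]
    exact ⟨_, hmem, Prod.ext hae rfl⟩
  · rintro ⟨a, ⟨ha, hext⟩, rfl⟩
    refine ⟨hφ.mem_verts.2 ⟨_, ha, rfl⟩, fun l' hl' hmem => ?_⟩
    obtain ⟨l, hl, hll⟩ := hφ.exists_of_mem l' hl'
    rw [hll, Sym2.mem_map] at hmem
    obtain ⟨c, hc, hca⟩ := hmem
    refine hext l hl ?_
    have h1 : c.1 = a.1 :=
      hφ.strictMonoOn.injOn (G₁.mem_verts_of_mem hl hc) ha (congrArg Prod.fst hca)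
    have h2 : c.2 = a.2 := (congrArg Prod.snd hca : _)
    rwa [← Prod.ext h1 h2]

theorem SubIso.numLegs_eq (hφ : SubIso f₁ f₂ φ) : G₂.numLegs f₂ = G₁.numLegs f₁ := by
  classical
  rw [numLegs_eq_card, numLegs_eq_card, ← Finset.card_image_of_injOn (f := Prod.map φ id)
    (s := G₁.extHalfLines f₁)]
  · congr 1
    ext e
    rw [hφ.mem_extHalfLines, Finset.mem_image]
  · intro a ha b hb hab
    have ha' := (G₁.mem_extHalfLines.1 ha).1
    have hb' := (G₁.mem_extHalfLines.1 hb).1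
    exact Prod.ext (hφ.strictMonoOn.injOn ha' hb' (congrArg Prod.fst hab))
      (congrArg Prod.snd hab : _)

theorem SubIso.mem_extVerts (hφ : SubIso f₁ f₂ φ) {v : Fin n₂} :
    v ∈ G₂.extVerts f₂ ↔ ∃ a ∈ G₁.extVerts f₁, φ a = v := by
  simp only [FeynmanGraph.mem_extVerts, hφ.mem_extHalfLines]
  constructor
  · rintro ⟨k, a, ha, hav⟩
    exact ⟨a.1, ⟨a.2, ha⟩, congrArg Prod.fst hav⟩
  · rintro ⟨a, ⟨k, hk⟩, rfl⟩
    exact ⟨k, _, hk, rfl⟩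

/-- This is why the maps of vertices are required to be increasing: anchors are smallest external
vertices, and only an order-preserving relabelling carries them to each other. -/
theorem SubIso.min'_extVerts (hφ : SubIso f₁ f₂ φ) (h₁ : (G₁.extVerts f₁).Nonempty)
    (h₂ : (G₂.extVerts f₂).Nonempty) :
    (G₂.extVerts f₂).min' h₂ = φ ((G₁.extVerts f₁).min' h₁) := by
  refine le_antisymm (Finset.min'_le _ _
    (hφ.mem_extVerts.2 ⟨_, Finset.min'_mem _ _, rfl⟩)) (Finset.le_min' _ _ _ fun v hv => ?_)
  obtain ⟨a, ha, rfl⟩ := hφ.mem_extVerts.1 hv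
  exact (hφ.strictMonoOn.le_iff_le (G₁.extVerts_subset _ (Finset.min'_mem _ _))
    (G₁.extVerts_subset _ ha)).2 (Finset.min'_le _ _ ha)

theorem SubIso.nonempty_extVerts_iff (hφ : SubIso f₁ f₂ φ) :
    (G₂.extVerts f₂).Nonempty ↔ (G₁.extVerts f₁).Nonempty :=
  ⟨fun ⟨_, hv⟩ => let ⟨a, ha, _⟩ := hφ.mem_extVerts.1 hv; ⟨a, ha⟩,
    fun ⟨_, ha⟩ => ⟨_, hφ.mem_extVerts.2 ⟨_, ha, rfl⟩⟩⟩

theorem SubIso.anchor_eq (hφ : SubIso f₁ f₂ φ) (v : Fin n₁) :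
    G₂.anchor f₂ (φ v) = φ (G₁.anchor f₁ v) := by
  unfold anchor
  by_cases h : (G₁.extVerts f₁).Nonempty
  · rw [dif_pos h, dif_pos (hφ.nonempty_extVerts_iff.2 h), hφ.min'_extVerts h]
  · rw [dif_neg h, dif_neg (mt hφ.nonempty_extVerts_iff.1 h)]

theorem SubIso.joined_iff (hφ : SubIso f₁ f₂ φ) {v w : Fin n₂} :
    G₂.Joined f₂ v w ↔ ∃ a b, φ a = v ∧ φ b = w ∧ G₁.Joined f₁ a b := by
  constructor
  · rintro ⟨l', hl', k, k', hk⟩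
    obtain ⟨l, hl, hll⟩ := hφ.exists_of_mem l' hl'
    rw [hll] at hk
    obtain ⟨e, e', hee, h1, h2⟩ := Sym2.exists_of_map_eq_mk hk
    exact ⟨e.1, e'.1, congrArg Prod.fst h1, congrArg Prod.fst h2, l, hl, e.2, e'.2, hee⟩
  · rintro ⟨a, b, rfl, rfl, l, hl, k, k', hk⟩
    obtain ⟨l', hl', hll⟩ := hφ.exists_map l hl
    exact ⟨l', hl', k, k', by rw [hll, hk]; rfl⟩

theorem Joined.mem_verts_left {n N : ℕ} {G : FeynmanGraph n N} {f : G.Sub} {v w : Fin n}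
    (h : G.Joined f v w) : v ∈ G.verts f := by
  obtain ⟨l, hl, k, k', hk⟩ := h
  exact G.mem_verts.2 ⟨l, hl, k, by rw [hk]; exact Sym2.mem_mk_left _ _⟩

theorem SubIso.reach_iff (hφ : SubIso f₁ f₂ φ) {a b : Fin n₁} (ha : a ∈ G₁.verts f₁)
    (hb : b ∈ G₁.verts f₁) :
    Relation.ReflTransGen (G₂.Joined f₂) (φ a) (φ b) ↔
      Relation.ReflTransGen (G₁.Joined f₁) a b := by
  constructor
  · intro h
    generalize hv : φ b = v at h
    induction h generalizing b with
    | refl => rw [hφ.strictMonoOn.injOn hb ha hv]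
    | tail _ hj ih =>
      obtain ⟨c, d, rfl, rfl, hcd⟩ := hφ.joined_iff.1 hj
      have hd := (Joined.symm G₁ hcd).mem_verts_left
      rw [hφ.strictMonoOn.injOn hb hd hv]
      exact (ih hcd.mem_verts_left rfl).tail hcd
  · intro h
    clear hb
    induction h with
    | refl => exact .refl
    | tail _ hj ih => exact ih.tail (hφ.joined_iff.2 ⟨_, _, rfl, rfl, hj⟩)

theorem SubIso.subConnected_iff (hφ : SubIso f₁ f₂ φ) :
    G₂.SubConnected f₂ ↔ G₁.SubConnected f₁ := by
  refine and_congr ⟨fun ⟨l, hl⟩ => ?_, fun ⟨l, hl⟩ => ?_⟩ ⟨fun h a ha b hb => ?_, fun h => ?_⟩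
  · obtain ⟨l', hl', -⟩ := hφ.exists_of_mem l hl
    exact ⟨l', hl'⟩
  · obtain ⟨l', hl', -⟩ := hφ.exists_map l hl
    exact ⟨l', hl'⟩
  · exact (hφ.reach_iff ha hb).1 (h _ (hφ.mem_verts.2 ⟨a, ha, rfl⟩) _
      (hφ.mem_verts.2 ⟨b, hb, rfl⟩))
  · intro v hv w hw
    obtain ⟨a, ha, rfl⟩ := hφ.mem_verts.1 hv
    obtain ⟨b, hb, rfl⟩ := hφ.mem_verts.1 hw
    exact (hφ.reach_iff ha hb).2 (h a ha b hb)

end SubIso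

end FeynmanGraph

/-! ### Insertion of a four-point graph in a vertex -/

/-- A splitting of the vertices `Fin n` of a graph into those of a subgraph, indexed by `Fin k`, and
the others, indexed by the elements of `Fin n'` other than the vertex `w` to which the subgraph
is contracted. The order of the vertices is respected. -/
structure Splitting (n n' k : ℕ) where
  /-- the vertices of the subgraph -/
  inner : Fin k → Fin n
  /-- the other vertices -/
  outer : Fin n' → Fin n
  /-- the vertex to which the subgraph is contracted -/
  w : Fin n'
  inner_strictMono : StrictMono inner
  outer_lt : ∀ a b, a ≠ w → b ≠ w → a < b → outer a < outer b
  outer_ne_inner : ∀ a b, a ≠ w → outer a ≠ inner b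
  cover : ∀ v, (∃ b, inner b = v) ∨ ∃ a, a ≠ w ∧ outer a = v

namespace Splitting

variable {n n' k N : ℕ} (S : Splitting n n' k)

theorem outer_injective {a b : Fin n'} (ha : a ≠ S.w) (hb : b ≠ S.w) (h : S.outer a = S.outer b) :
    a = b := by
  rcases lt_trichotomy a b with hab | hab | hab
  · exact absurd h (S.outer_lt a b ha hb hab).ne
  · exact hab
  · exact absurd h (S.outer_lt b a hb ha hab).ne'

/-- The half-lines of the subgraph. -/
def up (e : HalfLine k) : HalfLine n := (S.inner e.1, e.2)

/-- The half-lines of the contracted graph; those at the vertex `w` are numbered by `b`. -/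
def dn (b : Fin 4 → HalfLine k) (e : HalfLine n') : HalfLine n :=
  if e.1 = S.w then S.up (b e.2) else (S.outer e.1, e.2)

theorem up_injective : Function.Injective S.up := by
  intro a b h
  exact Prod.ext (S.inner_strictMono.injective (congrArg Prod.fst h)) (congrArg Prod.snd h : _)

variable {S} {b : Fin 4 → HalfLine k}

theorem dn_w (j : Fin 4) : S.dn b (S.w, j) = S.up (b j) := if_pos rfl

theorem dn_of_ne {e : HalfLine n'} (he : e.1 ≠ S.w) : S.dn b e = (S.outer e.1, e.2) := if_neg he

theorem dn_eq_up {e : HalfLine n'} {c : HalfLine k} (h : S.dn b e = S.up c) :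
    e.1 = S.w ∧ b e.2 = c := by
  by_cases he : e.1 = S.w
  · unfold dn at h
    rw [if_pos he] at h
    exact ⟨he, S.up_injective h⟩
  · rw [dn_of_ne he] at h
    exact absurd (congrArg Prod.fst h) (S.outer_ne_inner _ _ he)

theorem dn_injective (hb : Function.Injective b) : Function.Injective (S.dn b) := by
  intro e e' h
  by_cases he' : e'.1 = S.w
  · have h2 : S.dn b e' = S.up (b e'.2) := if_pos he'
    obtain ⟨h3, h4⟩ := dn_eq_up (h.trans h2)
    exact Prod.ext (h3.trans he'.symm) (hb h4)
  · by_cases he : e.1 = S.w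
    · have h2 : S.dn b e = S.up (b e.2) := if_pos he
      exact absurd (dn_eq_up (h.symm.trans h2)).1 he'
    · rw [dn_of_ne he, dn_of_ne he'] at h
      exact Prod.ext (S.outer_injective he he' (congrArg Prod.fst h)) (congrArg Prod.snd h : _)

theorem exists_up_or_dn (e : HalfLine n) :
    (∃ c, S.up c = e) ∨ ∃ c : HalfLine n', c.1 ≠ S.w ∧ (S.outer c.1, c.2) = e := by
  rcases S.cover e.1 with ⟨a, ha⟩ | ⟨a, haw, ha⟩
  · exact Or.inl ⟨(a, e.2), Prod.ext ha rfl⟩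
  · exact Or.inr ⟨(a, e.2), haw, Prod.ext ha rfl⟩

end Splitting

namespace FeynmanGraph

variable {n n' k N : ℕ} (S : Splitting n n' k) (G : FeynmanGraph n' N) (H : FeynmanGraph k 4)

open Splitting

open Classical in
/-- The graph obtained by inserting the four-point graph `H` in the place of the vertex `w`
of `G`. -/
noncomputable def glue : FeynmanGraph n N where
  lines := H.lines.image (Sym2.map S.up) ∪ G.lines.image (Sym2.map (S.dn H.leg))
  leg j := S.dn H.leg (G.leg j)
  leg_injective := (dn_injective H.leg_injective).comp G.leg_injective
  not_isDiag := by
    intro l hl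
    simp only [Finset.mem_union, Finset.mem_image] at hl
    rcases hl with ⟨l, hl, rfl⟩ | ⟨l, hl, rfl⟩
    · exact Sym2.not_isDiag_map S.up_injective (H.not_isDiag l hl)
    · exact Sym2.not_isDiag_map (dn_injective H.leg_injective) (G.not_isDiag l hl)
  lines_disjoint := by
    intro l hl l' hl' e he he'
    have key : ∀ l ∈ H.lines, ∀ l' ∈ G.lines, e ∈ l.map S.up → e ∈ l'.map (S.dn H.leg) →
        False := by
      intro l hl l' _ he he'
      rw [Sym2.mem_map] at he he'
      obtain ⟨a, ha, rfl⟩ := he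
      obtain ⟨c, hc, hca⟩ := he'
      exact H.leg_notMem l hl _ ((dn_eq_up hca).2 ▸ ha)
    simp only [Finset.mem_union, Finset.mem_image] at hl hl'
    rcases hl with ⟨l, hl, rfl⟩ | ⟨l, hl, rfl⟩ <;> rcases hl' with ⟨l', hl', rfl⟩ | ⟨l', hl', rfl⟩
    · rw [Sym2.mem_map] at he he'
      obtain ⟨a, ha, rfl⟩ := he
      obtain ⟨c, hc, hca⟩ := he'
      rw [S.up_injective hca] at hc
      rw [H.lines_disjoint l hl l' hl' a ha hc]
    · exact (key l hl l' hl' he he').elim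
    · exact (key l' hl' l hl he' he).elim
    · rw [Sym2.mem_map] at he he'
      obtain ⟨a, ha, rfl⟩ := he
      obtain ⟨c, hc, hca⟩ := he'
      rw [dn_injective H.leg_injective hca] at hc
      rw [G.lines_disjoint l hl l' hl' a ha hc]
  leg_notMem := by
    intro l hl j hj
    simp only [Finset.mem_union, Finset.mem_image] at hl
    rcases hl with ⟨l, hl, rfl⟩ | ⟨l, hl, rfl⟩
    · obtain ⟨c, hc, hcj⟩ := Sym2.mem_map.1 hj
      exact H.leg_notMem l hl _ ((dn_eq_up hcj.symm).2 ▸ hc)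
    · obtain ⟨c, hc, hcj⟩ := Sym2.mem_map.1 hj
      rw [dn_injective H.leg_injective hcj] at hc
      exact G.leg_notMem l hl j hc
  covered := by
    have key : ∀ c : HalfLine n', (∃ l ∈ H.lines.image (Sym2.map S.up) ∪
        G.lines.image (Sym2.map (S.dn H.leg)), S.dn H.leg c ∈ l) ∨
        ∃ j, S.dn H.leg (G.leg j) = S.dn H.leg c := by
      intro c
      rcases G.covered c with ⟨l, hl, hcl⟩ | ⟨j, hj⟩
      · exact Or.inl ⟨_, Finset.mem_union_right _ (Finset.mem_image_of_mem _ hl),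
          Sym2.mem_map.2 ⟨c, hcl, rfl⟩⟩
      · exact Or.inr ⟨j, by rw [hj]⟩
    intro e
    rcases exists_up_or_dn (S := S) e with ⟨c, rfl⟩ | ⟨c, hc, rfl⟩
    · rcases H.covered c with ⟨l, hl, hcl⟩ | ⟨j, rfl⟩
      · exact Or.inl ⟨_, Finset.mem_union_left _ (Finset.mem_image_of_mem _ hl),
          Sym2.mem_map.2 ⟨c, hcl, rfl⟩⟩
      · rw [← dn_w]
        exact key _
    · rw [← dn_of_ne (b := H.leg) hc]
      exact key c

/-- The line of `G` with `H` inserted that comes from a line of `H`. -/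
noncomputable def upLine (l : H.Line) : (glue S G H).Line :=
  ⟨l.1.map S.up, Finset.mem_union_left _ (Finset.mem_image_of_mem _ l.2)⟩

/-- The line of `G` with `H` inserted that comes from a line of `G`. -/
noncomputable def dnLine (l : G.Line) : (glue S G H).Line :=
  ⟨l.1.map (S.dn H.leg), Finset.mem_union_right _ (Finset.mem_image_of_mem _ l.2)⟩

theorem upLine_injective : Function.Injective (upLine S G H) := fun _ _ h =>
  Subtype.ext (Sym2.map.injective S.up_injective (congrArg Subtype.val h))

theorem dnLine_injective : Function.Injective (dnLine S G H) := fun _ _ h =>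
  Subtype.ext (Sym2.map.injective (dn_injective H.leg_injective) (congrArg Subtype.val h))

theorem line_cases (l : (glue S G H).Line) :
    (∃ l', upLine S G H l' = l) ∨ ∃ l', dnLine S G H l' = l := by
  obtain ⟨l, hl⟩ := l
  have hl' := hl
  simp only [glue, Finset.mem_union, Finset.mem_image] at hl'
  rcases hl' with ⟨l', hl', rfl⟩ | ⟨l', hl', rfl⟩
  · exact Or.inl ⟨⟨l', hl'⟩, rfl⟩
  · exact Or.inr ⟨⟨l', hl'⟩, rfl⟩

variable {S G H}

theorem up_mem_upLine {l : H.Line} {c : HalfLine k} : S.up c ∈ (upLine S G H l).1 ↔ c ∈ l.1 := by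
  refine ⟨fun h => ?_, fun h => Sym2.mem_map.2 ⟨c, h, rfl⟩⟩
  obtain ⟨c', hc', h⟩ := Sym2.mem_map.1 h
  rwa [← S.up_injective h]

theorem dn_mem_dnLine {l : G.Line} {c : HalfLine n'} :
    S.dn H.leg c ∈ (dnLine S G H l).1 ↔ c ∈ l.1 := by
  refine ⟨fun h => ?_, fun h => Sym2.mem_map.2 ⟨c, h, rfl⟩⟩
  obtain ⟨c', hc', h⟩ := Sym2.mem_map.1 h
  rwa [← dn_injective H.leg_injective h]

theorem dn_notMem_upLine {l : H.Line} {c : HalfLine n'} :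
    S.dn H.leg c ∉ (upLine S G H l).1 := by
  intro h
  obtain ⟨c', hc', h⟩ := Sym2.mem_map.1 h
  exact H.leg_notMem l.1 l.2 _ ((dn_eq_up h.symm).2 ▸ hc')

/-- The half-lines that come from `G` include the legs of `H` but none of the half-lines on lines of
`H`. -/
theorem upLine_ne_dnLine {l : H.Line} {l' : G.Line} : upLine S G H l ≠ dnLine S G H l' := by
  intro h
  obtain ⟨⟨e, e'⟩, hee⟩ := Quot.exists_rep l'.1
  have he : e ∈ l'.1 := by rw [← hee]; exact Sym2.mem_mk_left _ _
  have := dn_mem_dnLine (S := S) (H := H).2 he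
  rw [← h] at this
  exact dn_notMem_upLine this

variable (S G H) in
/-- The lines of `G` with `H` inserted. -/
noncomputable def lineEquiv : H.Line ⊕ G.Line ≃ (glue S G H).Line :=
  Equiv.ofBijective (Sum.elim (upLine S G H) (dnLine S G H))
    ⟨(upLine_injective S G H).sumElim (dnLine_injective S G H) fun _ _ => upLine_ne_dnLine,
      fun l => by
        rcases line_cases S G H l with ⟨l', rfl⟩ | ⟨l', rfl⟩
        · exact ⟨Sum.inl l', rfl⟩
        · exact ⟨Sum.inr l', rfl⟩⟩

variable (S G) in
/-- The subgraph of `G` with `H` inserted that comes from a subgraph of `H`. -/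
noncomputable def upSub (f : H.Sub) : (glue S G H).Sub := f.map ⟨_, upLine_injective S G H⟩

variable (S H) in
/-- The subgraph of `G` with `H` inserted that comes from a subgraph of `G`. -/
noncomputable def dnSub (g : G.Sub) : (glue S G H).Sub := g.map ⟨_, dnLine_injective S G H⟩

theorem mem_upSub {f : H.Sub} {l : (glue S G H).Line} :
    l ∈ upSub S G f ↔ ∃ l' ∈ f, upLine S G H l' = l := by
  simp [upSub]

theorem mem_dnSub {g : G.Sub} {l : (glue S G H).Line} :
    l ∈ dnSub S H g ↔ ∃ l' ∈ g, dnLine S G H l' = l := by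
  simp [dnSub]

theorem upLine_mem_upSub {f : H.Sub} {l : H.Line} : upLine S G H l ∈ upSub S G f ↔ l ∈ f := by
  rw [mem_upSub]
  exact ⟨fun ⟨l', hl', h⟩ => upLine_injective S G H h ▸ hl', fun h => ⟨l, h, rfl⟩⟩

theorem dnLine_mem_dnSub {g : G.Sub} {l : G.Line} : dnLine S G H l ∈ dnSub S H g ↔ l ∈ g := by
  rw [mem_dnSub]
  exact ⟨fun ⟨l', hl', h⟩ => dnLine_injective S G H h ▸ hl', fun h => ⟨l, h, rfl⟩⟩

theorem dnLine_notMem_upSub {f : H.Sub} {l : G.Line} : dnLine S G H l ∉ upSub S G f := by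
  rw [mem_upSub]
  rintro ⟨l', -, h⟩
  exact upLine_ne_dnLine h

theorem upLine_notMem_dnSub {g : G.Sub} {l : H.Line} : upLine S G H l ∉ dnSub S H g := by
  rw [mem_dnSub]
  rintro ⟨l', -, h⟩
  exact upLine_ne_dnLine h.symm

theorem upSub_injective : Function.Injective (upSub S G (H := H)) := Finset.map_injective _

theorem dnSub_injective : Function.Injective (dnSub S H (G := G)) := Finset.map_injective _

theorem subIso_upSub (f : H.Sub) : SubIso f (upSub S G f) S.inner where
  exists_map l hl := ⟨_, upLine_mem_upSub.2 hl, rfl⟩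
  exists_of_mem l hl := by
    obtain ⟨l', hl', rfl⟩ := mem_upSub.1 hl
    exact ⟨l', hl', rfl⟩
  strictMonoOn := S.inner_strictMono.strictMonoOn _

/-- Away from `w` the map `S.dn` just relabels vertices by `S.outer`. At `w` it follows the legs of
`H`, whence the hypothesis. -/
theorem subIso_dnSub {g : G.Sub} (hg : S.w ∉ G.verts g) : SubIso g (dnSub S H g) S.outer := by
  have key : ∀ l ∈ g, (dnLine S G H l).1 = l.1.map (Prod.map S.outer id) := by
    intro l hl
    refine Sym2.map_congr fun e he => dn_of_ne ?_
    rintro h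
    exact hg (h ▸ G.mem_verts_of_mem hl he)
  refine ⟨fun l hl => ⟨_, dnLine_mem_dnSub.2 hl, key l hl⟩, fun l hl => ?_,
    fun a ha b hb hab => S.outer_lt a b ?_ ?_ hab⟩
  · obtain ⟨l', hl', rfl⟩ := mem_dnSub.1 hl
    exact ⟨l', hl', key l' hl'⟩
  · rintro rfl; exact hg ha
  · rintro rfl; exact hg hb

theorem attached_upLine_inner {l : H.Line} {b : Fin k} :
    (glue S G H).Attached (upLine S G H l) (S.inner b) ↔ H.Attached l b :=
  exists_congr fun j => up_mem_upLine (c := (b, j))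

theorem not_attached_upLine_outer {l : H.Line} {a : Fin n'} (ha : a ≠ S.w) :
    ¬ (glue S G H).Attached (upLine S G H l) (S.outer a) := by
  rintro ⟨j, hj⟩
  rw [← dn_of_ne (b := H.leg) (e := (a, j)) ha] at hj
  exact dn_notMem_upLine hj

theorem attached_dnLine_outer {l : G.Line} {a : Fin n'} (ha : a ≠ S.w) :
    (glue S G H).Attached (dnLine S G H l) (S.outer a) ↔ G.Attached l a := by
  refine exists_congr fun j => ?_
  rw [← dn_of_ne (b := H.leg) (e := (a, j)) ha]
  exact dn_mem_dnLine

theorem attached_w_of_attached_dnLine_inner {l : G.Line} {b : Fin k}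
    (h : (glue S G H).Attached (dnLine S G H l) (S.inner b)) : G.Attached l S.w := by
  obtain ⟨j, hj⟩ := h
  obtain ⟨c, hc, hcj⟩ := Sym2.mem_map.1 hj
  have := (dn_eq_up (c := (b, j)) hcj).1
  exact ⟨c.2, by rwa [← this]⟩

theorem exists_attached_dnLine_inner {l : G.Line} (h : G.Attached l S.w) :
    ∃ b, (glue S G H).Attached (dnLine S G H l) (S.inner b) := by
  obtain ⟨j, hj⟩ := h
  exact ⟨(H.leg j).1, (H.leg j).2, by
    have := dn_mem_dnLine (S := S) (H := H).2 hj
    rwa [dn_w] at this⟩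

theorem mem_verts_upSub_univ (hH : H.verts Finset.univ = Finset.univ) {v : Fin n} :
    v ∈ (glue S G H).verts (upSub S G Finset.univ) ↔ ∃ b, S.inner b = v := by
  rw [(subIso_upSub _).mem_verts, hH]
  simp

/-- `covered` leaves only the legs. The hypothesis excludes the single vertex without lines, whose
half-lines are not seen by any subgraph. -/
theorem extHalfLines_univ {k N : ℕ} {H : FeynmanGraph k N}
    (hH : H.verts Finset.univ = Finset.univ) :
    H.extHalfLines Finset.univ = Finset.univ.map ⟨H.leg, H.leg_injective⟩ := by
  ext e
  rw [mem_extHalfLines, hH, Finset.mem_map]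
  simp only [Finset.mem_univ, true_and, true_imp_iff, Function.Embedding.coeFn_mk]
  constructor
  · intro h
    exact (H.covered e).resolve_left fun ⟨l, hl, hel⟩ => h ⟨l, hl⟩ hel
  · rintro ⟨j, rfl⟩ l
    exact H.leg_notMem l.1 l.2 j

theorem numLegs_univ {k N : ℕ} {H : FeynmanGraph k N} (hH : H.verts Finset.univ = Finset.univ) :
    H.numLegs Finset.univ = N := by
  rw [numLegs_eq_card, extHalfLines_univ hH, Finset.card_map, Finset.card_univ, Fintype.card_fin]

open Classical in
theorem sub_eq_union (f : (glue S G H).Sub) :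
    f = upSub S G (Finset.univ.filter fun l => upLine S G H l ∈ f) ∪
      dnSub S H (Finset.univ.filter fun l => dnLine S G H l ∈ f) := by
  ext l
  rw [Finset.mem_union]
  rcases line_cases S G H l with ⟨l', rfl⟩ | ⟨l', rfl⟩
  · rw [upLine_mem_upSub]
    simp only [upLine_notMem_dnSub, or_false, Finset.mem_filter, Finset.mem_univ, true_and]
  · rw [dnLine_mem_dnSub]
    simp only [dnLine_notMem_upSub, false_or, Finset.mem_filter, Finset.mem_univ, true_and]

theorem disjoint_upSub_dnSub (f : H.Sub) (g : G.Sub) :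
    Disjoint (upSub S G f) (dnSub S H g) := by
  rw [Finset.disjoint_left]
  intro l hl hl'
  obtain ⟨l', -, rfl⟩ := mem_upSub.1 hl
  exact upLine_notMem_dnSub hl'

end FeynmanGraph

/-! ### Two-point subgraphs and connectedness under insertion -/

namespace FeynmanGraph

open Splitting

theorem mem_verts_iff_attached {n N : ℕ} {G : FeynmanGraph n N} {f : G.Sub} {v : Fin n} :
    v ∈ G.verts f ↔ ∃ l ∈ f, G.Attached l v := G.mem_verts

variable {n n' k N : ℕ} {S : Splitting n n' k} {G : FeynmanGraph n' N} {H : FeynmanGraph k 4}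

theorem outer_mem_verts {f : (glue S G H).Sub} {a : Fin n'} (ha : a ≠ S.w) :
    S.outer a ∈ (glue S G H).verts f ↔ ∃ l, dnLine S G H l ∈ f ∧ G.Attached l a := by
  rw [mem_verts_iff_attached]
  constructor
  · rintro ⟨l, hl, hla⟩
    rcases line_cases S G H l with ⟨l', rfl⟩ | ⟨l', rfl⟩
    · exact absurd hla (not_attached_upLine_outer ha)
    · exact ⟨l', hl, (attached_dnLine_outer ha).1 hla⟩
  · rintro ⟨l, hl, hla⟩
    exact ⟨_, hl, (attached_dnLine_outer ha).2 hla⟩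

theorem inner_mem_verts_of_mem {f : (glue S G H).Sub} {l : H.Line} {b : Fin k}
    (hl : upLine S G H l ∈ f) (hb : H.Attached l b) : S.inner b ∈ (glue S G H).verts f :=
  mem_verts_iff_attached.2 ⟨_, hl, attached_upLine_inner.2 hb⟩

theorem _root_.Phi4.Splitting.card_eq (S : Splitting n n' k) (A : Finset (Fin n)) :
    A.card = (Finset.univ.filter fun a => a ≠ S.w ∧ S.outer a ∈ A).card +
      (Finset.univ.filter fun b => S.inner b ∈ A).card := by
  classical
  rw [← Finset.card_image_of_injOn (f := S.outer)
      (s := Finset.univ.filter fun a => a ≠ S.w ∧ S.outer a ∈ A),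
    ← Finset.card_image_of_injective (Finset.univ.filter fun b => S.inner b ∈ A)
      S.inner_strictMono.injective, ← Finset.card_union_of_disjoint]
  · congr 1
    ext v
    simp only [Finset.mem_union, Finset.mem_image, Finset.mem_filter, Finset.mem_univ, true_and]
    constructor
    · intro hv
      rcases S.cover v with ⟨b, rfl⟩ | ⟨a, ha, rfl⟩
      · exact Or.inr ⟨b, hv, rfl⟩
      · exact Or.inl ⟨a, ⟨ha, hv⟩, rfl⟩
    · rintro (⟨a, ⟨-, ha⟩, rfl⟩ | ⟨b, hb, rfl⟩)
      · exact ha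
      · exact hb
  · rw [Finset.disjoint_left]
    intro v hv hv'
    simp only [Finset.mem_image, Finset.mem_filter, Finset.mem_univ, true_and] at hv hv'
    obtain ⟨a, ⟨ha, -⟩, rfl⟩ := hv
    obtain ⟨b, -, hb⟩ := hv'
    exact S.outer_ne_inner a b ha hb.symm
  · intro a ha b hb hab
    simp only [Finset.coe_filter, Finset.mem_univ, true_and, Set.mem_ofPred_eq] at ha hb
    exact S.outer_injective ha.1 hb.1 hab

-- This is `numLegs_add` with the vertices sorted into outer and inner ones. The inner vertices
-- touched may exceed those of `f`, since lines of `g` arriving at `w` end on inner vertices.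
open Classical in
theorem numLegs_union (f : H.Sub) (g : G.Sub) :
    (glue S G H).numLegs (upSub S G f ∪ dnSub S H g) + 2 * f.card + 2 * g.card =
      4 * (((G.verts g).erase S.w).card + (Finset.univ.filter fun b =>
        S.inner b ∈ (glue S G H).verts (upSub S G f ∪ dnSub S H g)).card) := by
  have h1 := (glue S G H).numLegs_add (upSub S G f ∪ dnSub S H g)
  rw [Finset.card_union_of_disjoint (disjoint_upSub_dnSub f g), upSub, dnSub, Finset.card_map,
    Finset.card_map, S.card_eq] at h1
  have h2 : (Finset.univ.filter fun a => a ≠ S.w ∧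
      S.outer a ∈ (glue S G H).verts (upSub S G f ∪ dnSub S H g)) = (G.verts g).erase S.w := by
    ext a
    simp only [Finset.mem_filter, Finset.mem_univ, true_and, Finset.mem_erase]
    refine and_congr_right fun ha => ?_
    rw [outer_mem_verts ha, mem_verts_iff_attached]
    simp only [Finset.mem_union, dnLine_notMem_upSub, dnLine_mem_dnSub, false_or]
  rw [← h2]
  unfold upSub dnSub at *
  omega

/-- Filling `w` with the four-point graph `H` preserves the number of legs of a subgraph through
`w`, which gives one direction. Conversely, a subgraph splits into a part in `H` and a part in `G`,
each empty or with at least four legs; replacing one vertex of the `G` part by at least one touched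
vertex of `H` keeps the total at least four. -/
theorem glue_noTwoPoint_iff (hH : H.verts Finset.univ = Finset.univ) :
    (glue S G H).NoTwoPoint ↔ G.NoTwoPoint ∧ H.NoTwoPoint := by
  classical
  constructor
  · refine fun h => ⟨fun g => ?_, fun f => (subIso_upSub (S := S) (G := G) f).numLegs_eq ▸ h _⟩
    by_cases hg : S.w ∈ G.verts g
    · have h1 := h (upSub S G Finset.univ ∪ dnSub S H g)
      have h2 := numLegs_union (S := S) (G := G) (H := H) Finset.univ g
      have h3 : (Finset.univ.filter fun b => S.inner b ∈
          (glue S G H).verts (upSub S G Finset.univ ∪ dnSub S H g)) = Finset.univ := by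
        ext b
        simp only [Finset.mem_filter, Finset.mem_univ, true_and, iff_true]
        have hb : b ∈ H.verts Finset.univ := hH ▸ Finset.mem_univ b
        obtain ⟨l, -, hl⟩ := mem_verts_iff_attached.1 hb
        exact inner_mem_verts_of_mem
          (Finset.mem_union_left _ (upLine_mem_upSub.2 (Finset.mem_univ l))) hl
      rw [h3] at h2
      have h4 := H.numLegs_add Finset.univ
      rw [numLegs_univ hH, hH] at h4
      have h5 := G.numLegs_add g
      have h6 := Finset.card_erase_add_one hg
      omega
    · exact (subIso_dnSub (H := H) hg).numLegs_eq ▸ h _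
  · rintro ⟨hG, hH'⟩
    rw [noTwoPoint_iff] at hG hH' ⊢
    intro h hne
    obtain ⟨f, g, rfl⟩ : ∃ f g, h = upSub S G f ∪ dnSub S H g := ⟨_, _, sub_eq_union h⟩
    have h2 := numLegs_union (S := S) (G := G) (H := H) f g
    set T := Finset.univ.filter fun b => S.inner b ∈
          (glue S G H).verts (upSub S G f ∪ dnSub S H g) with hT
    have hTf : H.verts f ⊆ T := by
      intro b hb
      obtain ⟨l, hlf, hl⟩ := mem_verts_iff_attached.1 hb
      rw [hT, Finset.mem_filter]
      exact ⟨Finset.mem_univ _, inner_mem_verts_of_mem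
        (Finset.mem_union_left _ (upLine_mem_upSub.2 hlf)) hl⟩
    have hTc := Finset.card_le_card hTf
    have h4 := H.numLegs_add f
    have h5 := G.numLegs_add g
    have hf : f = ∅ ∨ 4 ≤ H.numLegs f := f.eq_empty_or_nonempty.imp id (hH' f)
    by_cases hg : S.w ∈ G.verts g
    · have h6 := Finset.card_erase_add_one hg
      have hTpos : 0 < T.card := by
        obtain ⟨l, hlg, hl⟩ := mem_verts_iff_attached.1 hg
        obtain ⟨b, hb⟩ := exists_attached_dnLine_inner (S := S) (H := H) hl
        refine Finset.card_pos.2 ⟨b, ?_⟩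
        rw [hT, Finset.mem_filter]
        exact ⟨Finset.mem_univ _, mem_verts_iff_attached.2 ⟨_, Finset.mem_union_right _
          (dnLine_mem_dnSub.2 hlg), hb⟩⟩
      have h7 := hG g (by
        obtain ⟨l, hlg, -⟩ := mem_verts_iff_attached.1 hg
        exact ⟨l, hlg⟩)
      rcases hf with rfl | hf
      · rw [Finset.card_empty] at h2
        omega
      · omega
    · rw [Finset.erase_eq_of_notMem hg] at h2
      have hgg : g = ∅ ∨ 4 ≤ G.numLegs g := g.eq_empty_or_nonempty.imp id (hG g)
      rcases hf with rfl | hf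
      · rcases hgg with rfl | hgg
        · simp [upSub, dnSub] at hne
        · rw [Finset.card_empty] at h2
          omega
      · omega

/-- The vertex `a` of the contracted graph is the one to which `v` is mapped. -/
def _root_.Phi4.Splitting.Over (S : Splitting n n' k) (a : Fin n') (v : Fin n) : Prop :=
  (a ≠ S.w ∧ S.outer a = v) ∨ (a = S.w ∧ ∃ b, S.inner b = v)

theorem _root_.Phi4.Splitting.exists_over (S : Splitting n n' k) (v : Fin n) :
    ∃ a, S.Over a v := by
  rcases S.cover v with ⟨b, hb⟩ | ⟨a, ha, hav⟩
  · exact ⟨S.w, Or.inr ⟨rfl, b, hb⟩⟩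
  · exact ⟨a, Or.inl ⟨ha, hav⟩⟩

theorem _root_.Phi4.Splitting.Over.eq {a a' : Fin n'} {v : Fin n} (h : S.Over a v)
    (h' : S.Over a' v) : a = a' := by
  rcases h with ⟨ha, rfl⟩ | ⟨rfl, b, rfl⟩ <;> rcases h' with ⟨ha', h'⟩ | ⟨rfl, b', h'⟩
  · exact S.outer_injective ha ha' h'.symm
  · exact absurd h'.symm (S.outer_ne_inner _ _ ha)
  · exact absurd h' (S.outer_ne_inner _ _ ha')
  · rfl

theorem over_dn (S : Splitting n n' k) (b : Fin 4 → HalfLine k) (e : HalfLine n') :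
    S.Over e.1 (S.dn b e).1 := by
  by_cases he : e.1 = S.w
  · exact Or.inr ⟨he, (b e.2).1, by rw [dn, if_pos he]; rfl⟩
  · exact Or.inl ⟨he, by rw [dn_of_ne he]⟩

/-- Paths in `G` lift: between two lifted lines one moves within a fibre, which is a single vertex
or the connected `H`. -/
theorem glue_connected_of (hG : G.Connected) (hH : H.Connected) : (glue S G H).Connected := by
  have hfib : ∀ a v v', S.Over a v → S.Over a v' →
      Relation.ReflTransGen ((glue S G H).Joined Finset.univ) v v' := by
    rintro a v v' (⟨ha, rfl⟩ | ⟨rfl, b, rfl⟩) (⟨ha', rfl⟩ | ⟨ha', b', rfl⟩)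
    · exact .refl
    · exact absurd ha' ha
    · exact absurd rfl ha'
    · have := hH.2 b b'
      clear ha'
      induction this with
      | refl => exact .refl
      | tail _ hj ih =>
        obtain ⟨l, hl, hj⟩ := hj
        exact ih.tail ((subIso_upSub (S := S) (G := G) Finset.univ).joined_iff.2
          ⟨_, _, rfl, rfl, l, hl, hj⟩ |>.mono _ (Finset.subset_univ _))
  refine ⟨(S.inner ⟨0, hH.1⟩).pos, fun v v' => ?_⟩
  obtain ⟨a, ha⟩ := S.exists_over v
  obtain ⟨a', ha'⟩ := S.exists_over v'
  have := hG.2 a a'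
  induction this generalizing v' with
  | refl => exact hfib a v v' ha ha'
  | @tail c d _ hj ih =>
    obtain ⟨l, -, j, j', hl⟩ := hj
    refine (ih _ (over_dn S H.leg (c, j))).trans (.head ⟨dnLine S G H l, Finset.mem_univ _,
      (S.dn H.leg (c, j)).2, (S.dn H.leg (d, j')).2, ?_⟩
      (hfib _ _ _ (over_dn S H.leg (d, j')) ha'))
    exact congrArg (Sym2.map (S.dn H.leg)) hl

/-- Paths project: lines of `H` collapse to `w`. Nothing follows for `H`, whose parts may be joined
only through `G`. -/
theorem connected_of_glue (hG : (glue S G H).Connected) : G.Connected := by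
  refine ⟨S.w.pos, fun a a' => ?_⟩
  have key : ∀ a, ∃ v, S.Over a v := by
    intro a
    by_cases ha : a = S.w
    · subst ha
      exact ⟨_, over_dn S H.leg (S.w, 0)⟩
    · exact ⟨_, Or.inl ⟨ha, rfl⟩⟩
  obtain ⟨v, hv⟩ := key a
  obtain ⟨v', hv'⟩ := key a'
  have := hG.2 v v'
  induction this generalizing a' with
  | refl => rw [hv.eq hv']
  | tail _ hj ih =>
    obtain ⟨l, -, j, j', hl⟩ := hj
    rcases line_cases S G H l with ⟨l', rfl⟩ | ⟨l', rfl⟩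
    · obtain ⟨e, e', -, h1, h2⟩ := Sym2.exists_of_map_eq_mk hl
      refine ih _ ?_
      have h3 : S.Over S.w _ := Or.inr ⟨rfl, e'.1, congrArg Prod.fst h2⟩
      rw [hv'.eq h3]
      exact Or.inr ⟨rfl, e.1, congrArg Prod.fst h1⟩
    · obtain ⟨e, e', hee, h1, h2⟩ := Sym2.exists_of_map_eq_mk hl
      have h3 := over_dn S H.leg e
      have h4 := over_dn S H.leg e'
      rw [h1] at h3
      rw [h2] at h4
      refine (ih _ h3).tail ⟨l', Finset.mem_univ _, e.2, e'.2, ?_⟩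
      rw [hee, hv'.eq h4]

theorem connected_iff_subConnected_univ (hH : H.verts Finset.univ = Finset.univ) (l : H.Line) :
    H.Connected ↔ H.SubConnected Finset.univ := by
  refine ⟨fun h => H.subConnected_univ h l, fun h => ⟨?_, fun v w => h.2 v (hH ▸ Finset.mem_univ _)
    w (hH ▸ Finset.mem_univ _)⟩⟩
  obtain ⟨e, -⟩ := Quot.exists_rep l.1
  exact e.1.1.pos

/-- Connectedness of the inserted subgraph has to be added on the left, as the connectedness of the
whole does not imply it. For a dangerous subgraph it is part of quasi-locality. -/
theorem glue_mem_graphs_iff (hH : H.verts Finset.univ = Finset.univ) (l : H.Line) :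
    (glue S G H ∈ graphs n N ∧ (glue S G H).SubConnected (upSub S G Finset.univ)) ↔
      G ∈ graphs n' N ∧ H ∈ graphs k 4 := by
  rw [mem_graphs, mem_graphs, mem_graphs, glue_noTwoPoint_iff hH,
    (subIso_upSub Finset.univ).subConnected_iff, ← connected_iff_subConnected_univ hH l]
  exact ⟨fun ⟨⟨h1, h2, h3⟩, h4⟩ => ⟨⟨connected_of_glue h1, h2⟩, h4, h3⟩,
    fun ⟨⟨h1, h2⟩, h4, h3⟩ => ⟨⟨glue_connected_of h1 h4, h2, h3⟩, h4⟩⟩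

end FeynmanGraph

/-! ### Scales, dangerous subgraphs and moved half-lines under insertion -/

namespace FeynmanGraph

open Splitting MeasureTheory

variable {n n' k N ρ : ℕ} {S : Splitting n n' k} {G : FeynmanGraph n' N} {H : FeynmanGraph k 4}

variable (S) in
/-- The scales of `G` with `H` inserted that come from scales of `H` and of `G`. -/
noncomputable def glueScales (μH : H.Scales ρ) (μ : G.Scales ρ) : (glue S G H).Scales ρ :=
  Sum.elim μH μ ∘ (lineEquiv S G H).symm

variable {μH : H.Scales ρ} {μ : G.Scales ρ}

theorem glueScales_upLine (l : H.Line) : glueScales S μH μ (upLine S G H l) = μH l := by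
  have : upLine S G H l = lineEquiv S G H (Sum.inl l) := rfl
  rw [this, glueScales, Function.comp_apply, Equiv.symm_apply_apply, Sum.elim_inl]

theorem glueScales_dnLine (l : G.Line) : glueScales S μH μ (dnLine S G H l) = μ l := by
  have : dnLine S G H l = lineEquiv S G H (Sum.inr l) := rfl
  rw [this, glueScales, Function.comp_apply, Equiv.symm_apply_apply, Sum.elim_inr]

/-- The only new neighbours of a subgraph of `H` are lines of `G` attached to `w`, and these are
below all the lines of `H`. -/
theorem quasiLocal_upSub (hlt : ∀ l l', G.Attached l' S.w → μ l' < μH l) (f : H.Sub) :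
    (glue S G H).QuasiLocal (glueScales S μH μ) (upSub S G f) ↔ H.QuasiLocal μH f := by
  refine and_congr (subIso_upSub f).subConnected_iff ⟨fun h l hl l' hl' => ?_, fun h l hl l' hl' => ?_⟩
  · rintro ⟨v, hv, hv'⟩
    have := h _ (upLine_mem_upSub.2 hl) _ (mt upLine_mem_upSub.1 hl')
      ⟨S.inner v, (subIso_upSub f).mem_verts.2 ⟨v, hv, rfl⟩, attached_upLine_inner.2 hv'⟩
    rwa [glueScales_upLine, glueScales_upLine] at this
  · rintro ⟨v, hv, hv'⟩
    obtain ⟨b, hb, rfl⟩ := (subIso_upSub f).mem_verts.1 hv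
    obtain ⟨l, hlf, rfl⟩ := mem_upSub.1 hl
    rcases line_cases S G H l' with ⟨l', rfl⟩ | ⟨l', rfl⟩
    · rw [glueScales_upLine, glueScales_upLine]
      exact h l hlf l' (mt upLine_mem_upSub.2 hl') ⟨b, hb, attached_upLine_inner.1 hv'⟩
    · rw [glueScales_upLine, glueScales_dnLine]
      exact hlt _ _ (attached_w_of_attached_dnLine_inner hv')

theorem quasiLocal_upSub_univ (hH : H.verts Finset.univ = Finset.univ) :
    (glue S G H).QuasiLocal (glueScales S μH μ) (upSub S G Finset.univ) ↔
      H.SubConnected Finset.univ ∧ ∀ l l', G.Attached l' S.w → μ l' < μH l := by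
  refine ⟨fun h => ⟨(subIso_upSub _).subConnected_iff.1 h.1, fun l l' hl' => ?_⟩,
    fun h => (quasiLocal_upSub h.2 _).2 ⟨h.1, fun _ _ l' hl' => absurd (Finset.mem_univ l') hl'⟩⟩
  obtain ⟨b, hb⟩ := exists_attached_dnLine_inner (S := S) (H := H) hl'
  have := h.2 _ (upLine_mem_upSub.2 (Finset.mem_univ l)) _ dnLine_notMem_upSub
    ⟨_, (mem_verts_upSub_univ hH).2 ⟨b, rfl⟩, hb⟩
  rwa [glueScales_upLine, glueScales_dnLine] at this

theorem quasiLocal_dnSub {g : G.Sub} (hg : S.w ∉ G.verts g) :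
    (glue S G H).QuasiLocal (glueScales S μH μ) (dnSub S H g) ↔ G.QuasiLocal μ g := by
  have hne : ∀ a ∈ G.verts g, a ≠ S.w := by rintro a ha rfl; exact hg ha
  refine and_congr (subIso_dnSub hg).subConnected_iff ⟨fun h l hl l' hl' => ?_, fun h l hl l' hl' => ?_⟩
  · rintro ⟨v, hv, hv'⟩
    have := h _ (dnLine_mem_dnSub.2 hl) _ (mt dnLine_mem_dnSub.1 hl')
      ⟨S.outer v, (subIso_dnSub hg).mem_verts.2 ⟨v, hv, rfl⟩,
        (attached_dnLine_outer (hne v hv)).2 hv'⟩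
    rwa [glueScales_dnLine, glueScales_dnLine] at this
  · rintro ⟨v, hv, hv'⟩
    obtain ⟨b, hb, rfl⟩ := (subIso_dnSub hg).mem_verts.1 hv
    obtain ⟨l, hlg, rfl⟩ := mem_dnSub.1 hl
    rcases line_cases S G H l' with ⟨l', rfl⟩ | ⟨l', rfl⟩
    · exact absurd hv' (not_attached_upLine_outer (hne b hb))
    · rw [glueScales_dnLine, glueScales_dnLine]
      exact h l hlg l' (mt dnLine_mem_dnSub.2 hl') ⟨b, hb, (attached_dnLine_outer (hne b hb)).1 hv'⟩

theorem upSub_mem_dangerous (hlt : ∀ l l', G.Attached l' S.w → μ l' < μH l) {f : H.Sub} :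
    upSub S G f ∈ (glue S G H).dangerous (glueScales S μH μ) ↔ f ∈ H.dangerous μH := by
  rw [mem_dangerous, mem_dangerous, quasiLocal_upSub hlt, (subIso_upSub f).numLegs_eq]

theorem dnSub_mem_dangerous {g : G.Sub} (hg : S.w ∉ G.verts g) :
    dnSub S H g ∈ (glue S G H).dangerous (glueScales S μH μ) ↔ g ∈ G.dangerous μ := by
  rw [mem_dangerous, mem_dangerous, quasiLocal_dnSub hg, (subIso_dnSub hg).numLegs_eq]

/-- A quasi-local subgraph whose lines are above all those attached to the inserted subgraph either
lies in it, or does not touch it. -/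
theorem quasiLocal_cases (hH : H.verts Finset.univ = Finset.univ) {c : ℤ}
    (hlt : ∀ l, G.Attached l S.w → ((μ l : ℕ) : ℤ) < c) {f : (glue S G H).Sub}
    (hf : (glue S G H).SubConnected f)
    (hc : ∀ l ∈ f, c ≤ ((glueScales S μH μ l : ℕ) : ℤ)) :
    (∃ f', f = upSub S G f') ∨ ∃ g, S.w ∉ G.verts g ∧ f = dnSub S H g := by
  classical
  by_cases hsub : f ⊆ upSub S G Finset.univ
  · left
    refine ⟨_, (sub_eq_union f).trans (Finset.union_eq_left.2 fun l hl => ?_)⟩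
    obtain ⟨l', hl', rfl⟩ := mem_dnSub.1 hl
    rw [Finset.mem_filter] at hl'
    exact absurd (hsub hl'.2) dnLine_notMem_upSub
  · right
    have hdisj : ∀ v ∈ (glue S G H).verts f,
        v ∉ (glue S G H).verts (upSub S G Finset.univ) := by
      intro v hv hv'
      obtain ⟨l, hlf, hl, v', hv', ha⟩ :=
        (glue S G H).exists_line_of_not_subset hf hv hv' hsub
      obtain ⟨b, rfl⟩ := (mem_verts_upSub_univ hH).1 hv'
      rcases line_cases S G H l with ⟨l', rfl⟩ | ⟨l', rfl⟩
      · exact hl (upLine_mem_upSub.2 (Finset.mem_univ _))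
      · have h1 := hc _ hlf
        rw [glueScales_dnLine] at h1
        have h2 := hlt _ (attached_w_of_attached_dnLine_inner ha)
        omega
    refine ⟨Finset.univ.filter fun l => dnLine S G H l ∈ f, fun hw => ?_,
      (sub_eq_union f).trans (Finset.union_eq_right.2 fun l hl => ?_)⟩
    · obtain ⟨l, hl, ha⟩ := mem_verts_iff_attached.1 hw
      rw [Finset.mem_filter] at hl
      obtain ⟨b, hb⟩ := exists_attached_dnLine_inner (S := S) (H := H) ha
      exact hdisj _ (mem_verts_iff_attached.2 ⟨_, hl.2, hb⟩) ((mem_verts_upSub_univ hH).2 ⟨b, rfl⟩)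
    · obtain ⟨l', hl', rfl⟩ := mem_upSub.1 hl
      rw [Finset.mem_filter] at hl'
      have hb : ∃ b, H.Attached l' b := by
        obtain ⟨⟨e, e'⟩, hee⟩ := Quot.exists_rep l'.1
        exact ⟨e.1, e.2, by rw [← hee]; exact Sym2.mem_mk_left _ _⟩
      obtain ⟨b, hb⟩ := hb
      exact absurd ((mem_verts_upSub_univ hH).2 ⟨b, rfl⟩)
        (hdisj _ (inner_mem_verts_of_mem hl'.2 hb))

theorem vertexScale_le_iff {n N : ℕ} {G : FeynmanGraph n N} {μ : G.Scales ρ} {v : Fin n} {c : ℤ} :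
    G.vertexScale μ v ≤ c ↔ -1 ≤ c ∧ ∀ l, G.Attached l v → ((μ l : ℕ) : ℤ) ≤ c := by
  unfold vertexScale
  rw [Finset.max'_le_iff]
  simp only [Finset.mem_insert, Finset.mem_image, Finset.mem_filter, Finset.mem_univ, true_and,
    forall_eq_or_imp, forall_exists_index, and_imp]
  exact and_congr_right fun _ => ⟨fun h l hl => h _ l hl rfl, fun h _ l hl hla => hla ▸ h l hl⟩

theorem vertexScale_glue_outer {a : Fin n'} (ha : a ≠ S.w) :
    (glue S G H).vertexScale (glueScales S μH μ) (S.outer a) = G.vertexScale μ a := by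
  refine eq_of_forall_ge_iff fun c => ?_
  rw [vertexScale_le_iff, vertexScale_le_iff]
  refine and_congr_right fun _ => ⟨fun h l hl => ?_, fun h l hl => ?_⟩
  · have := h _ ((attached_dnLine_outer (H := H) ha).2 hl)
    rwa [glueScales_dnLine] at this
  · rcases line_cases S G H l with ⟨l', rfl⟩ | ⟨l', rfl⟩
    · exact absurd hl (not_attached_upLine_outer ha)
    · rw [glueScales_dnLine]
      exact h _ ((attached_dnLine_outer ha).1 hl)

/-- Every vertex of `H` carries a line of `H`, which dominates the lines of `G` that arrive there.
-/
theorem vertexScale_glue_inner (hlt : ∀ l l', G.Attached l' S.w → μ l' < μH l)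
    (hH : H.verts Finset.univ = Finset.univ) (b : Fin k) :
    (glue S G H).vertexScale (glueScales S μH μ) (S.inner b) = H.vertexScale μH b := by
  refine eq_of_forall_ge_iff fun c => ?_
  rw [vertexScale_le_iff, vertexScale_le_iff]
  refine and_congr_right fun _ => ⟨fun h l hl => ?_, fun h l hl => ?_⟩
  · have := h _ (attached_upLine_inner.2 hl)
    rwa [glueScales_upLine] at this
  · rcases line_cases S G H l with ⟨l', rfl⟩ | ⟨l', rfl⟩
    · rw [glueScales_upLine]
      exact h _ (attached_upLine_inner.1 hl)
    · rw [glueScales_dnLine]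
      have hb : b ∈ H.verts Finset.univ := hH ▸ Finset.mem_univ b
      obtain ⟨l, -, hl'⟩ := mem_verts_iff_attached.1 hb
      have h1 := h l hl'
      have h2 : μ l' < μH l := hlt l l' (attached_w_of_attached_dnLine_inner hl)
      have h3 : (μ l' : ℕ) < (μH l : ℕ) := h2
      omega

section Position

variable (S) in
open Classical in
/-- The forest made of the inserted subgraph `H`, of a forest of subgraphs of `H` and of a forest of
subgraphs of `G`. -/
noncomputable def glueForest (FH : Finset H.Sub) (FG : Finset G.Sub) :
    Finset (glue S G H).Sub :=
  insert (upSub S G Finset.univ) (FH.image (upSub S G) ∪ FG.image (dnSub S H))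

theorem mem_glueForest {FH : Finset H.Sub} {FG : Finset G.Sub} {f : (glue S G H).Sub} :
    f ∈ glueForest S FH FG ↔ f = upSub S G Finset.univ ∨ (∃ f' ∈ FH, upSub S G f' = f) ∨
      ∃ g ∈ FG, dnSub S H g = f := by
  simp [glueForest]

variable {FH : Finset H.Sub} {FG : Finset G.Sub}

theorem up_notMem_verts_dnSub {g : G.Sub} (hg : S.w ∉ G.verts g) (b : Fin k) :
    S.inner b ∉ (glue S G H).verts (dnSub S H g) := by
  rw [(subIso_dnSub hg).mem_verts]
  rintro ⟨a, ha, hab⟩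
  exact S.outer_ne_inner a b (by rintro rfl; exact hg ha) hab

theorem outer_notMem_verts_upSub {f : H.Sub} {a : Fin n'} (ha : a ≠ S.w) :
    S.outer a ∉ (glue S G H).verts (upSub S G f) := by
  rw [(subIso_upSub f).mem_verts]
  rintro ⟨b, -, hab⟩
  exact S.outer_ne_inner a b ha hab.symm

/-- Being on a line of `H`, the half-line is not external to the inserted subgraph, and the
subgraphs taken from `G` avoid its vertex. Only the elements that come from `FH` can move it. -/
theorem position_glue_up (hFG : ∀ g ∈ FG, S.w ∉ G.verts g) {c : HalfLine k} {l₀ : H.Line}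
    (hc : c ∈ l₀.1) :
    (glue S G H).position (glueForest S FH FG) (S.up c) = S.inner (H.position FH c) := by
  classical
  unfold position
  rw [← (subIso_upSub (S := S) (G := G) _).anchor_eq]
  congr 1
  ext l
  simp only [Finset.mem_biUnion, Finset.mem_filter, mem_upSub, id]
  constructor
  · rintro ⟨f, ⟨hf, hv, hext⟩, hl⟩
    rcases mem_glueForest.1 hf with rfl | ⟨f, hfF, rfl⟩ | ⟨g, hg, rfl⟩
    · exact absurd (up_mem_upLine.2 hc) (hext _ (upLine_mem_upSub.2 (Finset.mem_univ l₀)))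
    · obtain ⟨l', hl', rfl⟩ := mem_upSub.1 hl
      refine ⟨l', ⟨f, ⟨hfF, ?_, fun l hl hcl => hext _ (upLine_mem_upSub.2 hl)
        (up_mem_upLine.2 hcl)⟩, hl'⟩, rfl⟩
      obtain ⟨b, hb, hbc⟩ := (subIso_upSub f).mem_verts.1 hv
      rwa [← S.inner_strictMono.injective hbc]
    · exact absurd hv (up_notMem_verts_dnSub (hFG g hg) _)
  · rintro ⟨l', ⟨f, ⟨hf, hv, hext⟩, hl⟩, rfl⟩
    refine ⟨_, ⟨mem_glueForest.2 (Or.inr (Or.inl ⟨f, hf, rfl⟩)),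
      (subIso_upSub f).mem_verts.2 ⟨_, hv, rfl⟩, fun l hl hcl => ?_⟩, upLine_mem_upSub.2 hl⟩
    obtain ⟨l', hl', rfl⟩ := mem_upSub.1 hl
    exact hext l' hl' (up_mem_upLine.1 hcl)

open Classical in
/-- The position of the vertices of the contracted graph when the subgraph sits at `v₀`. -/
noncomputable def _root_.Phi4.Splitting.place (S : Splitting n n' k) (v₀ : Fin k) (a : Fin n') :
    Fin n :=
  if a = S.w then S.inner v₀ else S.outer a

theorem anchor_empty {n N : ℕ} (G : FeynmanGraph n N) (v : Fin n) : G.anchor ∅ v = v := by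
  rcases G.anchor_mem_or ∅ v with h | h
  · exact h.2
  · have := G.extVerts_subset _ h
    simp [verts] at this

/-- At `w`, the inserted subgraph has the half-line as a leg and contains the elements of `FH`, so
its anchor decides. Elsewhere only the elements of `FG` matter, and they avoid `w`. -/
theorem position_glue_dn (hH : H.verts Finset.univ = Finset.univ)
    (hFG : ∀ g ∈ FG, S.w ∉ G.verts g) (hne : (H.extVerts Finset.univ).Nonempty) (e : HalfLine n') :
    (glue S G H).position (glueForest S FH FG) (S.dn H.leg e) =
      S.place ((H.extVerts Finset.univ).min' hne) (G.position FG e) := by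
  classical
  by_cases he : e.1 = S.w
  · have h1 : G.position FG e = S.w := by
      unfold position
      rw [Finset.filter_false_of_mem, Finset.biUnion_empty, anchor_empty, he]
      rintro g hg ⟨hv, -⟩
      exact hFG g hg (he ▸ hv)
    have h2 : S.dn H.leg e = S.up (H.leg e.2) := if_pos he
    rw [h1, Splitting.place, if_pos rfl]
    unfold position
    have h3 : ((glueForest S FH FG).filter fun h => (S.dn H.leg e).1 ∈ (glue S G H).verts h ∧
        ∀ l ∈ h, S.dn H.leg e ∉ l.1).biUnion id = upSub S G Finset.univ := by
      ext l
      simp only [Finset.mem_biUnion, Finset.mem_filter, id]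
      constructor
      · rintro ⟨f, ⟨hf, hv, hext⟩, hl⟩
        rcases mem_glueForest.1 hf with rfl | ⟨f, hf, rfl⟩ | ⟨g, hg, rfl⟩
        · exact hl
        · obtain ⟨l', -, rfl⟩ := mem_upSub.1 hl
          exact upLine_mem_upSub.2 (Finset.mem_univ _)
        · rw [h2] at hv
          exact absurd hv (up_notMem_verts_dnSub (hFG g hg) _)
      · intro hl
        refine ⟨_, ⟨mem_glueForest.2 (Or.inl rfl), ?_, fun l hl => ?_⟩, hl⟩
        · rw [h2]
          exact (mem_verts_upSub_univ hH).2 ⟨_, rfl⟩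
        · obtain ⟨l', -, rfl⟩ := mem_upSub.1 hl
          exact dn_notMem_upLine
    have h4 : (glue S G H).anchor (upSub S G Finset.univ) (S.dn H.leg e).1 =
        S.inner ((H.extVerts Finset.univ).min' hne) := by
      rw [h2]
      refine ((subIso_upSub _).anchor_eq _).trans ?_
      rw [anchor, dif_pos hne]
    rw [← h4, ← h3]
  · have h2 : S.dn H.leg e = (S.outer e.1, e.2) := if_neg he
    set T := FG.filter fun h => e.1 ∈ G.verts h ∧ ∀ l ∈ h, e ∉ l.1 with hT
    -- The union that decides the position also avoids `w`, so its anchor can be transported by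
    -- `subIso_dnSub`.
    have hw : S.w ∉ G.verts (T.biUnion id) := by
      intro hw
      obtain ⟨l, hl, ha⟩ := mem_verts_iff_attached.1 hw
      obtain ⟨g, hg, hlg⟩ := Finset.mem_biUnion.1 hl
      exact hFG g (Finset.mem_filter.1 hg).1 (mem_verts_iff_attached.2 ⟨l, hlg, ha⟩)
    have h1 : G.position FG e = G.anchor (T.biUnion id) e.1 := by
      unfold position
      rw [hT]
    have h5 : G.position FG e ≠ S.w := by
      rw [h1]
      rcases G.anchor_mem_or (T.biUnion id) e.1 with h | h
      · rw [h.2]; exact he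
      · intro h'
        rw [h'] at h
        exact hw (G.extVerts_subset _ h)
    rw [Splitting.place, if_neg h5, h1, ← (subIso_dnSub (H := H) hw).anchor_eq]
    unfold position
    rw [h2]
    congr 1
    ext l
    simp only [Finset.mem_biUnion, Finset.mem_filter, mem_dnSub, id, hT]
    constructor
    · rintro ⟨f, ⟨hf, hv, hext⟩, hl⟩
      rcases mem_glueForest.1 hf with rfl | ⟨f, hf, rfl⟩ | ⟨g, hg, rfl⟩
      · exact absurd hv (outer_notMem_verts_upSub he)
      · exact absurd hv (outer_notMem_verts_upSub he)
      · obtain ⟨l', hl', rfl⟩ := mem_dnSub.1 hl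
        refine ⟨l', ⟨g, ⟨hg, ?_, fun l hl hcl => hext _ (dnLine_mem_dnSub.2 hl) ?_⟩, hl'⟩, rfl⟩
        · obtain ⟨b, hb, hbc⟩ := (subIso_dnSub (hFG g hg)).mem_verts.1 hv
          rwa [← S.outer_injective (by rintro rfl; exact hFG g hg hb) he hbc]
        · rw [← h2]
          exact dn_mem_dnLine.2 hcl
    · rintro ⟨l', ⟨g, ⟨hg, hv, hext⟩, hl⟩, rfl⟩
      refine ⟨_, ⟨mem_glueForest.2 (Or.inr (Or.inr ⟨g, hg, rfl⟩)),
        (subIso_dnSub (hFG g hg)).mem_verts.2 ⟨_, hv, rfl⟩, fun l hl hcl => ?_⟩,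
        dnLine_mem_dnSub.2 hl⟩
      obtain ⟨l', hl', rfl⟩ := mem_dnSub.1 hl
      rw [← h2] at hcl
      exact hext l' hl' (dn_mem_dnLine.1 hcl)

theorem lineProduct_glue (M m : ℝ) (hH : H.verts Finset.univ = Finset.univ)
    (hFG : ∀ g ∈ FG, S.w ∉ G.verts g) (hne : (H.extVerts Finset.univ).Nonempty)
    (x : Fin n → Space) :
    (glue S G H).lineProduct M m (glueScales S μH μ) (glueForest S FH FG) x =
      H.lineProduct M m μH FH (fun b => x (S.inner b)) *
        G.lineProduct M m μ FG
          (fun a => x (S.place ((H.extVerts Finset.univ).min' hne) a)) := by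
  unfold lineProduct
  rw [← (lineEquiv S G H).prod_comp, Fintype.prod_sum_type]
  congr 1
  · refine Finset.prod_congr rfl fun l _ => ?_
    change Sym2.lift _ (upLine S G H l).1 = _
    have h1 : (upLine S G H l).1 = s(S.up (ends l).1, S.up (ends l).2) :=
      (congrArg (Sym2.map S.up) (mk_ends l).symm :)
    have h2 := mk_ends l
    have hl1 : (ends l).1 ∈ l.1 := by rw [← h2]; exact Sym2.mem_mk_left _ _
    have hl2 : (ends l).2 ∈ l.1 := by rw [← h2]; exact Sym2.mem_mk_right _ _
    rw [h1]
    conv_rhs => rw [← h2]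
    simp only [Sym2.lift_mk]
    rw [position_glue_up hFG hl1, position_glue_up hFG hl2]
    change propagator M m (glueScales S μH μ (upLine S G H l)) _ _ = _
    rw [glueScales_upLine]
  · refine Finset.prod_congr rfl fun l _ => ?_
    change Sym2.lift _ (dnLine S G H l).1 = _
    have h1 : (dnLine S G H l).1 = s(S.dn H.leg (ends l).1, S.dn H.leg (ends l).2) :=
      (congrArg (Sym2.map (S.dn H.leg)) (mk_ends l).symm :)
    rw [h1]
    conv_rhs => rw [← mk_ends l]
    simp only [Sym2.lift_mk]
    rw [position_glue_dn hH hFG hne, position_glue_dn hH hFG hne]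
    change propagator M m (glueScales S μH μ (dnLine S G H l)) _ _ = _
    rw [glueScales_dnLine]

theorem integrand_glue (M m : ℝ) (hH : H.verts Finset.univ = Finset.univ)
    (hFG : ∀ g ∈ FG, S.w ∉ G.verts g) (hne : (H.extVerts Finset.univ).Nonempty)
    (a : (Fin N → Space) → ℝ) (x : Fin n → Space) :
    (glue S G H).integrand M m (glueScales S μH μ) (glueForest S FH FG) a x =
      H.lineProduct M m μH FH (fun b => x (S.inner b)) *
        G.integrand M m μ FG a
          (fun a => x (S.place ((H.extVerts Finset.univ).min' hne) a)) := by
  unfold integrand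
  rw [lineProduct_glue M m hH hFG hne, mul_assoc]
  congr 3
  funext j
  exact congrArg x (position_glue_dn hH hFG hne (G.leg j))

end Position

end FeynmanGraph

/-! ### Factorization of the amplitude of a contracted subgraph -/

namespace FeynmanGraph

open Splitting MeasureTheory

variable {n n' k N ρ : ℕ} {S : Splitting n n' k} {G : FeynmanGraph n' N} {H : FeynmanGraph k 4}

/-- The vertices of the subgraph other than `v₀`, together with those of the contracted graph. -/
noncomputable def _root_.Phi4.Splitting.vertexEquiv (S : Splitting n n' k) (v₀ : Fin k) :
    {v : Fin k // v ≠ v₀} ⊕ Fin n' ≃ Fin n :=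
  Equiv.ofBijective (Sum.elim (fun v => S.inner v) (S.place v₀)) (by
    constructor
    · refine (S.inner_strictMono.injective.comp Subtype.val_injective).sumElim ?_ ?_
      · intro a b hab
        unfold Splitting.place at hab
        split_ifs at hab with ha hb hb
        · rw [ha, hb]
        · exact absurd hab.symm (S.outer_ne_inner _ _ hb)
        · exact absurd hab (S.outer_ne_inner _ _ ha)
        · exact S.outer_injective ha hb hab
      · intro v a hva
        unfold Splitting.place at hva
        split_ifs at hva with ha
        · exact v.2 (S.inner_strictMono.injective hva)
        · exact S.outer_ne_inner _ _ ha hva.symm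
    · intro v
      rcases S.cover v with ⟨b, rfl⟩ | ⟨a, ha, rfl⟩
      · by_cases hb : b = v₀
        · exact ⟨Sum.inr S.w, by simp [Splitting.place, hb]⟩
        · exact ⟨Sum.inl ⟨b, hb⟩, rfl⟩
      · exact ⟨Sum.inr a, by simp [Splitting.place, ha]⟩)

/-- Separation of the integration over the positions in the subgraph relative to `v₀`. -/
theorem integral_splitting (S : Splitting n n' k) (v₀ : Fin k) {P : (Fin k → Space) → ℝ}
    (hP : ∀ x c, P (fun v => x v + c) = P x) {Q : (Fin n' → Space) → ℝ}
    (hint : Integrable fun x : Fin n → Space =>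
      P (fun b => x (S.inner b)) * Q (fun a => x (S.place v₀ a))) :
    ∫ x : Fin n → Space, P (fun b => x (S.inner b)) * Q (fun a => x (S.place v₀ a)) =
      (∫ y, P (pinned v₀ y)) * ∫ x, Q x := by
  set E := S.vertexEquiv v₀ with hE
  set Φ := (MeasurableEquiv.sumPiEquivProdPi
    (fun _ : {v : Fin k // v ≠ v₀} ⊕ Fin n' => Space)).symm.trans
    (MeasurableEquiv.piCongrLeft (fun _ : Fin n => Space) E) with hΦ
  have hmp : MeasurePreserving Φ :=
    (volume_measurePreserving_sumPiEquivProdPi_symm _).trans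
      (volume_measurePreserving_piCongrLeft _ E)
  have hΦl : ∀ z x' v, Φ (z, x') (E (Sum.inl v)) = z v := fun z x' v => by
    simp [hΦ, MeasurableEquiv.piCongrLeft, MeasurableEquiv.sumPiEquivProdPi]
  have hΦr : ∀ z x' v, Φ (z, x') (E (Sum.inr v)) = x' v := fun z x' v => by
    simp [hΦ, MeasurableEquiv.piCongrLeft, MeasurableEquiv.sumPiEquivProdPi]
  have hQ : ∀ z x', (fun a => Φ (z, x') (S.place v₀ a)) = x' := fun z x' => by
    funext a
    exact hΦr z x' a
  -- In the new coordinates the anchor `v₀` sits at `x' S.w`. Translation invariance of `P` brings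
  -- it to the origin.
  have hPz : ∀ z x', P (fun b => Φ (z, x') (S.inner b)) =
      P (pinned v₀ (fun v => z v - x' S.w)) := fun z x' => by
    rw [← hP (pinned v₀ fun v => z v - x' S.w) (x' S.w)]
    congr 1
    funext b
    by_cases hb : b = v₀
    · subst hb
      have h1 := hΦr z x' S.w
      have h2 : E (Sum.inr S.w) = S.inner b := if_pos rfl
      rw [h2] at h1
      simp [h1, pinned]
    · have h1 := hΦl z x' ⟨b, hb⟩
      have h2 : E (Sum.inl ⟨b, hb⟩) = S.inner b := rfl
      rw [h2] at h1
      simp [h1, pinned, hb]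
  rw [← hmp.integral_comp Φ.measurableEmbedding]
  have hint' := (hmp.integrable_comp_emb Φ.measurableEmbedding).2 hint
  have hcongr : (fun p : ({v : Fin k // v ≠ v₀} → Space) × (Fin n' → Space) =>
      P (fun b => Φ p (S.inner b)) * Q (fun a => Φ p (S.place v₀ a))) =
      fun p => P (pinned v₀ (fun v => p.1 v - p.2 S.w)) * Q p.2 := by
    funext p
    rw [← hPz p.1 p.2, hQ p.1 p.2]
  rw [hcongr]
  have hint'' : Integrable (fun p : ({v : Fin k // v ≠ v₀} → Space) × (Fin n' → Space) =>
      P (pinned v₀ (fun v => p.1 v - p.2 S.w)) * Q p.2) (volume.prod volume) := by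
    rw [← hcongr]
    exact hint'
  rw [Measure.volume_eq_prod, integral_prod_symm _ hint'']
  simp only [integral_mul_const]
  -- The inner integral loses its dependence on the position of `w` by translation of all its
  -- variables, and the two integrals decouple.
  have hshift : ∀ c : Space, ∫ z : {v : Fin k // v ≠ v₀} → Space, P (pinned v₀ (fun v => z v - c)) =
      ∫ z, P (pinned v₀ z) := fun c =>
    integral_sub_right_eq_self (fun z => P (pinned v₀ z)) (fun _ : {v : Fin k // v ≠ v₀} => c)
  simp only [hshift]
  rw [integral_const_mul]

theorem extVerts_univ_nonempty {H : FeynmanGraph k 4} (hH : H.verts Finset.univ = Finset.univ) :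
    (H.extVerts Finset.univ).Nonempty := by
  refine ⟨(H.leg 0).1, (H.mem_extVerts).2 ⟨(H.leg 0).2, ?_⟩⟩
  rw [extHalfLines_univ hH]
  exact Finset.mem_map_of_mem _ (Finset.mem_univ 0)

variable {μH : H.Scales ρ} {μ : G.Scales ρ} {FH : Finset H.Sub} {FG : Finset G.Sub}

/-- The operator that contracts an inserted subgraph to a point factorizes the amplitude. -/
theorem amplitude_glue {M m : ℝ} (hM : 1 < M) (hm : 0 < m) (hgl : glue S G H ∈ graphs n N)
    (hF : glueForest S FH FG ⊆ (glue S G H).dangerous (glueScales S μH μ))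
    (hH : H.verts Finset.univ = Finset.univ) (hFG : ∀ g ∈ FG, S.w ∉ G.verts g)
    (a : 𝓢(Fin N → Space, ℝ)) :
    (glue S G H).amplitude M m (glueScales S μH μ) (glueForest S FH FG) a =
      H.localPart M m μH FH * G.amplitude M m μ FG a := by
  have hne := extVerts_univ_nonempty hH
  have hint := (glue S G H).integrable_integrand hM hm hgl hF a
  have h := funext (integrand_glue (S := S) (μH := μH) (μ := μ) (FH := FH) M m hH hFG hne a)
  unfold amplitude localPart
  rw [dif_pos hne]
  rw [h] at hint ⊢
  exact integral_splitting S _ (fun x c => H.lineProduct_add_right μH M m FH x c) hint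

end FeynmanGraph

/-! ### Counting the insertions that give a marked subgraph -/

theorem _root_.Sym2.exists_map_eq {α β : Type*} {f : α → β} {z : Sym2 β}
    (h : ∀ e ∈ z, ∃ c, f c = e) : ∃ z' : Sym2 α, z'.map f = z := by
  induction z with
  | _ a b =>
    obtain ⟨c, hc⟩ := h a (Sym2.mem_mk_left _ _)
    obtain ⟨d, hd⟩ := h b (Sym2.mem_mk_right _ _)
    exact ⟨s(c, d), by rw [Sym2.map_mk, hc, hd]⟩

namespace FeynmanGraph

open Splitting

variable {n n' k N : ℕ} (S : Splitting n n' k)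

-- A graph with a marked subgraph is an element of a sigma type. Its equality is reduced to
-- equalities of sets of lines and of legs, which do not involve dependent types.
open Classical in
theorem sigma_glue_eq_iff {G : FeynmanGraph n' N} {H : FeynmanGraph k 4}
    {Γ : FeynmanGraph n N} {h : Γ.Sub} :
    (⟨glue S G H, upSub S G Finset.univ⟩ : Σ Γ : FeynmanGraph n N, Γ.Sub) = ⟨Γ, h⟩ ↔
      H.lines.image (Sym2.map S.up) = h.image Subtype.val ∧
      G.lines.image (Sym2.map (S.dn H.leg)) = Γ.lines \ h.image Subtype.val ∧
      ∀ j, S.dn H.leg (G.leg j) = Γ.leg j := by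
  have h1 : (upSub S G (Finset.univ : H.Sub)).image Subtype.val =
      H.lines.image (Sym2.map S.up) := by
    ext z
    simp only [Finset.mem_image, mem_upSub, Finset.mem_univ, true_and]
    constructor
    · rintro ⟨_, ⟨l, rfl⟩, rfl⟩
      exact ⟨l.1, l.2, rfl⟩
    · rintro ⟨l, hl, rfl⟩
      exact ⟨upLine S G H ⟨l, hl⟩, ⟨_, rfl⟩, rfl⟩
  have h2 : ∀ z ∈ G.lines.image (Sym2.map (S.dn H.leg)),
      z ∉ H.lines.image (Sym2.map S.up) := by
    intro z hz hz'
    obtain ⟨l, hl, rfl⟩ := Finset.mem_image.1 hz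
    obtain ⟨l', hl', h⟩ := Finset.mem_image.1 hz'
    exact upLine_ne_dnLine (S := S) (G := G) (H := H) (l := ⟨l', hl'⟩) (l' := ⟨l, hl⟩)
      (Subtype.ext h)
  constructor
  · rintro heq
    cases heq
    refine ⟨h1.symm, ?_, fun _ => rfl⟩
    rw [h1]
    change _ = (H.lines.image (Sym2.map S.up) ∪ G.lines.image (Sym2.map (S.dn H.leg))) \ _
    rw [Finset.union_sdiff_left, Finset.sdiff_eq_self_of_disjoint]
    exact Finset.disjoint_left.2 h2
  · rintro ⟨h3, h4, h5⟩
    have hΓ : glue S G H = Γ := by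
      refine FeynmanGraph.ext ?_ (funext h5)
      change H.lines.image (Sym2.map S.up) ∪ G.lines.image (Sym2.map (S.dn H.leg)) = _
      rw [h3, h4, Finset.union_sdiff_of_subset]
      intro z hz
      obtain ⟨l, -, rfl⟩ := Finset.mem_image.1 hz
      exact l.2
    subst hΓ
    rw [← h1] at h3
    rw [Finset.image_injective Subtype.val_injective h3]

theorem eq_of_sigma_glue_eq {G G' : FeynmanGraph n' N} {H H' : FeynmanGraph k 4}
    (h : (⟨glue S G H, upSub S G Finset.univ⟩ : Σ Γ : FeynmanGraph n N, Γ.Sub) =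
      ⟨glue S G' H', upSub S G' Finset.univ⟩) (hleg : ∀ j, S.up (H.leg j) = S.up (H'.leg j)) :
    G = G' ∧ H = H' := by
  classical
  obtain ⟨h1, h2, h3⟩ := (sigma_glue_eq_iff S).1 h
  obtain ⟨h1', h2', h3'⟩ := (sigma_glue_eq_iff S).1 (Eq.refl (⟨glue S G' H',
    upSub S G' Finset.univ⟩ : Σ Γ : FeynmanGraph n N, Γ.Sub))
  have hl : H.leg = H'.leg := funext fun j => S.up_injective (hleg j)
  constructor
  · refine FeynmanGraph.ext (Finset.image_injective
      (Sym2.map.injective (dn_injective (S := S) H.leg_injective)) ?_) (funext fun j => ?_)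
    · rw [h2, ← h2', hl]
    · refine dn_injective (S := S) H.leg_injective ?_
      rw [h3, ← h3', hl]
  · refine FeynmanGraph.ext (Finset.image_injective (Sym2.map.injective S.up_injective) ?_) hl
    rw [h1, ← h1']

theorem up_leg_mem_extHalfLines {G : FeynmanGraph n' N} {H : FeynmanGraph k 4}
    {Γ : FeynmanGraph n N} {h : Γ.Sub} (hH : H.verts Finset.univ = Finset.univ)
    (heq : (⟨glue S G H, upSub S G Finset.univ⟩ : Σ Γ : FeynmanGraph n N, Γ.Sub) = ⟨Γ, h⟩)
    (j : Fin 4) : S.up (H.leg j) ∈ Γ.extHalfLines h := by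
  cases heq
  refine (mem_extHalfLines _).2 ⟨(mem_verts_upSub_univ hH).2 ⟨_, rfl⟩, fun l hl => ?_⟩
  obtain ⟨l', -, rfl⟩ := mem_upSub.1 hl
  rw [up_mem_upLine]
  exact H.leg_notMem l'.1 l'.2 j

/-- A four-point subgraph with given vertices and a given numbering of its external half-lines is an
inserted one. -/
theorem exists_glue {Γ : FeynmanGraph n N} {h : Γ.Sub}
    (hv : ∀ v, v ∈ Γ.verts h ↔ ∃ b, S.inner b = v) (β : Fin 4 → HalfLine n)
    (hβ : Function.Injective β) (hβr : ∀ e, e ∈ Γ.extHalfLines h ↔ ∃ j, β j = e) :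
    ∃ (G : FeynmanGraph n' N) (H : FeynmanGraph k 4), H.verts Finset.univ = Finset.univ ∧
      (⟨glue S G H, upSub S G Finset.univ⟩ : Σ Γ : FeynmanGraph n N, Γ.Sub) = ⟨Γ, h⟩ ∧
      ∀ j, S.up (H.leg j) = β j := by
  classical
  have hup : ∀ e : HalfLine n, e.1 ∈ Γ.verts h → ∃ c, S.up c = e := by
    intro e he
    obtain ⟨b, hb⟩ := (hv _).1 he
    exact ⟨(b, e.2), Prod.ext hb rfl⟩
  have hb : ∀ j, ∃ c, S.up c = β j := fun j =>
    hup _ ((mem_extHalfLines _).1 ((hβr _).2 ⟨j, rfl⟩)).1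
  choose b hb using hb
  have hbinj : Function.Injective b := fun i j hij => hβ (by rw [← hb, ← hb, hij])
  have hext : ∀ j, ∀ l ∈ h, β j ∉ l.1 := fun j =>
    ((mem_extHalfLines _).1 ((hβr _).2 ⟨j, rfl⟩)).2
  have hdn : ∀ e : HalfLine n, (∀ l ∈ h, e ∉ l.1) → ∃ c, S.dn b c = e := by
    intro e he
    rcases exists_up_or_dn (S := S) e with ⟨c, rfl⟩ | ⟨c, hc, rfl⟩
    · obtain ⟨j, hj⟩ := (hβr _).1 ((mem_extHalfLines _).2 ⟨(hv _).2 ⟨_, rfl⟩, he⟩)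
      exact ⟨(S.w, j), by rw [dn_w, hb, hj]⟩
    · exact ⟨c, dn_of_ne hc⟩
  have hdn' : ∀ c, ∀ l ∈ h, S.dn b c ∉ l.1 := by
    intro c l hl hmem
    by_cases hc : c.1 = S.w
    · rw [show S.dn b c = S.up (b c.2) from if_pos hc, hb] at hmem
      exact hext _ l hl hmem
    · rw [dn_of_ne hc] at hmem
      obtain ⟨d, hd⟩ := (hv _).1 (Γ.mem_verts_of_mem hl hmem)
      exact S.outer_ne_inner _ _ hc hd.symm
  have hh : ∀ l ∈ h, ∃ z : Sym2 (HalfLine k), z.map S.up = l.1 := fun l hl =>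
    Sym2.exists_map_eq fun e he => hup e (Γ.mem_verts_of_mem hl he)
  have hout : ∀ l ∈ Γ.lines \ h.image Subtype.val, ∃ z : Sym2 (HalfLine n'),
      z.map (S.dn b) = l := by
    intro l hl
    rw [Finset.mem_sdiff] at hl
    refine Sym2.exists_map_eq fun e he => hdn e fun l' hl' he' => hl.2 ?_
    rw [Γ.lines_disjoint l hl.1 l'.1 l'.2 e he he']
    exact Finset.mem_image_of_mem _ hl'
  have hsub : h.image Subtype.val ⊆ Γ.lines := by
    intro z hz
    obtain ⟨l, -, rfl⟩ := Finset.mem_image.1 hz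
    exact l.2
  choose c hc using fun j => hdn (Γ.leg j) fun l _ => Γ.leg_notMem l.1 l.2 j
  -- `H` and `G` are the pullbacks of the marked lines along `S.up` and of the other lines along
  -- `S.dn b`. The numbering `β` labels the cut half-lines both as legs of `H` and as half-lines of
  -- `w`.
  let H : FeynmanGraph k 4 :=
    { lines := Finset.univ.filter fun z => z.map S.up ∈ h.image Subtype.val
      leg := b
      leg_injective := hbinj
      not_isDiag := fun z hz hd => by
        refine Γ.not_isDiag _ (hsub (Finset.mem_filter.1 hz).2) ?_
        induction z with
        | _ x y => simpa using congrArg S.up hd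
      lines_disjoint := fun z hz z' hz' e he he' =>
        Sym2.map.injective S.up_injective (Γ.lines_disjoint _ (hsub (Finset.mem_filter.1 hz).2) _
          (hsub (Finset.mem_filter.1 hz').2) (S.up e) (Sym2.mem_map.2 ⟨e, he, rfl⟩)
          (Sym2.mem_map.2 ⟨e, he', rfl⟩))
      leg_notMem := fun z hz j hj => by
        obtain ⟨l, hl, hlz⟩ := Finset.mem_image.1 (Finset.mem_filter.1 hz).2
        refine hext j l hl ?_
        rw [hlz, ← hb]
        exact Sym2.mem_map.2 ⟨_, hj, rfl⟩
      covered := fun e => by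
        by_cases hex : ∃ l ∈ h, S.up e ∈ l.1
        · obtain ⟨l, hl, hel⟩ := hex
          obtain ⟨z, hz⟩ := hh l hl
          refine Or.inl ⟨z, Finset.mem_filter.2 ⟨Finset.mem_univ _,
            hz ▸ Finset.mem_image_of_mem _ hl⟩, ?_⟩
          rw [← hz] at hel
          obtain ⟨e', he', h⟩ := Sym2.mem_map.1 hel
          rwa [← S.up_injective h]
        · push Not at hex
          obtain ⟨j, hj⟩ := (hβr _).1 ((mem_extHalfLines _).2 ⟨(hv _).2 ⟨e.1, rfl⟩, hex⟩)
          exact Or.inr ⟨j, S.up_injective ((hb j).trans hj)⟩ }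
  let G : FeynmanGraph n' N :=
    { lines := Finset.univ.filter fun z => z.map (S.dn b) ∈ Γ.lines \ h.image Subtype.val
      leg := c
      leg_injective := fun i j hij => Γ.leg_injective (by rw [← hc, ← hc, hij])
      not_isDiag := fun z hz hd => by
        refine Γ.not_isDiag _ (Finset.mem_sdiff.1 (Finset.mem_filter.1 hz).2).1 ?_
        induction z with
        | _ x y => simpa using congrArg (S.dn b) hd
      lines_disjoint := fun z hz z' hz' e he he' =>
        Sym2.map.injective (dn_injective hbinj)
          (Γ.lines_disjoint _ (Finset.mem_sdiff.1 (Finset.mem_filter.1 hz).2).1 _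
          (Finset.mem_sdiff.1 (Finset.mem_filter.1 hz').2).1 (S.dn b e)
          (Sym2.mem_map.2 ⟨e, he, rfl⟩) (Sym2.mem_map.2 ⟨e, he', rfl⟩))
      leg_notMem := fun z hz j hj => by
        refine Γ.leg_notMem _ (Finset.mem_sdiff.1 (Finset.mem_filter.1 hz).2).1 j ?_
        rw [← hc]
        exact Sym2.mem_map.2 ⟨_, hj, rfl⟩
      covered := fun e => by
        rcases Γ.covered (S.dn b e) with ⟨l, hl, hel⟩ | ⟨j, hj⟩
        · have hl' : l ∈ Γ.lines \ h.image Subtype.val := by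
            refine Finset.mem_sdiff.2 ⟨hl, fun hlh => ?_⟩
            obtain ⟨l', hl', rfl⟩ := Finset.mem_image.1 hlh
            exact hdn' e l' hl' hel
          obtain ⟨z, rfl⟩ := hout l hl'
          refine Or.inl ⟨z, Finset.mem_filter.2 ⟨Finset.mem_univ _, hl'⟩, ?_⟩
          obtain ⟨e', he', h⟩ := Sym2.mem_map.1 hel
          rwa [← dn_injective hbinj h]
        · exact Or.inr ⟨j, dn_injective (S := S) hbinj ((hc j).trans hj)⟩ }
  refine ⟨G, H, ?_, (sigma_glue_eq_iff S).2 ⟨?_, ?_, hc⟩, hb⟩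
  · ext v
    simp only [Finset.mem_univ, iff_true]
    obtain ⟨l, hl, j, hj⟩ := Γ.mem_verts.1 ((hv _).2 ⟨v, rfl⟩)
    obtain ⟨z, hz⟩ := hh l hl
    refine H.mem_verts.2 ⟨⟨z, Finset.mem_filter.2 ⟨Finset.mem_univ _,
      hz ▸ Finset.mem_image_of_mem _ hl⟩⟩, Finset.mem_univ _, j, ?_⟩
    rw [← hz] at hj
    obtain ⟨e', he', h⟩ := Sym2.mem_map.1 hj
    have : e' = (v, j) := S.up_injective h
    rwa [← this]
  · ext l
    constructor
    · intro hl
      obtain ⟨z, hz, rfl⟩ := Finset.mem_image.1 hl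
      exact (Finset.mem_filter.1 hz).2
    · intro hl
      obtain ⟨l', hl', rfl⟩ := Finset.mem_image.1 hl
      obtain ⟨z, hz⟩ := hh l' hl'
      exact Finset.mem_image.2 ⟨z, Finset.mem_filter.2 ⟨Finset.mem_univ _, hz ▸ hl⟩, hz⟩
  · ext l
    constructor
    · intro hl
      obtain ⟨z, hz, rfl⟩ := Finset.mem_image.1 hl
      exact (Finset.mem_filter.1 hz).2
    · intro hl
      obtain ⟨z, hz⟩ := hout l hl
      exact Finset.mem_image.2 ⟨z, Finset.mem_filter.2 ⟨Finset.mem_univ _, hz ▸ hl⟩, hz⟩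

open Classical in
/-- There are `4!` ways of obtaining a given four-point subgraph by insertion. -/
theorem card_glue_fiber {Γ : FeynmanGraph n N} {h : Γ.Sub}
    (hv : ∀ v, v ∈ Γ.verts h ↔ ∃ b, S.inner b = v) (h4 : Γ.numLegs h = 4) :
    (Finset.univ.filter fun x : FeynmanGraph n' N × FeynmanGraph k 4 =>
      x.2.verts Finset.univ = Finset.univ ∧
      (⟨glue S x.1 x.2, upSub S x.1 Finset.univ⟩ : Σ Γ : FeynmanGraph n N, Γ.Sub) =
        ⟨Γ, h⟩).card = Nat.factorial 4 := by
  rw [numLegs_eq_card] at h4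
  have hcard : (Finset.univ : Finset (Fin 4 ↪ Γ.extHalfLines h)).card = Nat.factorial 4 := by
    rw [Finset.card_univ, Fintype.card_embedding_eq, Fintype.card_fin, Fintype.card_coe, h4]
    rfl
  rw [← hcard]
  refine Finset.card_bij (fun x hx => ⟨fun j => ⟨S.up (x.2.leg j),
    up_leg_mem_extHalfLines S (Finset.mem_filter.1 hx).2.1 (Finset.mem_filter.1 hx).2.2 j⟩,
    fun i j hij => x.2.leg_injective (S.up_injective (congrArg Subtype.val hij))⟩)
    (fun _ _ => Finset.mem_univ _) ?_ ?_
  · intro x hx y hy hxy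
    obtain ⟨h1, h2⟩ := eq_of_sigma_glue_eq S ((Finset.mem_filter.1 hx).2.2.trans
      (Finset.mem_filter.1 hy).2.2.symm) fun j =>
        congrArg Subtype.val (DFunLike.congr_fun hxy j)
    exact Prod.ext h1 h2
  · intro β _
    -- There are exactly four external half-lines, so an injective numbering is a bijection.
    have hsurj : Function.Surjective β :=
      ((Fintype.bijective_iff_injective_and_card β).2 ⟨β.injective, by
        rw [Fintype.card_fin, Fintype.card_coe, h4]⟩).2
    obtain ⟨G, H, h1, h2, h3⟩ := exists_glue S hv (fun j => (β j).1)
      (Subtype.val_injective.comp β.injective) fun e =>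
        ⟨fun he => let ⟨j, hj⟩ := hsurj ⟨e, he⟩; ⟨j, congrArg Subtype.val hj⟩,
          fun ⟨j, hj⟩ => hj ▸ (β j).2⟩
    exact ⟨(G, H), Finset.mem_filter.2 ⟨Finset.mem_univ _, h1, h2⟩,
      DFunLike.ext _ _ fun j => Subtype.ext (h3 j)⟩

open Classical in
theorem sum_glue {A : Type*} [AddCommMonoid A] (φ : (Σ Γ : FeynmanGraph n N, Γ.Sub) → A) :
    ∑ x : FeynmanGraph n' N × FeynmanGraph k 4 with x.2.verts Finset.univ = Finset.univ,
      φ ⟨glue S x.1 x.2, upSub S x.1 Finset.univ⟩ =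
    Nat.factorial 4 • ∑ p : (Σ Γ : FeynmanGraph n N, Γ.Sub) with
      p.1.verts p.2 = Finset.univ.image S.inner ∧ p.1.numLegs p.2 = 4, φ p := by
  rw [← Finset.sum_fiberwise_of_maps_to (t := Finset.univ.filter
    fun p : (Σ Γ : FeynmanGraph n N, Γ.Sub) =>
      p.1.verts p.2 = Finset.univ.image S.inner ∧ p.1.numLegs p.2 = 4)
    (g := fun x : FeynmanGraph n' N × FeynmanGraph k 4 =>
      (⟨glue S x.1 x.2, upSub S x.1 Finset.univ⟩ : Σ Γ : FeynmanGraph n N, Γ.Sub)),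
    Finset.smul_sum]
  · refine Finset.sum_congr rfl fun p hp => ?_
    obtain ⟨Γ, h⟩ := p
    rw [Finset.mem_filter] at hp
    rw [Finset.sum_congr rfl (g := fun _ => φ ⟨Γ, h⟩) fun x hx => by
      rw [(Finset.mem_filter.1 hx).2], Finset.sum_const, Finset.filter_filter,
      card_glue_fiber S (fun v => by rw [hp.2.1]; simp) hp.2.2]
  · rintro ⟨G, H⟩ hx
    have hH := (Finset.mem_filter.1 hx).2
    refine Finset.mem_filter.2 ⟨Finset.mem_univ _, ?_, ?_⟩
    · ext v
      rw [mem_verts_upSub_univ hH]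
      simp
    · exact (subIso_upSub _).numLegs_eq.trans (numLegs_univ hH)

end FeynmanGraph

/-! ### Splittings with a prescribed set of inner vertices -/

namespace Splitting

variable {n n' k : ℕ}

theorem prod_eq {A : Type*} [CommMonoid A] (S : Splitting n n' k) (g : Fin n → A) :
    ∏ v, g v = (∏ b, g (S.inner b)) * ∏ a ∈ Finset.univ.erase S.w, g (S.outer a) := by
  let E : Fin k ⊕ {a : Fin n' // a ≠ S.w} ≃ Fin n :=
    Equiv.ofBijective (Sum.elim S.inner fun a => S.outer a)
      ⟨S.inner_strictMono.injective.sumElim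
        (fun a b hab => Subtype.ext (S.outer_injective a.2 b.2 hab))
        fun b a h => S.outer_ne_inner a b a.2 h.symm, fun v => by
        rcases S.cover v with ⟨b, rfl⟩ | ⟨a, ha, rfl⟩
        · exact ⟨Sum.inl b, rfl⟩
        · exact ⟨Sum.inr ⟨a, ha⟩, rfl⟩⟩
  rw [← E.prod_comp, Fintype.prod_sum_type]
  congr 1
  exact (Finset.prod_subtype (Finset.univ.erase S.w) (by simp) fun a => g (S.outer a)).symm

theorem exists_of_card {m : ℕ} (hk : 0 < k) (U : Finset (Fin (m + k))) (hU : U.card = k)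
    (w : Fin (m + 1)) : ∃ S : Splitting (m + k) (m + 1) k,
      S.w = w ∧ Finset.univ.image S.inner = U := by
  classical
  have hUc : Uᶜ.card = m := by
    rw [Finset.card_compl, hU, Fintype.card_fin]; omega
  let inner := U.orderEmbOfFin hU
  let out := Uᶜ.orderEmbOfFin hUc
  -- The value at `w` is arbitrary, and this is where `0 < k` is used; no axiom of `Splitting`
  -- constrains it.
  let outer : Fin (m + 1) → Fin (m + k) := w.insertNth (α := fun _ => Fin (m + k)) (inner ⟨0, hk⟩) out
  have hout : ∀ j, outer (w.succAbove j) = out j := fun j => by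
    simp only [outer, Fin.insertNth_apply_succAbove]
  have hin : Set.range inner = U := Finset.range_orderEmbOfFin U hU
  have houtr : Set.range out = ↑(Uᶜ) := Finset.range_orderEmbOfFin _ hUc
  refine ⟨⟨inner, outer, w, inner.strictMono, ?_, ?_, ?_⟩, rfl, ?_⟩
  · intro a b ha hb hab
    obtain ⟨i, rfl⟩ := Fin.exists_succAbove_eq ha
    obtain ⟨j, rfl⟩ := Fin.exists_succAbove_eq hb
    rw [hout, hout]
    exact out.strictMono ((Fin.succAbove_lt_succAbove_iff).1 hab)
  · intro a b ha
    obtain ⟨i, rfl⟩ := Fin.exists_succAbove_eq ha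
    rw [hout]
    intro h
    have h1 : out i ∈ (↑(Uᶜ) : Set (Fin (m + k))) := houtr ▸ Set.mem_range_self i
    have h2 : inner b ∈ (U : Set (Fin (m + k))) := hin ▸ Set.mem_range_self b
    rw [h] at h1
    simp only [Finset.coe_compl, Set.mem_compl_iff] at h1
    exact h1 h2
  · intro v
    by_cases hv : v ∈ U
    · have : v ∈ Set.range inner := hin ▸ hv
      exact Or.inl this
    · have : v ∈ Set.range out := by rw [houtr]; simpa using hv
      obtain ⟨j, rfl⟩ := this
      exact Or.inr ⟨w.succAbove j, Fin.succAbove_ne w j, hout j⟩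
  · rw [← Finset.coe_inj, Finset.coe_image, Finset.coe_univ, Set.image_univ]
    exact hin

end Splitting

/-! ### Forests with a marked element -/

namespace FeynmanGraph

open Splitting

variable {n N ρ : ℕ}

/-- The lowest scale of the lines of a subgraph. -/
noncomputable def lowest {G : FeynmanGraph n N} (μ : G.Scales ρ) (f : G.Sub) : ℤ :=
  if h : f.Nonempty then f.inf' h fun l => ((μ l : ℕ) : ℤ) else 0

theorem le_lowest_iff {G : FeynmanGraph n N} {μ : G.Scales ρ} {f : G.Sub} (hf : f.Nonempty)
    {c : ℤ} : c ≤ lowest μ f ↔ ∀ l ∈ f, c ≤ ((μ l : ℕ) : ℤ) := by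
  rw [lowest, dif_pos hf, Finset.le_inf'_iff]

theorem exists_eq_lowest {G : FeynmanGraph n N} {μ : G.Scales ρ} {f : G.Sub} (hf : f.Nonempty) :
    ∃ l ∈ f, ((μ l : ℕ) : ℤ) = lowest μ f := by
  obtain ⟨l, hl, h⟩ := Finset.exists_mem_eq_inf' hf fun l => ((μ l : ℕ) : ℤ)
  exact ⟨l, hl, by rw [lowest, dif_pos hf, h]⟩

theorem lowestScale_iff {G : FeynmanGraph n N} {μ : G.Scales ρ} {c : ℤ} :
    G.LowestScale μ c ↔ (Finset.univ : G.Sub).Nonempty ∧ lowest μ Finset.univ = c := by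
  constructor
  · rintro ⟨⟨l, hl⟩, h⟩
    have hne : (Finset.univ : G.Sub).Nonempty := ⟨l, Finset.mem_univ l⟩
    exact ⟨hne, le_antisymm (hl ▸ (le_lowest_iff hne).1 le_rfl l (Finset.mem_univ l))
      ((le_lowest_iff hne).2 fun l _ => h l)⟩
  · rintro ⟨hne, rfl⟩
    obtain ⟨l, -, hl⟩ := exists_eq_lowest (μ := μ) hne
    exact ⟨⟨l, hl⟩, fun l => (le_lowest_iff hne).1 le_rfl l (Finset.mem_univ l)⟩

section Glue

variable {n' k : ℕ} {S : Splitting n n' k} {G : FeynmanGraph n' N} {H : FeynmanGraph k 4}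
  {μH : H.Scales ρ} {μ : G.Scales ρ}

theorem upSub_nonempty {f : H.Sub} : (upSub S G f).Nonempty ↔ f.Nonempty := Finset.map_nonempty

theorem dnSub_nonempty {g : G.Sub} : (dnSub S H g).Nonempty ↔ g.Nonempty := Finset.map_nonempty

theorem lowest_upSub (f : H.Sub) : lowest (glueScales S μH μ) (upSub S G f) = lowest μH f := by
  by_cases hf : f.Nonempty
  · refine eq_of_forall_le_iff fun c => ?_
    rw [le_lowest_iff hf, le_lowest_iff (upSub_nonempty.2 hf)]
    refine ⟨fun h l hl => ?_, fun h l hl => ?_⟩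
    · have := h _ (upLine_mem_upSub.2 hl)
      rwa [glueScales_upLine] at this
    obtain ⟨l', hl', rfl⟩ := mem_upSub.1 hl
    rw [glueScales_upLine]
    exact h l' hl'
  · rw [lowest, lowest, dif_neg hf, dif_neg (mt upSub_nonempty.1 hf)]

theorem lowest_dnSub (g : G.Sub) : lowest (glueScales S μH μ) (dnSub S H g) = lowest μ g := by
  by_cases hf : g.Nonempty
  · refine eq_of_forall_le_iff fun c => ?_
    rw [le_lowest_iff hf, le_lowest_iff (dnSub_nonempty.2 hf)]
    refine ⟨fun h l hl => ?_, fun h l hl => ?_⟩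
    · have := h _ (dnLine_mem_dnSub.2 hl)
      rwa [glueScales_dnLine] at this
    obtain ⟨l', hl', rfl⟩ := mem_dnSub.1 hl
    rw [glueScales_dnLine]
    exact h l' hl'
  · rw [lowest, lowest, dif_neg hf, dif_neg (mt dnSub_nonempty.1 hf)]

/-- The inserted graph is dangerous, with lowest scale `c`, exactly when `c` is its lowest scale and
lies above the scales of the vertex where it is inserted. -/
theorem upSub_univ_mem_dangerous_iff (hH : H.verts Finset.univ = Finset.univ)
    (hconn : H.SubConnected Finset.univ) {c : ℤ} :
    (upSub S G Finset.univ ∈ (glue S G H).dangerous (glueScales S μH μ) ∧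
      lowest (glueScales S μH μ) (upSub S G Finset.univ) = c) ↔
    H.LowestScale μH c ∧ G.vertexScale μ S.w < c := by
  rw [mem_dangerous, quasiLocal_upSub_univ hH, (subIso_upSub _).numLegs_eq, numLegs_univ hH,
    lowest_upSub, lowestScale_iff]
  have hne := hconn.1
  constructor
  · rintro ⟨⟨⟨-, h⟩, -⟩, rfl⟩
    obtain ⟨l, -, hl⟩ := exists_eq_lowest (μ := μH) hne
    -- The line of `H` that attains the lowest scale is compared with the lines attached to `w`; its
    -- scale is nonnegative, hence also above the scale `-1` of external legs.
    refine ⟨⟨hne, rfl⟩, Int.lt_of_le_sub_one (vertexScale_le_iff.2 ⟨by omega, fun l' hl' => ?_⟩)⟩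
    have h1 : (μ l' : ℕ) < (μH l : ℕ) := h l l' hl'
    omega
  · rintro ⟨⟨-, rfl⟩, h⟩
    refine ⟨⟨⟨hconn, fun l l' hl' => ?_⟩, rfl⟩, rfl⟩
    have h1 := (vertexScale_le_iff.1 (le_refl (G.vertexScale μ S.w))).2 l' hl'
    have h2 := (le_lowest_iff hne).1 (le_refl (lowest μH Finset.univ)) l (Finset.mem_univ l)
    have h3 : (μ l' : ℕ) < (μH l : ℕ) := by omega
    exact h3

variable {A : Type*} [CommRing A] (M m : ℝ) (s κ : ℤ → A)

/-- The product of the weights of the elements of the forest `F` and of the vertices in `V`. -/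
noncomputable def forestWeight {n N : ℕ} {G : FeynmanGraph n N} (μ : G.Scales ρ)
    (F : Finset G.Sub) (V : Finset (Fin n)) : A :=
  (∏ f ∈ F, s (lowest μ f)) * ∏ v ∈ V, κ (G.vertexScale μ v)

theorem upSub_ne_dnSub {f : H.Sub} {g : G.Sub} (hf : f.Nonempty) : upSub S G f ≠ dnSub S H g := by
  obtain ⟨l, hl⟩ := hf
  exact fun h => upLine_notMem_dnSub (h ▸ upLine_mem_upSub.2 hl)

-- The marked element carries no factor, hence the `erase`. The vertex `w` carries none either: the
-- vertices of `H` replace it.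
open Classical in
theorem forestWeight_glue {FH : Finset H.Sub} {FG : Finset G.Sub}
    (hH : H.verts Finset.univ = Finset.univ) (hlt : ∀ l l', G.Attached l' S.w → μ l' < μH l)
    (hFH : Finset.univ ∉ FH) (hne : (Finset.univ : H.Sub).Nonempty)
    (hFHne : ∀ f ∈ FH, f.Nonempty) :
    forestWeight s κ (glueScales S μH μ) ((glueForest S FH FG).erase (upSub S G Finset.univ))
      Finset.univ = forestWeight s κ μH FH Finset.univ *
        forestWeight s κ μ FG (Finset.univ.erase S.w) := by
  have herase : (glueForest S FH FG).erase (upSub S G Finset.univ) =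
      FH.image (upSub S G) ∪ FG.image (dnSub S H) := by
    refine Finset.erase_insert ?_
    rw [Finset.mem_union, Finset.mem_image, Finset.mem_image]
    rintro (⟨f, hf, h⟩ | ⟨g, -, h⟩)
    · exact hFH (upSub_injective h ▸ hf)
    · exact upSub_ne_dnSub hne h.symm
  have hdisj : Disjoint (FH.image (upSub S G)) (FG.image (dnSub S H)) := by
    rw [Finset.disjoint_left]
    intro f hf hg
    obtain ⟨f, hf', rfl⟩ := Finset.mem_image.1 hf
    obtain ⟨g, -, hg⟩ := Finset.mem_image.1 hg
    exact upSub_ne_dnSub (hFHne f hf') hg.symm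
  unfold forestWeight
  rw [herase, Finset.prod_union hdisj, Finset.prod_image upSub_injective.injOn,
    Finset.prod_image dnSub_injective.injOn, S.prod_eq]
  simp only [lowest_upSub, lowest_dnSub, vertexScale_glue_inner hlt hH]
  rw [Finset.prod_congr (rfl : Finset.univ.erase S.w = _) fun a ha => by
    rw [vertexScale_glue_outer (Finset.ne_of_mem_erase ha)]]
  ring

variable [Algebra ℝ A]

/-- The terms of a forest of which the element `h` is marked. -/
noncomputable def markedTerm {n N : ℕ} (G : FeynmanGraph n N) (μ : G.Scales ρ)
    (a : (Fin N → Space) → ℝ) (h : G.Sub) (F : Finset G.Sub) : A :=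
  open Classical in
  G.amplitude M m μ F a • forestWeight s κ μ (F.erase h) Finset.univ

theorem notMem_verts_of_vertexScale_lt {c : ℤ} {v : Fin n'} (hv : G.vertexScale μ v < c)
    {g : G.Sub} (hg : g.Nonempty) (hc : c ≤ lowest μ g) : v ∉ G.verts g := by
  intro h
  obtain ⟨l, hl, hlv⟩ := mem_verts_iff_attached.1 h
  have h1 := (le_lowest_iff hg).1 hc l hl
  have h2 := (vertexScale_le_iff.1 (le_refl (G.vertexScale μ v))).2 l hlv
  omega

theorem nonempty_of_mem_dangerous {n N : ℕ} {G : FeynmanGraph n N} {μ : G.Scales ρ} {f : G.Sub}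
    (hf : f ∈ G.dangerous μ) : f.Nonempty := (G.mem_dangerous.1 hf).1.1.1

variable {M m s}

open Classical in
/-- Forests of which the inserted subgraph is an element. -/
theorem sum_markedTerm_glue (hM : 1 < M) (hm : 0 < m) {c : ℤ} (hs : ∀ j < c, s j = 0)
    (a : 𝓢(Fin N → Space, ℝ)) (hgl : glue S G H ∈ graphs n N)
    (hH : H.verts Finset.univ = Finset.univ) (hconn : H.SubConnected Finset.univ)
    (hlow : H.LowestScale μH c) (hw : G.vertexScale μ S.w < c) :
    ∑ F ∈ ((glue S G H).dangerous (glueScales S μH μ)).powerset with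
        upSub S G Finset.univ ∈ F,
      markedTerm M m s κ (glue S G H) (glueScales S μH μ) a (upSub S G Finset.univ) F =
    (∑ F ∈ ((H.dangerous μH).erase Finset.univ).powerset,
      H.localPart M m μH F • forestWeight s κ μH F Finset.univ) *
    ∑ F ∈ (G.dangerous μ).powerset,
      G.amplitude M m μ F a • forestWeight s κ μ F (Finset.univ.erase S.w) := by
  obtain ⟨hD, hlowG⟩ := (upSub_univ_mem_dangerous_iff (S := S) (G := G) (μ := μ) hH hconn).2
    ⟨hlow, hw⟩
  have hlt := ((quasiLocal_upSub_univ hH).1 ((mem_dangerous _).1 hD).1).2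
  have hne := hconn.1
  have key : ∀ FH ⊆ (H.dangerous μH).erase Finset.univ, ∀ FG ⊆ G.dangerous μ,
      (∀ g ∈ FG, S.w ∉ G.verts g) →
      glueForest S FH FG ⊆ (glue S G H).dangerous (glueScales S μH μ) ∧
      (H.localPart M m μH FH • forestWeight s κ μH FH Finset.univ) *
        (G.amplitude M m μ FG a • forestWeight s κ μ FG (Finset.univ.erase S.w)) =
      markedTerm M m s κ (glue S G H) (glueScales S μH μ) a (upSub S G Finset.univ)
        (glueForest S FH FG) := by
    intro FH hFH FG hFG hFGw
    have hsub : glueForest S FH FG ⊆ (glue S G H).dangerous (glueScales S μH μ) := by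
      intro f hf
      rcases mem_glueForest.1 hf with rfl | ⟨f, hf', rfl⟩ | ⟨g, hg, rfl⟩
      · exact hD
      · exact (upSub_mem_dangerous hlt).2 (Finset.mem_of_mem_erase (hFH hf'))
      · exact (dnSub_mem_dangerous (hFGw g hg)).2 (hFG hg)
    refine ⟨hsub, ?_⟩
    rw [markedTerm, amplitude_glue hM hm hgl hsub hH hFGw, smul_mul_smul_comm]
    congr 1
    convert (forestWeight_glue (S := S) (μ := μ) (FG := FG) s κ hH hlt
      (fun h => Finset.notMem_erase _ _ (hFH h)) hne
      fun f hf => nonempty_of_mem_dangerous (Finset.mem_of_mem_erase (hFH hf))).symm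
  -- An element through `w` contains a line of scale below `c`, so its weight is zero.
  have hzero : ∀ FG ⊆ G.dangerous μ, forestWeight s κ μ FG (Finset.univ.erase S.w) ≠ 0 →
      ∀ g ∈ FG, S.w ∉ G.verts g := by
    intro FG hFG h0 g hg
    refine notMem_verts_of_vertexScale_lt hw (nonempty_of_mem_dangerous (hFG hg)) ?_
    by_contra! hcon
    refine h0 ?_
    rw [forestWeight, Finset.prod_eq_zero hg (hs _ hcon), zero_mul]
  rw [Finset.sum_mul_sum, ← Finset.sum_product']
  symm
  -- The correspondence of forests holds only for nonzero terms: on both sides there are forests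
  -- with elements of lowest scale below `c`, which `hs` removes.
  refine Finset.sum_bij_ne_zero (fun x _ _ => glueForest S x.1 x.2) ?_ ?_ ?_ ?_
  · rintro ⟨FH, FG⟩ hx h0
    rw [Finset.mem_product, Finset.mem_powerset, Finset.mem_powerset] at hx
    have := hzero FG hx.2 fun h => h0 (by simp only; rw [h, smul_zero, mul_zero])
    exact Finset.mem_filter.2 ⟨Finset.mem_powerset.2 (key FH hx.1 FG hx.2 this).1,
      mem_glueForest.2 (Or.inl rfl)⟩
  · rintro ⟨FH, FG⟩ hx - ⟨FH', FG'⟩ hx' - heq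
    rw [Finset.mem_product, Finset.mem_powerset, Finset.mem_powerset] at hx hx'
    simp only at heq hx hx'
    have aux : ∀ FH ⊆ (H.dangerous μH).erase Finset.univ, ∀ FG ⊆ G.dangerous μ,
        (∀ f ∈ (H.dangerous μH).erase Finset.univ, f ∈ FH ↔ upSub S G f ∈ glueForest S FH FG) ∧
        ∀ g ∈ G.dangerous μ, g ∈ FG ↔ dnSub S H g ∈ glueForest S FH FG := by
      intro FH hFH FG hFG
      refine ⟨fun f hf => ?_, fun g hg => ?_⟩
      · rw [mem_glueForest]
        refine ⟨fun h => Or.inr (Or.inl ⟨f, h, rfl⟩), ?_⟩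
        rintro (h | ⟨f', hf', h⟩ | ⟨g, -, h⟩)
        · exact absurd (upSub_injective h) (Finset.ne_of_mem_erase hf)
        · exact upSub_injective h ▸ hf'
        · exact absurd h.symm (upSub_ne_dnSub
            (nonempty_of_mem_dangerous (Finset.mem_of_mem_erase hf)))
      · rw [mem_glueForest]
        refine ⟨fun h => Or.inr (Or.inr ⟨g, h, rfl⟩), ?_⟩
        rintro (h | ⟨f', hf', h⟩ | ⟨g', hg', h⟩)
        · exact absurd h.symm (upSub_ne_dnSub hne)
        · exact absurd h (upSub_ne_dnSub
            (nonempty_of_mem_dangerous (Finset.mem_of_mem_erase (hFH hf'))))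
        · exact dnSub_injective h ▸ hg'
    obtain ⟨h1, h2⟩ := aux FH hx.1 FG hx.2
    obtain ⟨h1', h2'⟩ := aux FH' hx'.1 FG' hx'.2
    refine Prod.ext (Finset.ext fun f => ?_) (Finset.ext fun g => ?_)
    · exact ⟨fun hf => (h1' f (hx.1 hf)).2 (heq ▸ (h1 f (hx.1 hf)).1 hf),
        fun hf => (h1 f (hx'.1 hf)).2 (heq ▸ (h1' f (hx'.1 hf)).1 hf)⟩
    · exact ⟨fun hf => (h2' g (hx.2 hf)).2 (heq ▸ (h2 g (hx.2 hf)).1 hf),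
        fun hf => (h2 g (hx'.2 hf)).2 (heq ▸ (h2' g (hx'.2 hf)).1 hf)⟩
  · intro F hF h0
    rw [Finset.mem_filter, Finset.mem_powerset] at hF
    obtain ⟨hF, hFh⟩ := hF
    have hlowF : ∀ f ∈ F, c ≤ lowest (glueScales S μH μ) f := by
      intro f hf
      by_cases hfu : f = upSub S G Finset.univ
      · rw [hfu, hlowG]
      · by_contra! hcon
        refine h0 ?_
        rw [markedTerm, forestWeight, Finset.prod_eq_zero (Finset.mem_erase.2 ⟨hfu, hf⟩)
          (hs _ hcon), zero_mul, smul_zero]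
    set FH := ((H.dangerous μH).erase Finset.univ).filter fun f => upSub S G f ∈ F with hFHdef
    set FG := (G.dangerous μ).filter fun g => S.w ∉ G.verts g ∧ dnSub S H g ∈ F with hFGdef
    have hFH : FH ⊆ (H.dangerous μH).erase Finset.univ := Finset.filter_subset _ _
    have hFG : FG ⊆ G.dangerous μ := Finset.filter_subset _ _
    have hFGw : ∀ g ∈ FG, S.w ∉ G.verts g := fun g hg => (Finset.mem_filter.1 hg).2.1
    have heq : glueForest S FH FG = F := by
      ext f
      rw [mem_glueForest]
      constructor
      · rintro (rfl | ⟨f, hf, rfl⟩ | ⟨g, hg, rfl⟩)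
        · exact hFh
        · exact (Finset.mem_filter.1 hf).2
        · exact (Finset.mem_filter.1 hg).2.2
      · intro hf
        by_cases hfu : f = upSub S G Finset.univ
        · exact Or.inl hfu
        · have hfD := hF hf
          have hfne := nonempty_of_mem_dangerous hfD
          -- All lines of `f` have scale at least `c` and those of `G` at `w` are lower, so `f`
          -- cannot cross the boundary of the inserted subgraph.
          rcases quasiLocal_cases hH (fun l hl => lt_of_le_of_lt
              ((vertexScale_le_iff.1 (le_refl (G.vertexScale μ S.w))).2 l hl) hw)
              ((mem_dangerous _).1 hfD).1.1 ((le_lowest_iff hfne).1 (hlowF f hf)) with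
              ⟨f', rfl⟩ | ⟨g, hg, rfl⟩
          · refine Or.inr (Or.inl ⟨f', Finset.mem_filter.2 ⟨Finset.mem_erase.2
              ⟨fun h => hfu (h ▸ rfl), (upSub_mem_dangerous hlt).1 hfD⟩, hf⟩, rfl⟩)
          · exact Or.inr (Or.inr ⟨g, Finset.mem_filter.2
              ⟨(dnSub_mem_dangerous hg).1 hfD, hg, hf⟩, rfl⟩)
    refine ⟨(FH, FG), Finset.mem_product.2 ⟨Finset.mem_powerset.2 hFH,
      Finset.mem_powerset.2 hFG⟩, ?_, heq⟩
    simp only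
    rw [(key FH hFH FG hFG hFGw).2, heq]
    exact h0
  · rintro ⟨FH, FG⟩ hx h0
    rw [Finset.mem_product, Finset.mem_powerset, Finset.mem_powerset] at hx
    have := hzero FG hx.2 fun h => h0 (by simp only; rw [h, smul_zero, mul_zero])
    exact (key FH hx.1 FG hx.2 this).2

end Glue

end FeynmanGraph

/-! ### The insertion identity -/

namespace FeynmanGraph

open Splitting

variable {A : Type*} [CommRing A] [Algebra ℝ A] (M m : ℝ) (s κ : ℤ → A) (c : ℤ)

open Classical in
/-- The contributions of `G`, without the factor of the vertex `w`, whose lines lie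
below `c`. -/
noncomputable def contractedSum (ρ : ℕ) {n N : ℕ} (a : (Fin N → Space) → ℝ)
    (G : FeynmanGraph n N) (w : Fin n) : A :=
  ∑ μ : G.Scales ρ with G.vertexScale μ w < c, ∑ F ∈ (G.dangerous μ).powerset,
    G.amplitude M m μ F a • forestWeight s κ μ F (Finset.univ.erase w)

open Classical in
/-- The local contributions of `H`, with lowest scale `c`. -/
noncomputable def flowSum (ρ : ℕ) {k : ℕ} (H : FeynmanGraph k 4) : A :=
  ∑ μ : H.Scales ρ with H.LowestScale μ c,
    ∑ F ∈ ((H.dangerous μ).erase Finset.univ).powerset,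
      H.localPart M m μ F • forestWeight s κ μ F Finset.univ

open Classical in
/-- The contributions of the forests of `Γ` in which `h`, with lowest scale `c`, is marked. -/
noncomputable def markedSum (ρ : ℕ) {n N : ℕ} (a : (Fin N → Space) → ℝ)
    (Γ : FeynmanGraph n N) (h : Γ.Sub) : A :=
  ∑ μ : Γ.Scales ρ with h ∈ Γ.dangerous μ ∧ lowest μ h = c,
    ∑ F ∈ (Γ.dangerous μ).powerset with h ∈ F, markedTerm M m s κ Γ μ a h F

/-- The scales of the lines of `G` with `H` inserted. -/
noncomputable def scalesEquiv {n n' k N : ℕ} (ρ : ℕ) (S : Splitting n n' k)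
    (G : FeynmanGraph n' N) (H : FeynmanGraph k 4) :
    H.Scales ρ × G.Scales ρ ≃ (glue S G H).Scales ρ :=
  (Equiv.sumArrowEquivProdArrow _ _ _).symm.trans ((lineEquiv S G H).arrowCongr (Equiv.refl _))

theorem scalesEquiv_apply {n n' k N ρ : ℕ} {S : Splitting n n' k}
    {G : FeynmanGraph n' N} {H : FeynmanGraph k 4} (x : H.Scales ρ × G.Scales ρ) :
    scalesEquiv ρ S G H x = glueScales S x.1 x.2 := rfl

variable {M m s c}

theorem flowSum_eq_zero_of_isEmpty (ρ : ℕ) {k : ℕ} {H : FeynmanGraph k 4} (hH : IsEmpty H.Line) :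
    flowSum M m s κ c ρ H = 0 := by
  classical
  refine Finset.sum_eq_zero fun μ hμ => ?_
  obtain ⟨⟨l, -⟩, -⟩ := (Finset.mem_filter.1 hμ).2
  exact hH.elim l

-- The indicators of `graphs` allow sums over all pairs `(G, H)`, as in `sum_glue`. If `H` has no
-- line, both sides vanish, since the marked subgraph would be empty.
open Classical in
theorem markedSum_glue (ρ : ℕ) (hM : 1 < M) (hm : 0 < m) (hs : ∀ j < c, s j = 0) {n n' k N : ℕ}
    (S : Splitting n n' k) (a : 𝓢(Fin N → Space, ℝ)) (G : FeynmanGraph n' N)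
    (H : FeynmanGraph k 4) (hH : H.verts Finset.univ = Finset.univ) :
    (if glue S G H ∈ graphs n N then
      markedSum M m s κ c ρ a (glue S G H) (upSub S G Finset.univ) else 0) =
    (if H ∈ graphs k 4 then flowSum M m s κ c ρ H else 0) *
      (if G ∈ graphs n' N then contractedSum M m s κ c ρ a G S.w else 0) := by
  rcases isEmpty_or_nonempty H.Line with hE | ⟨⟨l⟩⟩
  · rw [flowSum_eq_zero_of_isEmpty κ ρ hE, ite_self, zero_mul]
    rw [ite_eq_right_iff]
    intro _
    refine Finset.sum_eq_zero fun μ hμ => ?_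
    obtain ⟨l, hl⟩ := nonempty_of_mem_dangerous (Finset.mem_filter.1 hμ).2.1
    obtain ⟨l', -, -⟩ := mem_upSub.1 hl
    exact hE.elim l'
  have hiff := glue_mem_graphs_iff (S := S) (G := G) hH l
  by_cases hboth : glue S G H ∈ graphs n N ∧
      (glue S G H).SubConnected (upSub S G Finset.univ)
  · have hconn := (subIso_upSub _).subConnected_iff.1 hboth.2
    rw [if_pos hboth.1, if_pos (hiff.1 hboth).1, if_pos (hiff.1 hboth).2]
    unfold markedSum flowSum contractedSum
    rw [Finset.sum_filter, ← (scalesEquiv ρ S G H).sum_comp, Fintype.sum_prod_type,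
      Finset.sum_mul_sum, Finset.sum_filter]
    refine Finset.sum_congr rfl fun μH _ => ?_
    rw [Finset.sum_filter]
    simp only [scalesEquiv_apply, upSub_univ_mem_dangerous_iff (S := S) (G := G) hH hconn]
    by_cases hlow : H.LowestScale μH c
    · rw [if_pos hlow]
      refine Finset.sum_congr rfl fun μ _ => ?_
      by_cases hw : G.vertexScale μ S.w < c
      · rw [if_pos ⟨hlow, hw⟩, if_pos hw]
        exact sum_markedTerm_glue κ hM hm hs a hboth.1 hH hconn hlow hw
      · rw [if_neg fun h => hw h.2, if_neg hw]
    · rw [if_neg hlow]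
      exact Finset.sum_eq_zero fun μ _ => if_neg fun h => hlow h.1
  · have h1 : (if glue S G H ∈ graphs n N then
        markedSum M m s κ c ρ a (glue S G H) (upSub S G Finset.univ) else 0) = 0 := by
      rw [ite_eq_right_iff]
      intro hgl
      refine Finset.sum_eq_zero fun μ hμ => ?_
      exact absurd ⟨hgl, ((mem_dangerous _).1 (Finset.mem_filter.1 hμ).2.1).1.1⟩ hboth
    rw [h1]
    by_cases hg : G ∈ graphs n' N
    · rw [if_neg (fun h => hboth (hiff.2 ⟨hg, h⟩)), zero_mul]
    · rw [if_neg hg, mul_zero]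

open Classical in
/-- The sum over the graphs with a given vertex set for the marked subgraph factorizes. -/
theorem sum_flowSum_mul_sum_contractedSum (ρ : ℕ) (hM : 1 < M) (hm : 0 < m)
    (hs : ∀ j < c, s j = 0) {n n' k N : ℕ} (S : Splitting n n' k) (a : 𝓢(Fin N → Space, ℝ)) :
    (∑ H ∈ graphs k 4, flowSum M m s κ c ρ H) *
      ∑ G ∈ graphs n' N, contractedSum M m s κ c ρ a G S.w =
    Nat.factorial 4 • ∑ Γ ∈ graphs n N, ∑ h : Γ.Sub with
      Γ.verts h = Finset.univ.image S.inner, markedSum M m s κ c ρ a Γ h := by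
  have h1 := sum_glue S (n' := n') (N := N) fun p : (Σ Γ : FeynmanGraph n N, Γ.Sub) =>
    if p.1 ∈ graphs n N then markedSum M m s κ c ρ a p.1 p.2 else 0
  have hR : ∑ p : (Σ Γ : FeynmanGraph n N, Γ.Sub) with
        p.1.verts p.2 = Finset.univ.image S.inner ∧ p.1.numLegs p.2 = 4,
      (if p.1 ∈ graphs n N then markedSum M m s κ c ρ a p.1 p.2 else 0) =
      ∑ Γ ∈ graphs n N, ∑ h : Γ.Sub with
        Γ.verts h = Finset.univ.image S.inner, markedSum M m s κ c ρ a Γ h := by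
    rw [Finset.sum_filter, Fintype.sum_sigma, ← Finset.univ_inter (graphs n N),
      ← Finset.sum_ite_mem]
    refine Finset.sum_congr rfl fun Γ _ => ?_
    rw [Finset.univ_inter]
    by_cases hΓ : Γ ∈ graphs n N
    · simp only [if_pos hΓ]
      rw [Finset.sum_filter]
      refine Finset.sum_congr rfl fun h _ => ?_
      by_cases hv : Γ.verts h = Finset.univ.image S.inner
      · by_cases hl : Γ.numLegs h = 4
        · rw [if_pos ⟨hv, hl⟩, if_pos hv]
        · rw [if_neg fun h => hl h.2, if_pos hv]
          symm
          refine Finset.sum_eq_zero fun μ hμ => ?_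
          exact absurd ((mem_dangerous _).1 (Finset.mem_filter.1 hμ).2.1).2 hl
      · rw [if_neg fun h => hv h.1, if_neg hv]
    · simp only [if_neg hΓ, ite_self, Finset.sum_const_zero]
  rw [← hR, ← h1]
  have hL : ∀ H ∈ (Finset.univ : Finset (FeynmanGraph k 4)),
      ¬ H.verts Finset.univ = Finset.univ →
      (if H ∈ graphs k 4 then flowSum M m s κ c ρ H else 0) = 0 := by
    intro H _ hH
    rw [ite_eq_right_iff]
    intro hHg
    rcases isEmpty_or_nonempty H.Line with hE | ⟨⟨l⟩⟩
    · exact flowSum_eq_zero_of_isEmpty κ ρ hE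
    · exact absurd (H.verts_univ_of_line (mem_graphs.1 hHg).1 l) hH
  symm
  rw [Finset.sum_congr rfl fun x hx => markedSum_glue κ ρ hM hm hs S a x.1 x.2
      (Finset.mem_filter.1 hx).2, Finset.sum_filter_of_ne fun x _ hne => by
      by_contra hx
      rw [hL x.2 (Finset.mem_univ _) hx, zero_mul] at hne
      exact hne rfl,
    Fintype.sum_prod_type_right, ← Finset.univ_inter (graphs k 4),
    ← Finset.univ_inter (graphs n' N), ← Finset.sum_ite_mem, ← Finset.sum_ite_mem,
    Finset.sum_mul_sum]
  simp only [Finset.univ_inter]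

-- Exchange of summations, which turns a sum over marked subgraphs into the form produced by the
-- Leibniz rule.
open Classical in
theorem sum_markedSum (ρ : ℕ) {n N : ℕ} (a : (Fin N → Space) → ℝ) (Γ : FeynmanGraph n N) :
    ∑ h : Γ.Sub, markedSum M m s κ c ρ a Γ h =
      ∑ μ : Γ.Scales ρ, ∑ F ∈ (Γ.dangerous μ).powerset, ∑ h ∈ F with lowest μ h = c,
        markedTerm M m s κ Γ μ a h F := by
  unfold markedSum
  simp only [Finset.sum_filter]
  rw [Finset.sum_comm]
  refine Finset.sum_congr rfl fun μ _ => ?_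
  have h1 : ∀ h : Γ.Sub, (if h ∈ Γ.dangerous μ ∧ lowest μ h = c then
      ∑ F ∈ (Γ.dangerous μ).powerset,
        if h ∈ F then markedTerm M m s κ Γ μ a h F else 0 else 0) =
      ∑ F ∈ (Γ.dangerous μ).powerset, if h ∈ F then
        (if lowest μ h = c then markedTerm M m s κ Γ μ a h F else 0) else 0 := by
    intro h
    by_cases hc : lowest μ h = c
    · by_cases hD : h ∈ Γ.dangerous μ
      · simp only [if_pos hc, if_pos (And.intro hD hc)]
      · rw [if_neg fun h => hD h.1]
        refine (Finset.sum_eq_zero fun F hF => if_neg fun hh => ?_).symm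
        exact hD (Finset.mem_powerset.1 hF hh)
    · simp only [if_neg hc, ite_self, Finset.sum_const_zero, if_neg fun h => hc (And.right h)]
  rw [Finset.sum_congr rfl fun h _ => h1 h, Finset.sum_comm]
  refine Finset.sum_congr rfl fun F _ => ?_
  rw [Finset.sum_ite_mem, Finset.univ_inter]

open Classical in
/-- The insertion of four-point graphs in the vertices of graphs gives the graphs with a marked
four-point subgraph. -/
theorem insertion (ρ : ℕ) (hM : 1 < M) (hm : 0 < m) (hs : ∀ j < c, s j = 0) {r k N : ℕ}
    (hk : 0 < k) (a : 𝓢(Fin N → Space, ℝ)) :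
    weight (r + k) • ∑ Γ ∈ graphs (r + k) N, ∑ h : Γ.Sub with (Γ.verts h).card = k,
      markedSum M m s κ c ρ a Γ h =
    (weight k • ∑ H ∈ graphs k 4, flowSum M m s κ c ρ H) *
      (weight (r + 1) • ∑ G ∈ graphs (r + 1) N, ∑ w, contractedSum M m s κ c ρ a G w) := by
  set X := ∑ H ∈ graphs k 4, flowSum M m s κ c ρ H with hX
  set Y := ∑ G ∈ graphs (r + 1) N, ∑ w, contractedSum M m s κ c ρ a G w with hY
  set Z := ∑ Γ ∈ graphs (r + k) N, ∑ h : Γ.Sub with (Γ.verts h).card = k,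
      markedSum M m s κ c ρ a Γ h with hZ
  -- For a fixed vertex set `U`, every one of the `r + 1` choices of `w` gives the same sum, so the
  -- marked vertex can be summed over freely.
  have h1 : ∀ U ∈ Finset.powersetCard k (Finset.univ : Finset (Fin (r + k))),
      X * Y = ((r + 1) * Nat.factorial 4) • ∑ Γ ∈ graphs (r + k) N,
        ∑ h : Γ.Sub with Γ.verts h = U, markedSum M m s κ c ρ a Γ h := by
    intro U hU
    have hUk := (Finset.mem_powersetCard.1 hU).2
    have h2 : ∀ w : Fin (r + 1), X * ∑ G ∈ graphs (r + 1) N, contractedSum M m s κ c ρ a G w =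
        Nat.factorial 4 • ∑ Γ ∈ graphs (r + k) N,
          ∑ h : Γ.Sub with Γ.verts h = U, markedSum M m s κ c ρ a Γ h := by
      intro w
      obtain ⟨S, hSw, hSU⟩ := Splitting.exists_of_card hk U hUk w
      have h3 := sum_flowSum_mul_sum_contractedSum κ ρ hM hm hs S a
      rwa [hSw, hSU] at h3
    rw [hY, Finset.sum_comm, Finset.mul_sum, Finset.sum_congr rfl fun w _ => h2 w,
      Finset.sum_const, Finset.card_univ, Fintype.card_fin, smul_smul]
  -- Summation over the `(r + k).choose k` vertex sets. Together with `r + 1` and `4!` this is what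
  -- turns `weight (r + k)` into `weight k * weight (r + 1)`.
  have h2 : ((r + k).choose k) • (X * Y) = ((r + 1) * Nat.factorial 4) • Z := by
    have h3 := Finset.sum_congr rfl h1
    rw [Finset.sum_const, Finset.card_powersetCard, Finset.card_univ, Fintype.card_fin,
      ← Finset.smul_sum, Finset.sum_comm] at h3
    rw [h3]
    congr 1
    refine Finset.sum_congr rfl fun Γ _ => ?_
    rw [← Finset.sum_fiberwise_of_maps_to (s := Finset.univ.filter fun h : Γ.Sub =>
      (Γ.verts h).card = k) (t := Finset.powersetCard k (Finset.univ : Finset (Fin (r + k))))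
      (g := fun h => Γ.verts h) fun h hh => Finset.mem_powersetCard.2
        ⟨Finset.subset_univ _, (Finset.mem_filter.1 hh).2⟩]
    refine Finset.sum_congr rfl fun U hU => Finset.sum_congr ?_ fun _ _ => rfl
    ext h
    simp only [Finset.mem_filter, Finset.mem_univ, true_and]
    exact ⟨fun hh => ⟨hh ▸ (Finset.mem_powersetCard.1 hU).2, hh⟩, fun hh => hh.2⟩
  have h3 : ((r + k).choose k : ℝ) • (X * Y) = ((r + 1) * Nat.factorial 4 : ℝ) • Z := by
    have := h2
    rw [← Nat.cast_smul_eq_nsmul ℝ, ← Nat.cast_smul_eq_nsmul ℝ] at this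
    push_cast at this
    exact this
  have h4 : Z = (((r + 1) * Nat.factorial 4 : ℝ)⁻¹ * (r + k).choose k) • (X * Y) := by
    rw [mul_smul, h3, smul_smul, inv_mul_cancel₀ (by positivity), one_smul]
  have h5 : ((r + k).choose k : ℝ) = (r + k).factorial / (r.factorial * k.factorial) := by
    rw [eq_div_iff (by positivity), ← mul_assoc]
    exact_mod_cast Nat.add_choose_mul_factorial_mul_factorial r k
  rw [h4, smul_smul, smul_mul_smul_comm]
  congr 1
  rw [h5]
  unfold weight
  rw [Nat.factorial_succ r]
  push_cast
  field_simp
  ring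

end FeynmanGraph

/-! ### Weighted sums over forests -/

open FeynmanGraph

theorem graphs_zero (N : ℕ) : graphs 0 N = ∅ := by
  ext G
  rw [mem_graphs]
  simp only [Finset.notMem_empty, iff_false]
  exact fun h => absurd h.1.1 (lt_irrefl 0)

section ForestSum

variable {A B : Type*} [CommRing A] [Algebra ℝ A] [CommRing B] [Algebra ℝ B]

/-- The sum over the graphs with `n` vertices and over the forests of dangerous subgraphs, each
element of the forest and each vertex having a weight that depends on its scale. -/
noncomputable def forestSum (M m : ℝ) (s κ : ℤ → A) (ρ : ℕ) {N : ℕ} (a : (Fin N → Space) → ℝ)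
    (n : ℕ) : A :=
  weight n • ∑ G ∈ graphs n N, ∑ μ : G.Scales ρ, ∑ F ∈ (G.dangerous μ).powerset,
    G.amplitude M m μ F a • forestWeight s κ μ F Finset.univ

theorem map_forestSum (M m : ℝ) (s κ : ℤ → A) (ρ : ℕ) {N : ℕ} (a : (Fin N → Space) → ℝ)
    (n : ℕ) (φ : A →ₐ[ℝ] B) :
    φ (forestSum M m s κ ρ a n) = forestSum M m (φ ∘ s) (φ ∘ κ) ρ a n := by
  simp only [forestSum, forestWeight, map_smul, map_sum, map_mul, map_prod, Function.comp_apply]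

/-- The contributions of the graphs of which one vertex, of scale below `c`, is marked. -/
noncomputable def contractedTerm (M m : ℝ) (s κ : ℤ → A) (c : ℤ) (ρ : ℕ) {N : ℕ}
    (a : (Fin N → Space) → ℝ) (n : ℕ) : A :=
  weight n • ∑ G ∈ graphs n N, ∑ w, contractedSum M m s κ c ρ a G w

/-- The contributions of the graphs of which one dangerous subgraph, of scale `c`, is marked. -/
noncomputable def markedTotal (M m : ℝ) (s κ : ℤ → A) (c : ℤ) (ρ : ℕ) {N : ℕ}
    (a : (Fin N → Space) → ℝ) (n : ℕ) : A :=
  weight n • ∑ Γ ∈ graphs n N, ∑ h : Γ.Sub, markedSum M m s κ c ρ a Γ h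

theorem contractedTerm_zero (M m : ℝ) (s κ : ℤ → A) (c : ℤ) (ρ : ℕ) {N : ℕ}
    (a : (Fin N → Space) → ℝ) : contractedTerm M m s κ c ρ a 0 = 0 := by
  rw [contractedTerm, graphs_zero, Finset.sum_empty, smul_zero]

/-- The marked subgraphs are sorted by their number `k` of vertices. Contraction replaces `k`
vertices by one, which leaves `n - k + 1`. -/
theorem markedTotal_eq {M m : ℝ} (hM : 1 < M) (hm : 0 < m) {s : ℤ → A} (κ : ℤ → A) {c : ℤ}
    (hs : ∀ j < c, s j = 0) (ρ : ℕ) {N : ℕ} (a : 𝓢(Fin N → Space, ℝ)) (n : ℕ) :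
    markedTotal M m s κ c ρ a n = ∑ k ∈ Finset.range (n + 1),
      (weight k • ∑ H ∈ graphs k 4, flowSum M m s κ c ρ H) *
        contractedTerm M m s κ c ρ a (n - k + 1) := by
  classical
  have h1 : markedTotal M m s κ c ρ a n = ∑ k ∈ Finset.range (n + 1),
      weight n • ∑ Γ ∈ graphs n N, ∑ h : Γ.Sub with (Γ.verts h).card = k,
        markedSum M m s κ c ρ a Γ h := by
    rw [markedTotal, ← Finset.smul_sum, Finset.sum_comm]
    congr 1
    refine Finset.sum_congr rfl fun Γ _ => ?_
    refine (Finset.sum_fiberwise_of_maps_to (fun h _ => ?_) _).symm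
    rw [Finset.mem_range, Nat.lt_succ_iff]
    exact (Finset.card_le_univ _).trans (Fintype.card_fin n).le
  rw [h1]
  refine Finset.sum_congr rfl fun k hk => ?_
  rcases Nat.eq_zero_or_pos k with rfl | hkpos
  · rw [graphs_zero, Finset.sum_empty, smul_zero, zero_mul]
    rw [Finset.sum_eq_zero, smul_zero]
    refine fun Γ _ => Finset.sum_eq_zero fun h hh => Finset.sum_eq_zero fun μ hμ => ?_
    have h2 := Finset.card_eq_zero.1 (Finset.mem_filter.1 hh).2
    obtain ⟨l, hl⟩ := nonempty_of_mem_dangerous (Finset.mem_filter.1 hμ).2.1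
    obtain ⟨⟨e, e'⟩, hee⟩ := Quot.exists_rep l.1
    have he : e ∈ l.1 := by rw [← hee]; exact Sym2.mem_mk_left _ _
    have := Γ.mem_verts_of_mem hl he
    rw [h2] at this
    exact absurd this (Finset.notMem_empty _)
  · have hkn : n - k + k = n := Nat.sub_add_cancel (Nat.lt_succ_iff.1 (Finset.mem_range.1 hk))
    have h3 := insertion (r := n - k) κ ρ hM hm hs hkpos a
    rw [hkn] at h3
    exact h3

theorem pow_dvd_prod {R ι : Type*} [CommRing R] (V : Finset ι) (f : ι → R) {x : R} (h : ∀ i ∈ V, x ∣ f i) :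
    x ^ V.card ∣ ∏ i ∈ V, f i := by
  rw [← Finset.prod_const]
  exact Finset.prod_dvd_prod_of_dvd _ _ h

theorem dvd_real_smul {x y : A} (r : ℝ) (h : x ∣ y) : x ∣ r • y := by
  rw [Algebra.smul_def]
  exact h.mul_left _

/-- The marked vertex carries no coupling constant, so one power is lost. -/
theorem pow_dvd_contractedTerm (M m : ℝ) (s : ℤ → A) {κ : ℤ → A} (c : ℤ) (ρ : ℕ) {N : ℕ}
    (a : (Fin N → Space) → ℝ) {x : A} (hx : ∀ e, x ∣ κ e) (r : ℕ) :
    x ^ r ∣ contractedTerm M m s κ c ρ a (r + 1) := by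
  classical
  refine dvd_real_smul _ (Finset.dvd_sum fun G _ => Finset.dvd_sum fun w _ =>
    Finset.dvd_sum fun μ _ => Finset.dvd_sum fun F _ => dvd_real_smul _ (Dvd.dvd.mul_left ?_ _))
  have := pow_dvd_prod ((Finset.univ : Finset (Fin (r + 1))).erase w)
    (fun v => κ (G.vertexScale μ v)) fun v _ => hx _
  rwa [Finset.card_erase_of_mem (Finset.mem_univ w), Finset.card_univ, Fintype.card_fin,
    Nat.add_sub_cancel] at this

end ForestSum

/-! ### Polynomial interpolation across one scale -/

section Polynomial

open Polynomial

variable {R : Type*} [CommRing R] [Algebra ℝ R]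

/-- The difference is the sum of the coefficients of positive degree. Each is a coefficient of the
derivative divided by a positive integer, which is invertible in an algebra over `ℝ`. -/
theorem dvd_eval_one_sub_eval_zero {x : R} {P : R[X]} (h : C x ∣ derivative P) :
    x ∣ P.eval 1 - P.eval 0 := by
  rw [C_dvd_iff_dvd_coeff] at h
  have h1 : ∀ i, x ∣ P.coeff (i + 1) := by
    intro i
    have h2 := h i
    rw [coeff_derivative] at h2
    have h3 : P.coeff (i + 1) =
        P.coeff (i + 1) * (i + 1) * algebraMap ℝ R ((i + 1 : ℝ)⁻¹) := by
      have : ((i : R) + 1) = algebraMap ℝ R (i + 1) := by simp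
      rw [mul_assoc, this, ← map_mul, mul_inv_cancel₀ (by positivity), map_one, mul_one]
    rw [h3]
    exact h2.mul_right _
  rw [eval_eq_sum_range, Finset.sum_range_succ', ← coeff_zero_eq_eval_zero]
  simp only [one_pow, mul_one, add_sub_cancel_right]
  exact Finset.dvd_sum fun i _ => h1 i

/-- The weight of the subtractions when those of scale `c` are switched on. -/
noncomputable def switchedSign (c j : ℤ) : R[X] :=
  if c < j then -1 else if j = c then -X else 0

/-- The coupling constants when `δ` is switched on below the scale `c`. -/
noncomputable def switchedCoupling (κ : ℤ → R) (δ : R) (c e : ℤ) : R[X] :=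
  C (κ e) + if e < c then X * C δ else 0

theorem derivative_switchedSign {S : Type*} [CommRing S] (c j : ℤ) :
    derivative (switchedSign c j : S[X]) = if j = c then -1 else 0 := by
  unfold switchedSign
  split_ifs with h1 h2 h2
  · omega
  · simp
  · simp
  · simp

theorem derivative_switchedCoupling {S : Type*} [CommRing S] (κ : ℤ → S) (δ : S) (c e : ℤ) :
    derivative (switchedCoupling κ δ c e) = if e < c then C δ else 0 := by
  unfold switchedCoupling
  split_ifs <;> simp

/-- The Leibniz rule marks either a vertex, with factor `δ` if its scale is below `c`, or an element
of the forest, with factor `-1` if its lowest scale is `c`. -/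
theorem derivative_forestWeight {S : Type*} [CommRing S] (κ : ℤ → S) (δ : S) (c : ℤ)
    {n N ρ : ℕ} {G : FeynmanGraph n N}
    (μ : G.Scales ρ) (F : Finset G.Sub) :
    open Classical in
    derivative (forestWeight (switchedSign c) (switchedCoupling κ δ c) μ F Finset.univ) =
      C δ * (∑ w with G.vertexScale μ w < c,
        forestWeight (switchedSign c) (switchedCoupling κ δ c) μ F (Finset.univ.erase w)) -
      ∑ h ∈ F with lowest μ h = c,
        forestWeight (switchedSign c) (switchedCoupling κ δ c) μ (F.erase h) Finset.univ := by
  classical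
  unfold forestWeight
  rw [derivative_mul, derivative_prod_finset, derivative_prod_finset, Finset.sum_filter,
    Finset.sum_filter, Finset.mul_sum, Finset.mul_sum, Finset.sum_mul, add_comm, sub_eq_add_neg,
    ← Finset.sum_neg_distrib]
  congr 1
  · refine Finset.sum_congr rfl fun w _ => ?_
    rw [derivative_switchedCoupling]
    split_ifs
    · ring
    · ring
  · refine Finset.sum_congr rfl fun h _ => ?_
    rw [derivative_switchedSign]
    split_ifs
    · ring
    · ring

theorem derivative_forestSum (M m : ℝ) (κ : ℤ → R) (δ : R) (c : ℤ) (ρ : ℕ) {N : ℕ}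
    (a : (Fin N → Space) → ℝ) (n : ℕ) :
    derivative (forestSum M m (switchedSign c) (switchedCoupling κ δ c) ρ a n) =
      C δ * contractedTerm M m (switchedSign c) (switchedCoupling κ δ c) c ρ a n -
        markedTotal M m (switchedSign c) (switchedCoupling κ δ c) c ρ a n := by
  classical
  unfold forestSum contractedTerm markedTotal
  rw [derivative_smul, mul_smul_comm, ← smul_sub, derivative_sum, Finset.mul_sum,
    ← Finset.sum_sub_distrib]
  congr 1
  refine Finset.sum_congr rfl fun G _ => ?_
  rw [sum_markedSum, derivative_sum]
  unfold contractedSum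
  simp only [Finset.sum_filter]
  rw [Finset.sum_comm, Finset.mul_sum, ← Finset.sum_sub_distrib]
  refine Finset.sum_congr rfl fun μ _ => ?_
  rw [derivative_sum]
  have h1 : ∑ w, (if G.vertexScale μ w < c then ∑ F ∈ (G.dangerous μ).powerset,
        G.amplitude M m μ F a • forestWeight (switchedSign c) (switchedCoupling κ δ c) μ F
          (Finset.univ.erase w) else 0) =
      ∑ F ∈ (G.dangerous μ).powerset, ∑ w, if G.vertexScale μ w < c then
        G.amplitude M m μ F a • forestWeight (switchedSign c) (switchedCoupling κ δ c) μ F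
          (Finset.univ.erase w) else 0 := by
    rw [Finset.sum_comm]
    refine Finset.sum_congr rfl fun w _ => ?_
    split_ifs
    · rfl
    · rw [Finset.sum_const_zero]
  rw [h1, Finset.mul_sum, ← Finset.sum_sub_distrib]
  refine Finset.sum_congr rfl fun F _ => ?_
  rw [derivative_smul, derivative_forestWeight, smul_sub, ← mul_smul_comm, Finset.smul_sum,
    Finset.smul_sum, Finset.sum_filter, Finset.sum_filter]
  rfl

end Polynomial

open FeynmanGraph

/-! ### Which scales enter the flow -/

section Flow

namespace FeynmanGraph

variable {k N ρ : ℕ} {H : FeynmanGraph k N} {μ : H.Scales ρ} {c : ℤ}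

theorem le_vertexScale_of_lowestScale (hH : H.Connected) (hc : H.LowestScale μ c) (v : Fin k) :
    c ≤ H.vertexScale μ v := by
  obtain ⟨⟨l₀, -⟩, h⟩ := hc
  have hv : v ∈ H.verts Finset.univ := by
    rw [H.verts_univ_of_line hH l₀]
    exact Finset.mem_univ v
  obtain ⟨l, -, hl⟩ := mem_verts_iff_attached.1 hv
  exact (h l).trans ((vertexScale_le_iff.1 le_rfl).2 l hl)

/-- By connectedness some line outside `f` is attached to `f`. It has scale at least `c` and lies
strictly below all the lines of `f`. -/
theorem lt_lowest_of_mem_dangerous (hH : H.Connected) (hc : H.LowestScale μ c) {f : H.Sub}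
    (hf : f ∈ H.dangerous μ) (hfu : f ≠ Finset.univ) : c < lowest μ f := by
  have hq := (H.mem_dangerous.1 hf).1
  obtain ⟨l₀, hl₀⟩ := nonempty_of_mem_dangerous hf
  obtain ⟨⟨e, e'⟩, hee⟩ := Quot.exists_rep l₀.1
  have hv := H.mem_verts_of_mem hl₀ (e := e) (hee ▸ Sym2.mem_mk_left _ _)
  obtain ⟨l', -, hl'f, w, hw, hlw⟩ := H.exists_line_of_not_subset
    (H.subConnected_univ hH l₀) (H.mem_verts_of_mem (Finset.mem_univ l₀) (e := e)
      (hee ▸ Sym2.mem_mk_left _ _)) hv fun h => hfu (Finset.univ_subset_iff.1 h)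
  rw [← Int.add_one_le_iff, le_lowest_iff ⟨l₀, hl₀⟩]
  intro l hl
  have h1 : (μ l' : ℕ) < μ l := hq.2 l hl l' hl'f ⟨w, hw, hlw⟩
  have h2 := hc.2 l'
  omega

theorem lowest_le {f : H.Sub} (hf : f.Nonempty) : lowest μ f ≤ ρ := by
  obtain ⟨l, -, hl⟩ := exists_eq_lowest (μ := μ) hf
  have := (μ l).2
  omega

theorem lowest_nonneg {f : H.Sub} (hf : f.Nonempty) : 0 ≤ lowest μ f :=
  (le_lowest_iff hf).2 fun _ _ => by omega

end FeynmanGraph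

-- The result is constant in the switching parameter: proper dangerous subgraphs have lowest scale
-- above `i + 1`, hence weight `-1`, and the vertices have scale at least `i + 1`, hence unmodified
-- constants.
open Polynomial in
theorem flowSum_switched (M m : ℝ) (Λ : ℤ → ℝ⟦X⟧) (δ : ℝ⟦X⟧) (i : ℤ) (ρ k : ℕ) :
    weight k • ∑ H ∈ graphs k 4, flowSum M m (switchedSign (i + 1))
      (switchedCoupling (fun e => -Λ e) δ (i + 1)) (i + 1) ρ H =
      C (flowTerm M m ρ Λ i k) := by
  classical
  rw [flowTerm, ← smul_C, map_sum]
  congr 1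
  refine Finset.sum_congr rfl fun H hH => ?_
  have hconn := (mem_graphs.1 hH).1
  rw [map_sum]
  unfold flowSum
  refine Finset.sum_congr (by congr) fun μ hμ => ?_
  have hc := (Finset.mem_filter.1 hμ).2
  rw [renLocalPart, Finset.sum_smul, map_sum]
  refine Finset.sum_congr (by congr) fun F hF => ?_
  have h1 : ∏ f ∈ F, (switchedSign (i + 1) (lowest μ f) : ℝ⟦X⟧[X]) = (-1) ^ F.card := by
    rw [← Finset.prod_const]
    refine Finset.prod_congr rfl fun f hf => ?_
    have h2 := Finset.mem_erase.1 (Finset.mem_powerset.1 hF hf)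
    rw [switchedSign, if_pos (lt_lowest_of_mem_dangerous hconn hc h2.2 h2.1)]
  have h3 : ∏ v, switchedCoupling (fun e => -Λ e) δ (i + 1) (H.vertexScale μ v) =
      C (∏ v, -Λ (H.vertexScale μ v)) := by
    rw [map_prod]
    refine Finset.prod_congr rfl fun v _ => ?_
    rw [switchedCoupling, if_neg (le_vertexScale_of_lowestScale hconn hc v).not_gt, add_zero]
  rw [forestWeight, h1, h3, mul_comm ((-1 : ℝ) ^ _), mul_smul, ← smul_C, ← smul_C]
  congr 1
  rcases neg_one_pow_eq_or ℝ F.card with h | h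
  · rcases Nat.even_or_odd F.card with he | ho
    · rw [he.neg_one_pow, he.neg_one_pow, one_smul, one_mul]
    · rw [ho.neg_one_pow] at h; norm_num at h
  · rcases Nat.even_or_odd F.card with he | ho
    · rw [he.neg_one_pow] at h; norm_num at h
    · rw [ho.neg_one_pow, ho.neg_one_pow, neg_one_smul, neg_one_mul]

theorem X_pow_dvd_flowTerm (M m : ℝ) (ρ : ℕ) {Λ : ℤ → ℝ⟦X⟧} (hΛ : ∀ e, PowerSeries.X ∣ Λ e)
    (i : ℤ) (n : ℕ) : PowerSeries.X ^ n ∣ flowTerm M m ρ Λ i n := by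
  classical
  refine dvd_real_smul _ (Finset.dvd_sum fun G _ => Finset.dvd_sum fun μ _ => dvd_real_smul _ ?_)
  have := pow_dvd_prod (Finset.univ : Finset (Fin n)) (fun v => -Λ (G.vertexScale μ v))
    (x := PowerSeries.X) fun v _ => (hΛ _).neg_right
  rwa [Finset.card_univ, Fintype.card_fin] at this

theorem flowTerm_zero (M m : ℝ) (ρ : ℕ) (Λ : ℤ → ℝ⟦X⟧) (i : ℤ) : flowTerm M m ρ Λ i 0 = 0 := by
  rw [flowTerm, graphs_zero, Finset.sum_empty, smul_zero]

/-- This makes the recursion well founded: the flow to the scale `i` uses only the constants of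
higher scales. -/
theorem flowTerm_congr (M m : ℝ) (ρ : ℕ) {Λ Λ' : ℤ → ℝ⟦X⟧} {i : ℤ}
    (h : ∀ e, i + 1 ≤ e → Λ e = Λ' e) : flowTerm M m ρ Λ i = flowTerm M m ρ Λ' i := by
  classical
  ext1 n
  unfold flowTerm
  congr 1
  refine Finset.sum_congr rfl fun H hH => Finset.sum_congr rfl fun μ hμ => ?_
  congr 1
  refine Finset.prod_congr rfl fun v _ => ?_
  rw [h _ (le_vertexScale_of_lowestScale (mem_graphs.1 hH).1 (Finset.mem_filter.1 hμ).2 v)]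

end Flow

/-! ### Formal sums of power series and convolutions -/

section FormalSum

/-- The sum of a sequence of power series of which the term `n` is divisible by `X ^ n`. -/
noncomputable def formalSum (T : ℕ → ℝ⟦X⟧) : ℝ⟦X⟧ :=
  PowerSeries.mk fun k => PowerSeries.coeff k (∑ n ∈ Finset.range (k + 1), T n)

variable {T : ℕ → ℝ⟦X⟧}

theorem coeff_sum_range_eq_formalSum (hT : ∀ n, PowerSeries.X ^ n ∣ T n) {k p : ℕ} (hk : k < p) :
    PowerSeries.coeff k (∑ n ∈ Finset.range p, T n) = PowerSeries.coeff k (formalSum T) := by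
  rw [formalSum, PowerSeries.coeff_mk, map_sum, map_sum]
  refine (Finset.sum_subset (Finset.range_mono hk) fun n _ hn => ?_).symm
  exact PowerSeries.X_pow_dvd_iff.1 (hT n) k (by rw [Finset.mem_range] at hn; omega)

theorem formalHasSum_formalSum (hT : ∀ n, PowerSeries.X ^ n ∣ T n) :
    FormalHasSum T (formalSum T) := fun k => by
  filter_upwards [Filter.eventually_gt_atTop k] with p hp
  exact coeff_sum_range_eq_formalSum hT hp

theorem X_pow_dvd_formalSum_sub (hT : ∀ n, PowerSeries.X ^ n ∣ T n) (p : ℕ) :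
    PowerSeries.X ^ p ∣ formalSum T - ∑ n ∈ Finset.range p, T n := by
  rw [PowerSeries.X_pow_dvd_iff]
  intro k hk
  rw [map_sub, coeff_sum_range_eq_formalSum hT hk, sub_self]

theorem FormalHasSum.of_dvd_sub {T' : ℕ → ℝ⟦X⟧} {S : ℝ⟦X⟧} (hT : FormalHasSum T S)
    (h : ∀ p, PowerSeries.X ^ p ∣ ∑ n ∈ Finset.range p, T' n - ∑ n ∈ Finset.range p, T n) :
    FormalHasSum T' S := fun k => by
  filter_upwards [hT k, Filter.eventually_gt_atTop k] with p hp hk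
  rw [← hp, ← sub_eq_zero, ← map_sub]
  exact PowerSeries.X_pow_dvd_iff.1 (h p) k hk

end FormalSum

/-- With `r = n - k`, the truncated difference is the sum over `r < p` of `(δ - ∑ k < p - r, D k) *
I (r + 1)`, divisible by `x ^ (p - r) * x ^ r`, up to the boundary term `δ * I p`. The latter is
divisible by `x * x ^ (p - 1)` because `D 0 = 0` makes `x` divide `δ`. -/
theorem pow_dvd_sum_sub_sum_convolution {A : Type*} [CommRing A] {x δ : A} {D I : ℕ → A}
    (hD : D 0 = 0) (hδ : ∀ p, x ^ p ∣ δ - ∑ k ∈ Finset.range p, D k)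
    (hI : ∀ r, x ^ r ∣ I (r + 1)) (hI0 : I 0 = 0) (p : ℕ) :
    x ^ p ∣ ∑ n ∈ Finset.range p, (δ * I n - ∑ k ∈ Finset.range (n + 1), D k * I (n - k + 1)) := by
  have h1 : ∑ n ∈ Finset.range p, ∑ k ∈ Finset.range (n + 1), D k * I (n - k + 1) =
      ∑ r ∈ Finset.range p, ∑ k ∈ Finset.range (p - r), D k * I (r + 1) := by
    rw [← Finset.sum_range_diag_flip p fun r k => D k * I (r + 1)]
    refine Finset.sum_congr rfl fun n _ => ?_
    rw [← Finset.sum_flip]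
    refine Finset.sum_congr rfl fun k hk => ?_
    have := Finset.mem_range.1 hk
    rw [show n - (n - k) = k by omega]
  have h2 : ∑ n ∈ Finset.range p, δ * I n = ∑ r ∈ Finset.range p, δ * I (r + 1) - δ * I p := by
    rw [eq_sub_iff_add_eq, ← Finset.sum_range_succ, Finset.sum_range_succ', hI0, mul_zero,
      add_zero]
  have h3 : x ∣ δ := by
    have := hδ 1
    rwa [pow_one, Finset.sum_range_one, hD, sub_zero] at this
  rw [Finset.sum_sub_distrib, h1, h2, sub_right_comm, ← Finset.sum_sub_distrib]
  refine dvd_sub (Finset.dvd_sum fun r hr => ?_) ?_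
  · rw [← Finset.sum_mul, ← sub_mul, ← Nat.sub_add_cancel (Finset.mem_range.1 hr).le, pow_add,
      Nat.sub_add_cancel (Finset.mem_range.1 hr).le]
    exact mul_dvd_mul (hδ _) (hI r)
  · cases p with
    | zero => rw [hI0, mul_zero]; exact dvd_zero _
    | succ p =>
      rw [pow_succ, mul_comm]
      exact mul_dvd_mul h3 (hI p)

/-! ### Descent through the scales -/

open Polynomial in
theorem X_pow_dvd_forestSum_sub {M m : ℝ} (hM : 1 < M) (hm : 0 < m) {Λ : ℤ → ℝ⟦X⟧}
    (hΛ : ∀ e, PowerSeries.X ∣ Λ e) (i : ℤ) (ρ : ℕ) {N : ℕ} (a : 𝓢(Fin N → Space, ℝ)) (p : ℕ) :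
    PowerSeries.X ^ p ∣
      ∑ n ∈ Finset.range p, forestSum M m (fun j => if i + 1 ≤ j then (-1 : ℝ⟦X⟧) else 0)
        (fun e => -Λ e + if e ≤ i then formalSum (flowTerm M m ρ Λ i) else 0) ρ a n -
      ∑ n ∈ Finset.range p, forestSum M m (fun j => if i + 1 < j then (-1 : ℝ⟦X⟧) else 0)
        (fun e => -Λ e) ρ a n := by
  set δ := formalSum (flowTerm M m ρ Λ i) with hδ
  have hT := X_pow_dvd_flowTerm M m ρ hΛ i
  have hδp := X_pow_dvd_formalSum_sub hT
  have hδ1 : PowerSeries.X ∣ δ := by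
    have := hδp 1
    rwa [pow_one, Finset.sum_range_one, flowTerm_zero, sub_zero] at this
  -- The polynomial variable is the switching parameter; the coupling constant of the cutoff is
  -- `PowerSeries.X`, a scalar here. The values at `0` and `1` are the sums before and after
  -- crossing the scale `i + 1`.
  set s : ℤ → ℝ⟦X⟧[X] := switchedSign (i + 1) with hs
  set κ : ℤ → ℝ⟦X⟧[X] := switchedCoupling (fun e => -Λ e) δ (i + 1) with hκ
  set P : ℝ⟦X⟧[X] := ∑ n ∈ Finset.range p, forestSum M m s κ ρ a n with hP
  have heval : ∀ t : ℝ⟦X⟧, P.eval t = ∑ n ∈ Finset.range p,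
      forestSum M m (fun j => (s j).eval t) (fun e => (κ e).eval t) ρ a n := by
    intro t
    rw [hP, eval_finsetSum]
    refine Finset.sum_congr rfl fun n _ => ?_
    have := map_forestSum M m s κ ρ a n ((aeval t).restrictScalars ℝ : ℝ⟦X⟧[X] →ₐ[ℝ] ℝ⟦X⟧)
    simpa only [AlgHom.restrictScalars_apply, coe_aeval_eq_eval, Function.comp_def] using this
  have h1 : P.eval 1 = ∑ n ∈ Finset.range p,
      forestSum M m (fun j => if i + 1 ≤ j then (-1 : ℝ⟦X⟧) else 0)
        (fun e => -Λ e + if e ≤ i then δ else 0) ρ a n := by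
    rw [heval]
    refine Finset.sum_congr rfl fun n _ => ?_
    congr 1
    · ext1 j
      rw [hs, switchedSign]
      split_ifs <;> first | omega | simp
    · ext1 e
      rw [hκ, switchedCoupling]
      split_ifs <;> first | omega | simp
  have h0 : P.eval 0 = ∑ n ∈ Finset.range p,
      forestSum M m (fun j => if i + 1 < j then (-1 : ℝ⟦X⟧) else 0) (fun e => -Λ e) ρ a n := by
    rw [heval]
    refine Finset.sum_congr rfl fun n _ => ?_
    congr 1
    · ext1 j
      rw [hs, switchedSign]
      split_ifs <;> simp
    · ext1 e
      rw [hκ, switchedCoupling]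
      split_ifs <;> simp
  rw [← h1, ← h0]
  refine dvd_eval_one_sub_eval_zero ?_
  have h2 : derivative P = ∑ n ∈ Finset.range p,
      (C δ * contractedTerm M m s κ (i + 1) ρ a n - ∑ k ∈ Finset.range (n + 1),
        C (flowTerm M m ρ Λ i k) * contractedTerm M m s κ (i + 1) ρ a (n - k + 1)) := by
    rw [hP, derivative_sum]
    refine Finset.sum_congr rfl fun n _ => ?_
    rw [hs, hκ, derivative_forestSum, markedTotal_eq hM hm]
    · simp only [flowSum_switched]
    · intro j hj
      rw [switchedSign, if_neg hj.not_gt, if_neg hj.ne]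
  rw [h2, C_pow]
  refine pow_dvd_sum_sub_sum_convolution (by rw [flowTerm_zero, C_0]) (fun q => ?_) (fun r => ?_)
    (contractedTerm_zero ..) p
  · rw [← C_pow, ← map_sum, ← C_sub]
    exact map_dvd C (hδp q)
  · refine pow_dvd_contractedTerm M m s _ ρ a (fun e => ?_) r
    rw [hκ, switchedCoupling]
    refine dvd_add (map_dvd C (hΛ e).neg_right) ?_
    split_ifs
    · exact (map_dvd C hδ1).mul_left _
    · exact dvd_zero _

/-- The effective constants down to the scale `ρ - j`, constant below. -/
noncomputable def couplings (M m : ℝ) (ρ : ℕ) : ℕ → ℤ → ℝ⟦X⟧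
  | 0 => fun _ => PowerSeries.X
  | j + 1 => fun e => couplings M m ρ j e -
      if e ≤ ρ - j - 1 then formalSum (flowTerm M m ρ (couplings M m ρ j) (ρ - j - 1)) else 0

theorem couplings_succ (M m : ℝ) (ρ j : ℕ) (e : ℤ) :
    couplings M m ρ (j + 1) e = couplings M m ρ j e -
      if e ≤ ρ - j - 1 then formalSum (flowTerm M m ρ (couplings M m ρ j) (ρ - j - 1)) else 0 :=
  rfl

theorem X_dvd_couplings (M m : ℝ) (ρ j : ℕ) (e : ℤ) : PowerSeries.X ∣ couplings M m ρ j e := by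
  induction j generalizing e with
  | zero => exact dvd_rfl
  | succ j ih =>
    rw [couplings_succ]
    refine dvd_sub (ih e) ?_
    split_ifs
    · have := X_pow_dvd_formalSum_sub (X_pow_dvd_flowTerm M m ρ ih (ρ - j - 1)) 1
      rwa [pow_one, Finset.sum_range_one, flowTerm_zero, sub_zero] at this
    · exact dvd_zero _

theorem couplings_eq_of_le (M m : ℝ) (ρ j : ℕ) {e e' : ℤ} (he : e ≤ ρ - j) (he' : e' ≤ ρ - j) :
    couplings M m ρ j e = couplings M m ρ j e' := by
  induction j with
  | zero => rfl
  | succ j ih =>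
    push_cast at he he'
    rw [couplings_succ, couplings_succ, ih (by omega) (by omega), if_pos (by omega), if_pos (by omega)]

/-- The step from `j` to `j + 1` modifies only scales up to `ρ - j - 1`, so a constant is final once
its scale is reached. -/
theorem couplings_stable (M m : ℝ) (ρ : ℕ) {j j' : ℕ} (h : j ≤ j') {e : ℤ} (he : ρ - j ≤ e) :
    couplings M m ρ j' e = couplings M m ρ j e := by
  induction j', h using Nat.le_induction with
  | base => rfl
  | succ j' h ih => rw [couplings_succ, if_neg (by omega), sub_zero, ih]

theorem formalHasSum_flowTerm (M m : ℝ) (ρ : ℕ) {i : ℤ} (hi : -1 ≤ i) (hiρ : i < ρ) :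
    FormalHasSum (flowTerm M m ρ (couplings M m ρ (ρ + 1)) i)
      (-couplings M m ρ (ρ + 1) i - (-couplings M m ρ (ρ + 1) (i + 1))) := by
  obtain ⟨j, hj⟩ : ∃ j : ℕ, (j : ℤ) = ρ - i - 1 := ⟨(ρ - i - 1).toNat, by omega⟩
  obtain rfl : i = ρ - j - 1 := by omega
  have h1 : flowTerm M m ρ (couplings M m ρ (ρ + 1)) (ρ - j - 1) =
      flowTerm M m ρ (couplings M m ρ j) (ρ - j - 1) :=
    flowTerm_congr M m ρ fun e he => couplings_stable M m ρ (by omega) (by omega)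
  have h2 : -couplings M m ρ (ρ + 1) (ρ - j - 1) - (-couplings M m ρ (ρ + 1) (ρ - j - 1 + 1)) =
      formalSum (flowTerm M m ρ (couplings M m ρ j) (ρ - j - 1)) := by
    -- The constants of scales `i` and `i + 1` agree at stage `j`; the next stage separates them by
    -- exactly one flow sum.
    rw [couplings_stable M m ρ (j := j + 1) (by omega) (by push_cast; omega), couplings_succ,
      if_pos le_rfl, couplings_stable M m ρ (j := j) (j' := ρ + 1) (by omega) (by omega),
      couplings_eq_of_le M m ρ j (e := ρ - j - 1) (e' := ρ - j - 1 + 1) (by omega) (by omega)]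
    ring
  rw [h1, h2]
  exact formalHasSum_formalSum (X_pow_dvd_flowTerm M m ρ (X_dvd_couplings M m ρ j) _)

/-- No line has a scale above `ρ`, so every nonempty forest has weight zero. -/
theorem forestSum_bare (M m : ℝ) (ρ : ℕ) {N : ℕ} (a : (Fin N → Space) → ℝ) (n : ℕ) :
    forestSum M m (fun j => if (ρ : ℤ) < j then (-1 : ℝ⟦X⟧) else 0) (fun _ => -PowerSeries.X) ρ a n =
      PowerSeries.monomial n (PowerSeries.coeff n (bareSeries M m ρ N a)) := by
  classical
  have h1 : ∀ (G : FeynmanGraph n N) (μ : G.Scales ρ), ∑ F ∈ (G.dangerous μ).powerset,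
      G.amplitude M m μ F a • forestWeight (fun j => if (ρ : ℤ) < j then (-1 : ℝ⟦X⟧) else 0)
        (fun _ => -PowerSeries.X) μ F Finset.univ =
      G.amplitude M m μ ∅ a • (-PowerSeries.X) ^ n := by
    intro G μ
    rw [Finset.sum_eq_single_of_mem ∅ (Finset.empty_mem_powerset _)]
    · simp [forestWeight]
    · intro F hF hne
      obtain ⟨f, hf⟩ := Finset.nonempty_iff_ne_empty.2 hne
      have h2 := lowest_le (μ := μ) (nonempty_of_mem_dangerous (Finset.mem_powerset.1 hF hf))
      rw [forestWeight, Finset.prod_eq_zero hf (if_neg h2.not_gt), zero_mul, smul_zero]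
  unfold forestSum
  simp only [h1, ← Finset.sum_smul]
  rw [bareSeries, PowerSeries.coeff_mk, smul_smul, neg_pow, PowerSeries.X_pow_eq]
  ext k
  have h3 : ((-1 : ℝ⟦X⟧)) ^ n = PowerSeries.C ((-1 : ℝ) ^ n) := by simp
  rw [h3, PowerSeries.coeff_smul, PowerSeries.coeff_C_mul, PowerSeries.coeff_monomial,
    PowerSeries.coeff_monomial]
  split_ifs
  · rw [smul_eq_mul]; ring
  · simp

theorem formalHasSum_forestSum_bare (M m : ℝ) (ρ : ℕ) {N : ℕ} (a : (Fin N → Space) → ℝ) :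
    FormalHasSum (forestSum M m (fun j => if (ρ : ℤ) < j then (-1 : ℝ⟦X⟧) else 0)
      (fun _ => -PowerSeries.X) ρ a) (bareSeries M m ρ N a) := fun k => by
  filter_upwards [Filter.eventually_gt_atTop k] with p hp
  simp only [map_sum, forestSum_bare, PowerSeries.coeff_monomial]
  rw [Finset.sum_ite_eq, if_pos (Finset.mem_range.2 hp)]

/-- All lowest scales are nonnegative, so each element of the forest contributes `-1`, as in the
expansion of the product of the `1 - τ_h`. -/
theorem forestSum_eq_effectiveTerm (M m : ℝ) (ρ : ℕ) (Λ : ℤ → ℝ⟦X⟧) {N : ℕ}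
    (a : (Fin N → Space) → ℝ) (n : ℕ) :
    forestSum M m (fun j => if 0 ≤ j then (-1 : ℝ⟦X⟧) else 0) (fun e => -Λ e) ρ a n =
      effectiveTerm M m ρ N Λ a n := by
  classical
  unfold forestSum effectiveTerm
  congr 1
  refine Finset.sum_congr rfl fun G _ => Finset.sum_congr rfl fun μ _ => ?_
  rw [renAmplitude, Finset.sum_smul]
  refine Finset.sum_congr rfl fun F hF => ?_
  have h1 : ∏ f ∈ F, (if 0 ≤ lowest μ f then (-1 : ℝ⟦X⟧) else 0) =
      algebraMap ℝ ℝ⟦X⟧ ((-1) ^ F.card) := by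
    rw [map_pow, map_neg, map_one, ← Finset.prod_const]
    exact Finset.prod_congr rfl fun f hf =>
      if_pos (lowest_nonneg (nonempty_of_mem_dangerous (Finset.mem_powerset.1 hF hf)))
  rw [forestWeight, h1, mul_comm ((-1 : ℝ) ^ _), mul_smul, ← Algebra.smul_def]

/-- The sum never changes along the descent. Stage `0` is the bare series, and stage `ρ + 1` has all
subtractions switched on. -/
theorem formalHasSum_forestSum_couplings {M m : ℝ} (hM : 1 < M) (hm : 0 < m) (ρ : ℕ) {N : ℕ}
    (a : 𝓢(Fin N → Space, ℝ)) (j : ℕ) :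
    FormalHasSum (forestSum M m (fun i => if (ρ : ℤ) - j < i then (-1 : ℝ⟦X⟧) else 0)
      (fun e => -couplings M m ρ j e) ρ a) (bareSeries M m ρ N a) := by
  induction j with
  | zero => simpa [couplings] using formalHasSum_forestSum_bare M m ρ a
  | succ j ih =>
    refine ih.of_dvd_sub fun p => ?_
    have h1 := X_pow_dvd_forestSum_sub hM hm (X_dvd_couplings M m ρ j) (ρ - j - 1) ρ a p
    have h2 : (fun i : ℤ => if (ρ : ℤ) - (j + 1 : ℕ) < i then (-1 : ℝ⟦X⟧) else 0) =
        fun i => if (ρ : ℤ) - j - 1 + 1 ≤ i then -1 else 0 := by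
      ext1 i
      exact if_congr (by push_cast; omega) rfl rfl
    have h3 : (fun e => -couplings M m ρ (j + 1) e) = fun e => -couplings M m ρ j e +
        if e ≤ ρ - j - 1 then formalSum (flowTerm M m ρ (couplings M m ρ j) (ρ - j - 1)) else 0 := by
      ext1 e
      rw [couplings_succ, neg_sub, sub_eq_add_neg, add_comm]
    have h4 : (fun i : ℤ => if (ρ : ℤ) - j < i then (-1 : ℝ⟦X⟧) else 0) =
        fun i => if (ρ : ℤ) - j - 1 + 1 < i then -1 else 0 := by
      ext1 i
      exact if_congr (by omega) rfl rfl
    rw [h2, h3, h4]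
    exact h1

end Phi4

theorem mainTheorem10 (M m : ℝ) (hM : 1 < M) (hm : 0 < m) (ρ : ℕ) :
    -- all the integrals below converge absolutely
    (∀ (n N : ℕ), ∀ G ∈ Phi4.graphs n N, ∀ μ : G.Scales ρ, ∀ F ⊆ G.dangerous μ,
      (∀ a : 𝓢(Fin N → Phi4.Space, ℝ), MeasureTheory.Integrable (G.integrand M m μ F a)) ∧
      ∀ v₀ : Fin n, MeasureTheory.Integrable
        (fun y : {v : Fin n // v ≠ v₀} → Phi4.Space =>
          G.lineProduct M m μ F (Phi4.FeynmanGraph.pinned v₀ y))) ∧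
    -- the effective constants `lam i`, `-1 ≤ i ≤ ρ`, as formal series in `λ_ρ`
    ∃ lam : ℤ → ℝ⟦X⟧, lam ρ = PowerSeries.X ∧
      -- they obey the recursion that gives `lam i` in terms of `lam (i + 1), …, lam ρ`
      (∀ i : ℤ, -1 ≤ i → i < ρ →
        Phi4.FormalHasSum (Phi4.flowTerm M m ρ lam i) (-lam i - (-lam (i + 1)))) ∧
      -- the bare series is the effective series
      ∀ (N : ℕ) (a : 𝓢(Fin N → Phi4.Space, ℝ)),
        Phi4.FormalHasSum (Phi4.effectiveTerm M m ρ N lam a) (Phi4.bareSeries M m ρ N a) := by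
  refine ⟨fun n N G hG μ F hF => ⟨fun a => G.integrable_integrand hM hm hG hF a,
    fun v₀ => G.integrable_pinned hM hm hG hF v₀⟩, Phi4.couplings M m ρ (ρ + 1), ?_,
    fun i hi hiρ => Phi4.formalHasSum_flowTerm M m ρ hi hiρ, fun N a => ?_⟩
  · exact Phi4.couplings_stable M m ρ (Nat.zero_le _) (by simp)
  · have h1 := Phi4.formalHasSum_forestSum_couplings hM hm ρ a (ρ + 1)
    have h2 : (fun i : ℤ => if (ρ : ℤ) - (ρ + 1 : ℕ) < i then (-1 : ℝ⟦X⟧) else 0) =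
        fun i => if 0 ≤ i then -1 else 0 := by
      ext1 i
      exact if_congr (by push_cast; omega) rfl rfl
    rw [h2] at h1
    rwa [← funext (Phi4.forestSum_eq_effectiveTerm M m ρ _ a)]
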